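/- Let $\gamma>1$. Consider one-dimensional cylindrically symmetric MHD flows of a polytropic gas with infinite electric conductivity in mass Lagrangian coordinates $(t,s)$, where $r>0$, $\rho>0$ and $H^r=A/r$ with a constant $A$. For $A\neq0$ the system, for the dependent variables $r,\theta,z,u,v,w,\rho,p,H^\theta,H^z$, is $$\rho_t=-\rho^2(ru)_s,\qquad u_t-\frac{v^2}{r}=-rp_s-\frac1{2r}\big(r^2(H^\theta)^2\big)_s-\frac r2\big((H^z)^2\big)_s,\qquad r_t=u,\qquad r_s=\frac1{r\rho},$$ $$v_t+\frac{uv}{r}=H^r(rH^\theta)_s,\qquad \theta_t=\frac vr,\qquad w_t=rH^rH^z_s,\qquad z_t=w,$$ $$p_t=-\gamma\rho p(ru)_s,\qquad H^\theta_t=r\rho\big((vH^r)_s-H^\theta u_s\big),\qquad H^z_t=\rho\big((rwH^r)_s-H^z(ru)_s\big).$$ For $A=0$ the system, for the dependent variables $r,\theta,u,v,\rho,p,H^\theta,H^z$, consists of the same equations with $H^r=0$, without the (separated) equations $w_t=0$, $z_t=w$. A generator is a smooth vector field $X=\xi^t\partial_t+\xi^s\partial_s+\sum_a\eta^a\partial_a$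 on an open set $U$ of the space of all independent and dependent variables (with $r,\rho>0$), where $a$ runs over the dependent variables and the coefficients depend on all these variables. The system admits $X$ (that is, $X$ is a Lie point symmetry) over $U$ if the first prolongation of $X$ annihilates every equation of the system at all points of the first jet space over $U$ at which all equations of the system hold. Below, $f_1,f_2$ are arbitrary functions that are smooth at the values which their arguments take. (1) Let $A\neq0$. Over every such $U$ the system admits $$X_1=\partial_t,\quad X_2=\partial_s,\quad X_3=t\partial_t+2s\partial_s-u\partial_u-v\partial_v-w\partial_w+2\rho\partial_\rho,$$ $$X_4=-2s\partial_s+r\partial_r+z\partial_z+u\partial_u+v\partial_v+w\partial_w-4\rho\partial_\rho-2p\partial_p-H^\theta\partial_{H^\theta}-H^z\partial_{H^z},$$ $$X_5=t\partial_z+\partial_w,\quad X_6=f_1\big(s,p/\rho^\gamma\big)\partial_\theta,\quad X_7=f_2\big(s,p/\rho^\gamma\big)\partial_z .$$ (2) Let $A=0$. Over every such $U$ the system admits $$X_1=\partial_t,\quad X_2=\partial_s,\quad X_3=t\partial_t+2s\partial_s-u\partial_u-v\partial_v+2\rho\partial_\rho,$$ $$X_4=-2s\partial_s+r\partial_r+u\partial_u+v\partial_v-4\rho\partial_\rho-2p\partial_p-H^\theta\partial_{H^\theta}-H^z\partial_{H^z},$$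 $$X_5=2s\partial_s+2\rho\partial_\rho+2p\partial_p+H^\theta\partial_{H^\theta}+H^z\partial_{H^z},\quad X_6=f_1\Big(s,rv,\frac p{\rho^\gamma},\frac{H^\theta}{r\rho},\frac{H^z}\rho\Big)\partial_\theta ,$$ and, if $\gamma=2$, also $$X_7=\rho f_2\Big(s,rv,\frac p{\rho^\gamma},\frac{H^\theta}{r\rho},\frac{H^z}\rho\Big)\big(\partial_{H^z}-H^z\partial_p\big).$$ (3) There are no other Lie point symmetries: if $U$ is connected, every generator admitted over $U$ has the form $a_1X_1+\dots+a_5X_5+X_6+X_7$ if $A\ne0$, or if $A=0$ and $\gamma=2$, and the form $a_1X_1+\dots+a_5X_5+X_6$ if $A=0$ and $\gamma\neq2$. Here $a_1,\dots,a_5$ are constants on $U$, and the functions $f_1,f_2$ are found near every point of $U$ (they may depend on the neighbourhood). -/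

import Mathlib

open scoped ContDiff

namespace MHD

/-! ### Lie point symmetries of first-order systems with independent variables `t`, `s` -/

/-- The space of independent and dependent variables `(t, s, q)`, where the dependent variables
`q` are indexed by `D`. -/
abbrev Base (D : Type) : Type := ℝ × ℝ × (D → ℝ)

/-- The first jet space: a point `(t, s, q)` together with values of all derivatives `q_t`
and `q_s`. -/
abbrev Jet (D : Type) : Type := Base D × (D → ℝ) × (D → ℝ)

section General

variable {D : Type}

/-- The value of the dependent variable `a`. -/
abbrev val (a : D) (y : Base D) : ℝ := y.2.2 a

/-- The derivative `a_t` of the dependent variable `a`, as a coordinate of the jet space. -/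
abbrev dt (a : D) (j : Jet D) : ℝ := j.2.1 a

/-- The derivative `a_s` of the dependent variable `a`, as a coordinate of the jet space. -/
abbrev ds (a : D) (j : Jet D) : ℝ := j.2.2 a

/-- The total derivative `D_t g = g_t + ∑ a, a_t * g_a` of a function `g` of `(t, s, q)`. -/
noncomputable def Dt [Fintype D] (g : Base D → ℝ) (j : Jet D) : ℝ :=
  fderiv ℝ g j.1 (1, 0, j.2.1)

/-- The total derivative `D_s g = g_s + ∑ a, a_s * g_a` of a function `g` of `(t, s, q)`. -/
noncomputable def Ds [Fintype D] (g : Base D → ℝ) (j : Jet D) : ℝ :=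
  fderiv ℝ g j.1 (0, 1, j.2.2)

/-- The first prolongation of a generator
`X = ξ^t ∂_t + ξ^s ∂_s + ∑ a, η^a ∂_a`. The generator is given as the vector field
`y ↦ (ξ^t y, ξ^s y, fun a => η^a y)`. Its prolongation has the coefficients
`D_t η^a - a_t D_t ξ^t - a_s D_t ξ^s` at `∂_{a_t}` and
`D_s η^a - a_t D_s ξ^t - a_s D_s ξ^s` at `∂_{a_s}`. -/
noncomputable def prolong [Fintype D] (X : Base D → Base D) (j : Jet D) : Jet D :=
  (X j.1,
   fun a => Dt (fun y => (X y).2.2 a) j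
      - dt a j * Dt (fun y => (X y).1) j - ds a j * Dt (fun y => (X y).2.1) j,
   fun a => Ds (fun y => (X y).2.2 a) j
      - dt a j * Ds (fun y => (X y).1) j - ds a j * Ds (fun y => (X y).2.1) j)

/-- The generator `X`, smooth on the set `U` of the space of independent and dependent variables,
is admitted by the system `F k = 0` (for all `k`) over `U`: the infinitesimal criterion of
invariance, i.e. the prolongation of `X` annihilates every `F k` wherever the system holds. -/
def Admits [Fintype D] {K : Type} (F : K → Jet D → ℝ) (U : Set (Base D))
    (X : Base D → Base D) : Prop :=
  ContDiffOn ℝ ∞ X U ∧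
    ∀ j : Jet D, j.1 ∈ U → (∀ k, F k j = 0) → ∀ k, fderiv ℝ (F k) j (prolong X j) = 0

end General

/-! ### The case `A ≠ 0` -/

/-- The dependent variables in the case `A ≠ 0`. -/
inductive VarA : Type
  | r | θ | z | u | v | w | ρ | p | Hθ | Hz
  deriving DecidableEq

instance : Fintype VarA :=
  ⟨{.r, .θ, .z, .u, .v, .w, .ρ, .p, .Hθ, .Hz}, fun x => by cases x <;> decide⟩

/-- The radial magnetic field `H^r = A / r`. -/
noncomputable def Hr (A : ℝ) (y : Base VarA) : ℝ := A / val .r y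

/-- The equations of one-dimensional cylindrically symmetric flows with infinite conductivity
in mass Lagrangian coordinates, each written as `left side - right side`. The equation `some a`
is the one with the derivative `a_t`; the equation `none` is `r_s = 1 / (r ρ)`, which
together with `r_t = u` defines the variable `r`. -/
noncomputable def systemA (γ A : ℝ) : Option VarA → Jet VarA → ℝ
  | some .ρ => fun j => dt .ρ j - (-(val .ρ j.1) ^ 2 * Ds (fun y => val .r y * val .u y) j)
  | some .u => fun j => dt .u j - (val .v j.1) ^ 2 / val .r j.1
      - (-val .r j.1 * ds .p j
          - 1 / (2 * val .r j.1) * Ds (fun y => val .r y ^ 2 * val .Hθ y ^ 2) j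
          - val .r j.1 / 2 * Ds (fun y => val .Hz y ^ 2) j)
  | some .r => fun j => dt .r j - val .u j.1
  | some .v => fun j => dt .v j + val .u j.1 * val .v j.1 / val .r j.1
      - Hr A j.1 * Ds (fun y => val .r y * val .Hθ y) j
  | some .θ => fun j => dt .θ j - val .v j.1 / val .r j.1
  | some .w => fun j => dt .w j - val .r j.1 * Hr A j.1 * ds .Hz j
  | some .z => fun j => dt .z j - val .w j.1
  | some .p => fun j => dt .p j
      - (-γ * val .ρ j.1 * val .p j.1 * Ds (fun y => val .r y * val .u y) j)
  | some .Hθ => fun j => dt .Hθ j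
      - val .r j.1 * val .ρ j.1 * (Ds (fun y => val .v y * Hr A y) j - val .Hθ j.1 * ds .u j)
  | some .Hz => fun j => dt .Hz j
      - val .ρ j.1 * (Ds (fun y => val .r y * val .w y * Hr A y) j
          - val .Hz j.1 * Ds (fun y => val .r y * val .u y) j)
  | none => fun j => ds .r j - 1 / (val .r j.1 * val .ρ j.1)

/-- The range of the variables: `r > 0` and `ρ > 0`. -/
def domainA : Set (Base VarA) := {y | 0 < val .r y ∧ 0 < val .ρ y}

/-- The pair `(s, p / ρ ^ γ)`. -/
noncomputable def invA (γ : ℝ) (y : Base VarA) : ℝ × ℝ :=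
  (y.2.1, val .p y / val .ρ y ^ γ)

/-- `∂_t` -/
def A1 (_ : Base VarA) : Base VarA := (1, 0, 0)

/-- `∂_s` -/
def A2 (_ : Base VarA) : Base VarA := (0, 1, 0)

/-- `t ∂_t + 2 s ∂_s - u ∂_u - v ∂_v - w ∂_w + 2 ρ ∂_ρ` -/
def A3 (y : Base VarA) : Base VarA :=
  (y.1, 2 * y.2.1, fun
    | .u => -val .u y
    | .v => -val .v y
    | .w => -val .w y
    | .ρ => 2 * val .ρ y
    | _ => 0)

/-- `-2 s ∂_s + r ∂_r + z ∂_z + v ∂_v + u ∂_u + w ∂_w - 4 ρ ∂_ρ - 2 p ∂_p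
- H^θ ∂_{H^θ} - H^z ∂_{H^z}` -/
def A4 (y : Base VarA) : Base VarA :=
  (0, -2 * y.2.1, fun
    | .r => val .r y
    | .θ => 0
    | .z => val .z y
    | .u => val .u y
    | .v => val .v y
    | .w => val .w y
    | .ρ => -4 * val .ρ y
    | .p => -2 * val .p y
    | .Hθ => -val .Hθ y
    | .Hz => -val .Hz y)

/-- `t ∂_z + ∂_w` -/
def A5 (y : Base VarA) : Base VarA :=
  (0, 0, fun
    | .z => y.1
    | .w => 1
    | _ => 0)

/-- `f(s, p / ρ ^ γ) ∂_θ` -/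
noncomputable def A6 (γ : ℝ) (f : ℝ × ℝ → ℝ) (y : Base VarA) : Base VarA :=
  (0, 0, fun
    | .θ => f (invA γ y)
    | _ => 0)

/-- `f(s, p / ρ ^ γ) ∂_z` -/
noncomputable def A7 (γ : ℝ) (f : ℝ × ℝ → ℝ) (y : Base VarA) : Base VarA :=
  (0, 0, fun
    | .z => f (invA γ y)
    | _ => 0)

/-! ### The case `A = 0` -/

/-- The dependent variables in the case `A = 0`. -/
inductive VarO : Type
  | r | θ | u | v | ρ | p | Hθ | Hz
  deriving DecidableEq

instance : Fintype VarO :=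
  ⟨{.r, .θ, .u, .v, .ρ, .p, .Hθ, .Hz}, fun x => by cases x <;> decide⟩

/-- The equations in the case `A = 0` (so `H^r = 0`), after separation of the equations
`w_t = 0`, `z_t = w`; same conventions as in `systemA`. -/
noncomputable def systemO (γ : ℝ) : Option VarO → Jet VarO → ℝ
  | some .ρ => fun j => dt .ρ j - (-(val .ρ j.1) ^ 2 * Ds (fun y => val .r y * val .u y) j)
  | some .u => fun j => dt .u j - (val .v j.1) ^ 2 / val .r j.1
      - (-val .r j.1 * ds .p j
          - 1 / (2 * val .r j.1) * Ds (fun y => val .r y ^ 2 * val .Hθ y ^ 2) j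
          - val .r j.1 / 2 * Ds (fun y => val .Hz y ^ 2) j)
  | some .r => fun j => dt .r j - val .u j.1
  | some .v => fun j => dt .v j + val .u j.1 * val .v j.1 / val .r j.1
  | some .θ => fun j => dt .θ j - val .v j.1 / val .r j.1
  | some .p => fun j => dt .p j
      - (-γ * val .ρ j.1 * val .p j.1 * Ds (fun y => val .r y * val .u y) j)
  | some .Hθ => fun j => dt .Hθ j - (-val .r j.1 * val .ρ j.1 * val .Hθ j.1 * ds .u j)
  | some .Hz => fun j => dt .Hz j
      - (-val .ρ j.1 * val .Hz j.1 * Ds (fun y => val .r y * val .u y) j)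
  | none => fun j => ds .r j - 1 / (val .r j.1 * val .ρ j.1)

/-- The range of the variables: `r > 0` and `ρ > 0`. -/
def domainO : Set (Base VarO) := {y | 0 < val .r y ∧ 0 < val .ρ y}

/-- The tuple `(s, r v, p / ρ ^ γ, H^θ / (r ρ), H^z / ρ)`. -/
noncomputable def invO (γ : ℝ) (y : Base VarO) : ℝ × ℝ × ℝ × ℝ × ℝ :=
  (y.2.1, val .r y * val .v y, val .p y / val .ρ y ^ γ,
    val .Hθ y / (val .r y * val .ρ y), val .Hz y / val .ρ y)

/-- `∂_t` -/
def O1 (_ : Base VarO) : Base VarO := (1, 0, 0)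

/-- `∂_s` -/
def O2 (_ : Base VarO) : Base VarO := (0, 1, 0)

/-- `t ∂_t + 2 s ∂_s - u ∂_u - v ∂_v + 2 ρ ∂_ρ` -/
def O3 (y : Base VarO) : Base VarO :=
  (y.1, 2 * y.2.1, fun
    | .u => -val .u y
    | .v => -val .v y
    | .ρ => 2 * val .ρ y
    | _ => 0)

/-- `-2 s ∂_s + r ∂_r + v ∂_v + u ∂_u - 4 ρ ∂_ρ - 2 p ∂_p - H^θ ∂_{H^θ} - H^z ∂_{H^z}` -/
def O4 (y : Base VarO) : Base VarO :=
  (0, -2 * y.2.1, fun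
    | .r => val .r y
    | .θ => 0
    | .u => val .u y
    | .v => val .v y
    | .ρ => -4 * val .ρ y
    | .p => -2 * val .p y
    | .Hθ => -val .Hθ y
    | .Hz => -val .Hz y)

/-- `2 s ∂_s + 2 ρ ∂_ρ + 2 p ∂_p + H^θ ∂_{H^θ} + H^z ∂_{H^z}` -/
def O5 (y : Base VarO) : Base VarO :=
  (0, 2 * y.2.1, fun
    | .ρ => 2 * val .ρ y
    | .p => 2 * val .p y
    | .Hθ => val .Hθ y
    | .Hz => val .Hz y
    | _ => 0)

/-- `f(s, r v, p / ρ ^ γ, H^θ / (r ρ), H^z / ρ) ∂_θ` -/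
noncomputable def O6 (γ : ℝ) (f : ℝ × ℝ × ℝ × ℝ × ℝ → ℝ) (y : Base VarO) : Base VarO :=
  (0, 0, fun
    | .θ => f (invO γ y)
    | _ => 0)

/-- `ρ f(s, r v, p / ρ ^ γ, H^θ / (r ρ), H^z / ρ) (∂_{H^z} - H^z ∂_p)` -/
noncomputable def O7 (γ : ℝ) (f : ℝ × ℝ × ℝ × ℝ × ℝ → ℝ) (y : Base VarO) : Base VarO :=
  (0, 0, fun
    | .Hz => val .ρ y * f (invO γ y)
    | .p => -(val .ρ y * f (invO γ y) * val .Hz y)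
    | _ => 0)

end MHD

open MHD

/-! On the solution manifold all `q_t` and also `r_s = 1/(rρ)` are functions of the base point and
of the remaining s-derivatives, which are free. The criterion of invariance is thus an identity in
the free derivatives, and it splits into an overdetermined linear system for the coefficients of the
generator. Solving that system takes only algebra: commuting derivations, the product rule, and
cancellation of coordinates and nonzero constants. It is therefore posed in an abstract ring with a
`Calculus` and realised by smooth functions on `U` (`smoothCalculus`), where a coordinate may vanish
but is not a zero divisor. Coefficients of the free derivatives are read off by substituting 0, 1,
-1 for them and subtracting.

In both cases the relation `dr = u dt + ds/(rρ)` (`Calculus.contact`) and the absence of `θ_s` from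
the system show that `ξs` depends on `s` only, and `ξt`, `η r` on `t, s, r` (`base`).

For `A ≠ 0` the radial field couples `v` with `Hθ` and `w` with `Hz`. Matching coefficients within
each coupled pair gives a second formula for `η ρ` (`IsSymmetryA.kinematics`), and the momentum
equation then ties `η Hθ`, `η Hz` to one scaling parameter `m` (`field_coefficients`,
`scaling_parameter`). In `IsSymmetryA.solve` the quantities `m`, `∂_t ξt` and `∂_t η z` become
constants; they are the coefficients of the two scalings and of the Galilean boost.

For `A = 0` no such coupling exists. The coefficient of `u_s` is governed by the derivation
`scaleO`, and the momentum equation determines the perturbation `Q = η p + Hθ η Hθ + Hz η Hz` of the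
total pressure `p + (Hθ² + Hz²)/2`. Applying `scaleO` to these relations twice yields `(γ - 2)(η p -
K p) = 0` (`total_pressure`). So an additional freedom exists only for `γ = 2`, where `Hz²/2` is
transported by the same law as `p` and the two may be exchanged at constant sum. Time-dependent
scalings and translations of `r` are excluded in `momentum` and `velocity`.

What is left are functions annihilated by the derivations tangent to the level sets of the
Lagrangian invariants. A change of variables straightens these level sets, and `exists_local_factor`
writes such a function locally as a smooth function of the invariants; functions all of whose
derivatives vanish are constant on a connected `U`. Conversely, the invariants are constant along
particle trajectories, which makes the listed generators symmetries by direct computation. -/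

open scoped ContDiff

namespace MHD

/-! ### The algebra of smooth functions on an open set -/

section SmoothFunctions

open TopologicalSpace

variable {E : Type*} [NormedAddCommGroup E] [NormedSpace ℝ E]

/-- The algebra of smooth real functions on an open set `U` of a normed space. -/
def Smooth (U : Opens E) : Subalgebra ℝ (U → ℝ) where
  carrier := {f | ∃ g : E → ℝ, ContDiffOn ℝ ∞ g U ∧ ∀ y : U, g y = f y}
  mul_mem' := by
    rintro f f' ⟨g, hg, h⟩ ⟨g', hg', h'⟩
    exact ⟨fun y => g y * g' y, hg.mul hg', fun y => by simp [h, h']⟩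
  add_mem' := by
    rintro f f' ⟨g, hg, h⟩ ⟨g', hg', h'⟩
    exact ⟨fun y => g y + g' y, hg.add hg', fun y => by simp [h, h']⟩
  algebraMap_mem' := fun c => ⟨fun _ => c, contDiffOn_const, fun y => by simp⟩

variable {U : Opens E}

namespace Smooth

/-- The value of a smooth function at a point. -/
def eval (y : U) : Smooth U →ₐ[ℝ] ℝ :=
  (Pi.evalAlgHom ℝ (fun _ : U => ℝ) y).comp (Smooth U).val

theorem ext_eval {f g : Smooth U} (h : ∀ y, eval y f = eval y g) : f = g :=
  Subtype.ext (funext h)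

/-- An extension of a smooth function to the whole space. -/
noncomputable def extend (f : Smooth U) : E → ℝ := f.2.choose

theorem contDiffOn_extend (f : Smooth U) : ContDiffOn ℝ ∞ (extend f) U := f.2.choose_spec.1

@[simp] theorem extend_apply (f : Smooth U) (y : U) : (extend f) y = eval y f :=
  f.2.choose_spec.2 y

/-- The restriction to `U` of a function that is smooth on `U`. -/
def of (g : E → ℝ) (hg : ContDiffOn ℝ ∞ g U) : Smooth U := ⟨fun y => g y, g, hg, fun _ => rfl⟩

@[simp] theorem eval_of (g : E → ℝ) (hg : ContDiffOn ℝ ∞ g U) (y : U) : eval y (of g hg) = g y :=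
  rfl

theorem fderiv_eq {g h : E → ℝ} (H : ∀ y : U, g y = h y) (y : U) :
    fderiv ℝ g y = fderiv ℝ h y :=
  Filter.EventuallyEq.fderiv_eq <| by
    filter_upwards [U.isOpen.mem_nhds y.2] with z hz using H ⟨z, hz⟩

theorem differentiableAt {g : E → ℝ} (hg : ContDiffOn ℝ ∞ g U) (y : U) :
    DifferentiableAt ℝ g y :=
  (hg.contDiffAt (U.isOpen.mem_nhds y.2)).differentiableAt (by simp)

theorem contDiffOn_fderiv {g : E → ℝ} (hg : ContDiffOn ℝ ∞ g U) (v : E) :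
    ContDiffOn ℝ ∞ (fun y => fderiv ℝ g y v) U :=
  (hg.fderiv_of_isOpen U.isOpen (m := ∞) (by simp)).clm_apply contDiffOn_const

/-- The derivative in the direction of a constant vector field. -/
noncomputable def dir (v : E) : Derivation ℝ (Smooth U) (Smooth U) :=
  Derivation.mk'
    { toFun := fun f => of (fun y => fderiv ℝ (extend f) y v)
        (contDiffOn_fderiv (contDiffOn_extend f) v)
      map_add' := fun f g => ext_eval fun y => by
        rw [map_add, eval_of, eval_of, eval_of,
          fderiv_eq (h := fun z => (extend f) z + (extend g) z) (fun z => by simp),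
          fderiv_fun_add (differentiableAt (contDiffOn_extend f) y)
            (differentiableAt (contDiffOn_extend g) y)]
        rfl
      map_smul' := fun c f => ext_eval fun y => by
        rw [map_smul, eval_of, eval_of,
          fderiv_eq (h := fun z => c • (extend f) z) (fun z => by simp),
          fderiv_fun_const_smul (differentiableAt (contDiffOn_extend f) y)]
        rfl }
    (fun f g => ext_eval fun y => by
      simp only [LinearMap.coe_mk, AddHom.coe_mk, smul_eq_mul]
      rw [map_add, map_mul, map_mul, eval_of, eval_of, eval_of,
        fderiv_eq (h := fun z => (extend f) z * (extend g) z) (fun z => by simp),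
        fderiv_fun_mul (differentiableAt (contDiffOn_extend f) y)
          (differentiableAt (contDiffOn_extend g) y)]
      simp)

theorem eval_dir {f : Smooth U} {g : E → ℝ} (h : ∀ y : U, g y = eval y f) (v : E) (y : U) :
    eval y (dir v f) = fderiv ℝ g y v := by
  rw [fderiv_eq (h := (extend f)) (fun z => by simp [h])]
  rfl

theorem eval_dir_of (g : E → ℝ) (hg : ContDiffOn ℝ ∞ g U) (v : E) (y : U) :
    eval y (dir v (of g hg)) = fderiv ℝ g y v :=
  eval_dir (fun _ => rfl) v y

theorem dir_comm (v w : E) (f : Smooth U) : dir v (dir w f) = dir w (dir v f) := by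
  refine ext_eval fun y => ?_
  have hC := (contDiffOn_extend f).contDiffAt (U.isOpen.mem_nhds y.2)
  have hd : DifferentiableAt ℝ (fderiv ℝ (extend f)) y :=
    (hC.fderiv_right (m := 1) (by norm_cast)).differentiableAt (by simp)
  have key : ∀ v w : E, eval y (dir v (dir w f)) = fderiv ℝ (fderiv ℝ (extend f)) y v w := by
    intro v w
    rw [eval_dir (g := fun z => fderiv ℝ (extend f) z w) (fun z => rfl),
      fderiv_clm_apply hd (differentiableAt_const w)]
    simp
  rw [key, key]
  exact hC.isSymmSndFDerivAt (by simpa using WithTop.coe_le_coe.2 (le_top (a := (2 : ℕ∞)))) v w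

/-- A nonconstant affine function is not a zero divisor. -/
theorem eq_zero_of_linear_mul {l f : Smooth U} (ℓ : E →L[ℝ] ℝ) (hl : ∀ y : U, eval y l = ℓ y)
    {v : E} (hv : ℓ v ≠ 0) (h : l * f = 0) : f = 0 := by
  refine ext_eval fun y => ?_
  rw [map_zero]
  have hc : ContinuousAt (extend f) y := (differentiableAt (contDiffOn_extend f) y).continuousAt
  -- Near `y` the line in the direction `v` meets the zero set of `ℓ` in at most one point. Off that
  -- point `f` vanishes, and continuity carries this to `y`.
  have hp : Filter.Tendsto (fun t : ℝ => (y : E) + t • v) (nhdsWithin 0 {0}ᶜ) (nhds y) := by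
    have : ContinuousAt (fun t : ℝ => (y : E) + t • v) 0 := by fun_prop
    have := this.tendsto
    simp only [zero_smul, add_zero] at this
    exact this.mono_left nhdsWithin_le_nhds
  have h0 : Filter.Tendsto (fun t : ℝ => (extend f) ((y : E) + t • v)) (nhdsWithin 0 {0}ᶜ)
      (nhds ((extend f) y)) := hc.tendsto.comp hp
  rw [extend_apply] at h0
  refine tendsto_nhds_unique_of_eventuallyEq h0 (tendsto_const_nhds (x := (0 : ℝ))) ?_
  have hU : ∀ᶠ t in nhdsWithin (0 : ℝ) {0}ᶜ, (y : E) + t • v ∈ U :=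
    hp.eventually (U.isOpen.mem_nhds y.2)
  have hne : ∀ᶠ t in nhdsWithin (0 : ℝ) {0}ᶜ, ℓ y + t * ℓ v ≠ 0 := by
    -- The only zero on the line is at `t = -ℓ y / ℓ v`. If this is `t = 0`, the puncture already
    -- removes it, hence the union with `{0}`.
    have h1 : ({-(ℓ y / ℓ v)} : Set ℝ)ᶜ ∪ {0} ∈ nhds (0 : ℝ) := by
      by_cases h : -(ℓ y / ℓ v) = 0
      · rw [h, Set.compl_union_self]; exact Filter.univ_mem
      · exact Filter.mem_of_superset (isOpen_compl_singleton.mem_nhds (Ne.symm h))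
          Set.subset_union_left
    filter_upwards [nhdsWithin_le_nhds h1, self_mem_nhdsWithin] with t ht ht0 h0
    rcases ht with ht | ht
    · apply ht
      rw [Set.mem_singleton_iff]
      field_simp
      linarith
    · exact ht0 ht
  filter_upwards [hU, hne] with t ht hn
  have h2 := congrArg (eval ⟨_, ht⟩) h
  rw [map_mul, hl, map_zero] at h2
  have h3 : ℓ ((y : E) + t • v) ≠ 0 := by simpa using hn
  rw [← extend_apply] at h2
  exact (mul_eq_zero.1 h2).resolve_left h3

end Smooth

end SmoothFunctions

/-! ### Coordinates and partial derivatives -/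

/-- The independent and dependent variables. -/
inductive Coord (D : Type) : Type
  | t | s
  | q (a : D)
  deriving DecidableEq

namespace Coord

variable {D : Type}

/-- The basis vectors of the space of independent and dependent variables. -/
def vec [DecidableEq D] : Coord D → Base D
  | t => (1, 0, 0)
  | s => (0, 1, 0)
  | q a => (0, 0, Pi.single a 1)

/-- The coordinates of the space of independent and dependent variables. -/
noncomputable def fn [Fintype D] : Coord D → Base D →L[ℝ] ℝ
  | t => ContinuousLinearMap.fst ℝ ℝ (ℝ × (D → ℝ))
  | s => (ContinuousLinearMap.fst ℝ ℝ (D → ℝ)).comp (ContinuousLinearMap.snd ℝ ℝ (ℝ × (D → ℝ)))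
  | q a => (ContinuousLinearMap.proj a).comp
      ((ContinuousLinearMap.snd ℝ ℝ (D → ℝ)).comp (ContinuousLinearMap.snd ℝ ℝ (ℝ × (D → ℝ))))

theorem fn_vec [Fintype D] [DecidableEq D] (i j : Coord D) :
    fn j (vec i) = if i = j then 1 else 0 := by
  cases i <;> cases j <;> simp [fn, vec, Pi.single_apply, eq_comm]

end Coord

section Ring

open TopologicalSpace Smooth

variable {D : Type} [Fintype D] [DecidableEq D] {U : Opens (Base D)}

/-- The coordinates as smooth functions on `U`. -/
noncomputable def crd (i : Coord D) : Smooth U := of (Coord.fn i) (Coord.fn i).contDiff.contDiffOn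

/-- The partial derivatives of smooth functions on `U`. -/
noncomputable def par (i : Coord D) : Derivation ℝ (Smooth U) (Smooth U) := dir i.vec

theorem par_crd (i j : Coord D) : par i (crd j : Smooth U) = if i = j then 1 else 0 := by
  refine ext_eval fun y => ?_
  rw [par, crd, eval_dir_of, ContinuousLinearMap.fderiv, Coord.fn_vec]
  split_ifs <;> simp

theorem par_comm (i j : Coord D) (f : Smooth U) : par i (par j f) = par j (par i f) :=
  dir_comm _ _ f

theorem eq_zero_of_crd_mul (i : Coord D) {f : Smooth U} (h : crd i * f = 0) : f = 0 :=
  eq_zero_of_linear_mul (Coord.fn i) (fun _ => rfl) (v := i.vec) (by simp [Coord.fn_vec]) h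

theorem vec_decomp (a b : ℝ) (τ : D → ℝ) :
    ((a, b, τ) : Base D) = a • Coord.vec .t + b • Coord.vec .s + ∑ i, τ i • Coord.vec (.q i) := by
  have h : ∑ i, τ i • (Coord.vec (.q i) : Base D) = (0, 0, τ) := by
    ext i
    · simp [Prod.fst_sum, Coord.vec]
    · simp [Prod.fst_sum, Prod.snd_sum, Coord.vec]
    · simp [Prod.snd_sum, Coord.vec, Finset.sum_apply, Pi.single_apply]
  rw [h]
  simp [Coord.vec]

theorem fderiv_eq_sum {f : Smooth U} {g : Base D → ℝ} (h : ∀ y : U, g y = eval y f) (y : U)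
    (a b : ℝ) (τ : D → ℝ) : fderiv ℝ g y (a, b, τ) =
      a * eval y (par .t f) + b * eval y (par .s f) + ∑ i, τ i * eval y (par (.q i) f) := by
  simp only [vec_decomp, map_add, map_sum, map_smul, par, eval_dir h, smul_eq_mul]

/-- On a connected open set, a function with vanishing partial derivatives is constant. -/
theorem exists_eq_const (hU : IsPreconnected (U : Set (Base D))) {f : Smooth U}
    (h : ∀ i, par i f = 0) : ∃ c : ℝ, ∀ y, eval y f = c := by
  obtain ⟨c, hc⟩ := U.isOpen.exists_is_const_of_fderiv_eq_zero hU
    ((contDiffOn_extend f).differentiableOn (by simp)) (fun y hy => by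
      refine ContinuousLinearMap.ext fun v => ?_
      have := fderiv_eq_sum (f := f) (fun y => extend_apply f y) ⟨y, hy⟩ v.1 v.2.1 v.2.2
      simpa [h] using this)
  exact ⟨c, fun y => by rw [← extend_apply]; exact hc y y.2⟩

end Ring

/-! ### Rules for directional derivatives -/

section DirectionalDerivatives

variable {E V W : Type*} [NormedAddCommGroup E] [NormedSpace ℝ E] [NormedAddCommGroup V]
  [NormedSpace ℝ V] [NormedAddCommGroup W] [NormedSpace ℝ W]

/-- The function `F` is differentiable at `x`, with derivative `d` in the direction `v`. -/
def HasDirDeriv (F : E → V) (x v : E) (d : V) : Prop :=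
  DifferentiableAt ℝ F x ∧ fderiv ℝ F x v = d

namespace HasDirDeriv

variable {F G : E → ℝ} {x v : E} {d e : ℝ}

theorem congr_deriv (h : HasDirDeriv F x v d) (hd : d = e) : HasDirDeriv F x v e := hd ▸ h

theorem congr_fun (h : HasDirDeriv F x v d) (hF : G =ᶠ[nhds x] F) : HasDirDeriv G x v d :=
  ⟨h.1.congr_of_eventuallyEq hF, by rw [hF.fderiv_eq, h.2]⟩

theorem const (c : ℝ) : HasDirDeriv (fun _ : E => c) x v 0 :=
  ⟨differentiableAt_const c, by simp⟩

theorem linear (ℓ : E →L[ℝ] ℝ) : HasDirDeriv (fun y => ℓ y) x v (ℓ v) :=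
  ⟨ℓ.differentiableAt, by rw [ℓ.fderiv]⟩

theorem add (hF : HasDirDeriv F x v d) (hG : HasDirDeriv G x v e) :
    HasDirDeriv (fun y => F y + G y) x v (d + e) :=
  ⟨hF.1.add hG.1, by rw [fderiv_fun_add hF.1 hG.1, ← hF.2, ← hG.2]; rfl⟩

theorem sub (hF : HasDirDeriv F x v d) (hG : HasDirDeriv G x v e) :
    HasDirDeriv (fun y => F y - G y) x v (d - e) :=
  ⟨hF.1.sub hG.1, by rw [fderiv_fun_sub hF.1 hG.1, ← hF.2, ← hG.2]; rfl⟩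

theorem neg (hF : HasDirDeriv F x v d) : HasDirDeriv (fun y => -F y) x v (-d) :=
  ⟨hF.1.neg, by rw [fderiv_fun_neg, ← hF.2]; rfl⟩

theorem mul (hF : HasDirDeriv F x v d) (hG : HasDirDeriv G x v e) :
    HasDirDeriv (fun y => F y * G y) x v (F x * e + G x * d) :=
  ⟨hF.1.mul hG.1, by rw [fderiv_fun_mul hF.1 hG.1, ← hF.2, ← hG.2]; rfl⟩

theorem pow_two (hF : HasDirDeriv F x v d) :
    HasDirDeriv (fun y => F y ^ 2) x v (2 * F x * d) :=
  ((hF.mul hF).congr_deriv (by ring)).congr_fun (.of_eq (by ext y; ring))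

theorem inv (hF : HasDirDeriv F x v d) (h : F x ≠ 0) :
    HasDirDeriv (fun y => (F y)⁻¹) x v (-d / F x ^ 2) :=
  ⟨hF.1.fun_inv h, by
    have := ((hasDerivAt_inv h).comp_hasFDerivAt x hF.1.hasFDerivAt).fderiv
    rw [← hF.2, show (fun y => (F y)⁻¹) = (fun y => y⁻¹) ∘ F from rfl, this]
    simp [div_eq_mul_inv, mul_comm]⟩

theorem div (hF : HasDirDeriv F x v d) (hG : HasDirDeriv G x v e) (h : G x ≠ 0) :
    HasDirDeriv (fun y => F y / G y) x v ((d * G x - F x * e) / G x ^ 2) :=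
  ((hF.mul (hG.inv h)).congr_deriv (by field_simp; ring)).congr_fun
    (.of_eq (by ext y; rw [div_eq_mul_inv]))

theorem rpow_const (hF : HasDirDeriv F x v d) (h : F x ≠ 0) (c : ℝ) :
    HasDirDeriv (fun y => F y ^ c) x v (c * F x ^ (c - 1) * d) :=
  ⟨hF.1.rpow_const (Or.inl h), by
    rw [← hF.2, (hF.1.hasFDerivAt.rpow_const (Or.inl h)).fderiv]
    simp⟩

theorem prodMk {F : E → V} {G : E → W} {d : V} {e : W} (hF : HasDirDeriv F x v d)
    (hG : HasDirDeriv G x v e) : HasDirDeriv (fun y => (F y, G y)) x v (d, e) :=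
  ⟨hF.1.prodMk hG.1, by rw [hF.1.fderiv_prodMk hG.1, ← hF.2, ← hG.2]; rfl⟩

theorem comp {F : E → V} {d : V} {f : V → ℝ} (hf : DifferentiableAt ℝ f (F x))
    (hF : HasDirDeriv F x v d) : HasDirDeriv (fun y => f (F y)) x v (fderiv ℝ f (F x) d) :=
  ⟨hf.comp x hF.1, by
    have := (hf.hasFDerivAt.comp x hF.1.hasFDerivAt).fderiv
    rw [show (fun y => f (F y)) = f ∘ F from rfl, this, ← hF.2]
    rfl⟩

end HasDirDeriv

variable {D : Type} [Fintype D]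

theorem hasDirDeriv_val (a : D) (y v : Base D) : 
    HasDirDeriv (fun y : Base D => y.2.2 a) y v (v.2.2 a) :=
  .linear (Coord.fn (.q a))

theorem hasDirDeriv_t (y v : Base D) : HasDirDeriv (fun y : Base D => y.1) y v v.1 :=
  .linear (Coord.fn (D := D) .t)

theorem hasDirDeriv_s (y v : Base D) : HasDirDeriv (fun y : Base D => y.2.1) y v v.2.1 :=
  .linear (Coord.fn (D := D) .s)

theorem hasDirDeriv_jet_val (a : D) (j v : Jet D) :
    HasDirDeriv (fun j : Jet D => j.1.2.2 a) j v (v.1.2.2 a) :=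
  .linear ((Coord.fn (.q a)).comp (ContinuousLinearMap.fst ℝ (Base D) ((D → ℝ) × (D → ℝ))))

theorem hasDirDeriv_dt (a : D) (j v : Jet D) :
    HasDirDeriv (fun j : Jet D => j.2.1 a) j v (v.2.1 a) :=
  .linear ((ContinuousLinearMap.proj a).comp ((ContinuousLinearMap.fst ℝ (D → ℝ) (D → ℝ)).comp
    (ContinuousLinearMap.snd ℝ (Base D) ((D → ℝ) × (D → ℝ)))))

theorem hasDirDeriv_ds (a : D) (j v : Jet D) :
    HasDirDeriv (fun j : Jet D => j.2.2 a) j v (v.2.2 a) :=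
  .linear ((ContinuousLinearMap.proj a).comp ((ContinuousLinearMap.snd ℝ (D → ℝ) (D → ℝ)).comp
    (ContinuousLinearMap.snd ℝ (Base D) ((D → ℝ) × (D → ℝ)))))

end DirectionalDerivatives

/-! ### The system for A ≠ 0 and its linearization -/

theorem VarA.sum_eq {M : Type*} [AddCommMonoid M] (f : VarA → M) :
    ∑ a, f a = f .r + f .θ + f .z + f .u + f .v + f .w + f .ρ + f .p + f .Hθ + f .Hz := by
  simp [Finset.univ, Fintype.elems, add_assoc]

/-- The derivatives `q_t` on the solutions of the system for `A ≠ 0`, where `ir` and `iρ` stand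
for the inverses of `r` and `ρ`. -/
def flowA {R : Type*} [CommRing R] (g A ir iρ : R) (q σ : VarA → R) : VarA → R
  | .r => q .u
  | .θ => q .v * ir
  | .z => q .w
  | .u => q .v ^ 2 * ir - q .r * σ .p - q .Hθ ^ 2 * (ir * iρ) - q .r * q .Hθ * σ .Hθ
      - q .r * q .Hz * σ .Hz
  | .v => -(q .u * q .v * ir) + A * q .Hθ * (ir ^ 2 * iρ) + A * σ .Hθ
  | .w => A * σ .Hz
  | .ρ => -(q .ρ ^ 2 * q .r * σ .u) - q .ρ * q .u * ir
  | .p => -(g * q .p * q .ρ * q .r * σ .u) - g * q .p * q .u * ir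
  | .Hθ => A * q .ρ * σ .v - A * q .v * ir ^ 2 - q .r * q .ρ * q .Hθ * σ .u
  | .Hz => A * q .ρ * σ .w - q .r * q .ρ * q .Hz * σ .u - q .Hz * q .u * ir

/-- The differential of `flowA`. -/
def dflowA {R : Type*} [CommRing R] (g A ir iρ : R) (q σ η ησ : VarA → R) : VarA → R
  | .r => η .u
  | .θ => η .v * ir - q .v * ir ^ 2 * η .r
  | .z => η .w
  | .u => 2 * q .v * η .v * ir - q .v ^ 2 * ir ^ 2 * η .r - η .r * σ .p - q .r * ησ .p
      - 2 * q .Hθ * η .Hθ * (ir * iρ) + q .Hθ ^ 2 * (ir * iρ) * (ir * η .r + iρ * η .ρ)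
      - (η .r * q .Hθ + q .r * η .Hθ) * σ .Hθ - q .r * q .Hθ * ησ .Hθ
      - (η .r * q .Hz + q .r * η .Hz) * σ .Hz - q .r * q .Hz * ησ .Hz
  | .v => -((η .u * q .v + q .u * η .v) * ir) + q .u * q .v * ir ^ 2 * η .r
      + A * η .Hθ * (ir ^ 2 * iρ) - A * q .Hθ * (ir ^ 2 * iρ) * (2 * ir * η .r + iρ * η .ρ)
      + A * ησ .Hθ
  | .w => A * ησ .Hz
  | .ρ => -(2 * q .ρ * η .ρ * q .r * σ .u) - q .ρ ^ 2 * (η .r * σ .u + q .r * ησ .u)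
      - (η .ρ * q .u + q .ρ * η .u) * ir + q .ρ * q .u * ir ^ 2 * η .r
  | .p => -(g * (η .p * q .ρ * q .r + q .p * η .ρ * q .r + q .p * q .ρ * η .r) * σ .u)
      - g * q .p * q .ρ * q .r * ησ .u
      - g * (η .p * q .u + q .p * η .u) * ir + g * q .p * q .u * ir ^ 2 * η .r
  | .Hθ => A * η .ρ * σ .v + A * q .ρ * ησ .v - A * η .v * ir ^ 2 + 2 * A * q .v * ir ^ 3 * η .r
      - (η .r * q .ρ * q .Hθ + q .r * η .ρ * q .Hθ + q .r * q .ρ * η .Hθ) * σ .u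
      - q .r * q .ρ * q .Hθ * ησ .u
  | .Hz => A * η .ρ * σ .w + A * q .ρ * ησ .w
      - (η .r * q .ρ * q .Hz + q .r * η .ρ * q .Hz + q .r * q .ρ * η .Hz) * σ .u
      - q .r * q .ρ * q .Hz * ησ .u
      - (η .Hz * q .u + q .Hz * η .u) * ir + q .Hz * q .u * ir ^ 2 * η .r

theorem map_flowA {R S : Type*} [CommRing R] [CommRing S] (φ : R →+* S) (g A ir iρ : R)
    (q σ : VarA → R) (a : VarA) : φ (flowA g A ir iρ q σ a) =
      flowA (φ g) (φ A) (φ ir) (φ iρ) (fun a => φ (q a)) (fun a => φ (σ a)) a := by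
  cases a <;> simp [flowA]

theorem map_dflowA {R S : Type*} [CommRing R] [CommRing S] (φ : R →+* S) (g A ir iρ : R)
    (q σ η ησ : VarA → R) (a : VarA) : φ (dflowA g A ir iρ q σ η ησ a) =
      dflowA (φ g) (φ A) (φ ir) (φ iρ) (fun a => φ (q a)) (fun a => φ (σ a)) (fun a => φ (η a))
        (fun a => φ (ησ a)) a := by
  have h : φ 2 = 2 := map_ofNat φ 2
  cases a <;> simp [dflowA, h]

/-- The left-hand sides of the system for `A ≠ 0` with the products differentiated. -/
noncomputable def expandedA (γ A : ℝ) : Option VarA → Jet VarA → ℝ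
  | some .r => fun j => j.2.1 .r - j.1.2.2 .u
  | some .θ => fun j => j.2.1 .θ - j.1.2.2 .v / j.1.2.2 .r
  | some .z => fun j => j.2.1 .z - j.1.2.2 .w
  | some .u => fun j => j.2.1 .u - j.1.2.2 .v ^ 2 / j.1.2.2 .r + j.1.2.2 .r * j.2.2 .p
      + j.2.2 .r * j.1.2.2 .Hθ ^ 2 + j.1.2.2 .r * j.1.2.2 .Hθ * j.2.2 .Hθ
      + j.1.2.2 .r * j.1.2.2 .Hz * j.2.2 .Hz
  | some .v => fun j => j.2.1 .v + j.1.2.2 .u * j.1.2.2 .v / j.1.2.2 .r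
      - A * j.2.2 .r * j.1.2.2 .Hθ / j.1.2.2 .r - A * j.2.2 .Hθ
  | some .w => fun j => j.2.1 .w - A * j.2.2 .Hz
  | some .ρ => fun j => j.2.1 .ρ
      + j.1.2.2 .ρ ^ 2 * (j.2.2 .r * j.1.2.2 .u + j.1.2.2 .r * j.2.2 .u)
  | some .p => fun j => j.2.1 .p
      + γ * j.1.2.2 .ρ * j.1.2.2 .p * (j.2.2 .r * j.1.2.2 .u + j.1.2.2 .r * j.2.2 .u)
  | some .Hθ => fun j => j.2.1 .Hθ - A * j.1.2.2 .ρ * j.2.2 .v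
      + A * j.1.2.2 .ρ * j.1.2.2 .v * j.2.2 .r / j.1.2.2 .r
      + j.1.2.2 .r * j.1.2.2 .ρ * j.1.2.2 .Hθ * j.2.2 .u
  | some .Hz => fun j => j.2.1 .Hz - j.1.2.2 .ρ * (A * j.2.2 .w
      - j.1.2.2 .Hz * (j.2.2 .r * j.1.2.2 .u + j.1.2.2 .r * j.2.2 .u))
  | none => fun j => j.2.2 .r - 1 / (j.1.2.2 .r * j.1.2.2 .ρ)

theorem systemA_eq_expandedA (γ A : ℝ) (k : Option VarA) (j : Jet VarA) (hr : j.1.2.2 .r ≠ 0) :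
    systemA γ A k j = expandedA γ A k j := by
  have h0 : ∀ a : VarA, HasDirDeriv (fun y : Base VarA => y.2.2 a) j.1 (0, 1, j.2.2) (j.2.2 a) :=
    fun a => hasDirDeriv_val a _ _
  have h1 := ((h0 .r).mul (h0 .u)).2
  have h2 := ((h0 .r).pow_two.mul (h0 .Hθ).pow_two).2
  have h3 := ((h0 .Hz).pow_two).2
  have h4 := ((h0 .r).mul (h0 .Hθ)).2
  have h5 := ((h0 .v).mul ((HasDirDeriv.const A).div (h0 .r) hr)).2
  have h6 := (((h0 .r).mul (h0 .w)).mul ((HasDirDeriv.const A).div (h0 .r) hr)).2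
  rcases k with _ | a
  · simp only [systemA, expandedA, ds, val]
  · cases a <;> simp only [systemA, expandedA, dt, ds, val, Ds, Hr, h1, h2, h3, h4, h5, h6] <;>
      field_simp <;> ring

/-- In `flowA` the derivative `r_s` is already replaced by `1/(rρ)`, so the differential of equation
`some a` agrees with `dflowA` only up to a multiple of the linearized constraint `none`. The
multiplier `m` is the coefficient of `r_s` in that equation. -/
theorem hasDirDeriv_systemA (γ A : ℝ) (k : Option VarA) (j v : Jet VarA) (hr : j.1.2.2 .r ≠ 0)
    (hρ : j.1.2.2 .ρ ≠ 0) (hj : j.2.2 .r = (j.1.2.2 .r)⁻¹ * (j.1.2.2 .ρ)⁻¹) :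
    ∃ m : ℝ, HasDirDeriv (systemA γ A k) j v
      (k.elim 0 (fun a => v.2.1 a - dflowA γ A (j.1.2.2 .r)⁻¹ (j.1.2.2 .ρ)⁻¹ j.1.2.2 j.2.2
        v.1.2.2 v.2.2 a) + k.elim 1 (fun _ => m) * (v.2.2 .r + (j.1.2.2 .r)⁻¹ * (j.1.2.2 .ρ)⁻¹ *
          ((j.1.2.2 .r)⁻¹ * v.1.2.2 .r + (j.1.2.2 .ρ)⁻¹ * v.1.2.2 .ρ))) := by
  have hE : systemA γ A k =ᶠ[nhds j] expandedA γ A k := by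
    have : ContinuousAt (fun j : Jet VarA => j.1.2.2 .r) j := by fun_prop
    filter_upwards [this.eventually_ne hr] with i hi using systemA_eq_expandedA γ A k i hi
  have hc : ∀ c : ℝ, HasDirDeriv (fun _ : Jet VarA => c) j v 0 := fun c => .const c
  have hq := fun a => hasDirDeriv_jet_val a j v
  have ht := fun a => hasDirDeriv_dt a j v
  have hs := fun a => hasDirDeriv_ds a j v
  rcases k with _ | a
  · refine ⟨0, .congr_fun (.congr_deriv ((hs .r).sub ((hc 1).div ((hq .r).mul (hq .ρ))
      (mul_ne_zero hr hρ))) ?_) hE⟩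
    simp only [Option.elim]
    field_simp
    ring
  · cases a
    case r =>
      refine ⟨0, .congr_fun (.congr_deriv ((ht .r).sub (hq .u)) ?_) hE⟩
      simp [dflowA]
    case θ =>
      refine ⟨0, .congr_fun (.congr_deriv ((ht .θ).sub ((hq .v).div (hq .r) hr)) ?_) hE⟩
      simp only [dflowA, Option.elim]
      field_simp
      ring
    case z =>
      refine ⟨0, .congr_fun (.congr_deriv ((ht .z).sub (hq .w)) ?_) hE⟩
      simp [dflowA]
    case u =>
      refine ⟨j.1.2.2 .Hθ ^ 2, .congr_fun (.congr_deriv (((((ht .u).sub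
        ((hq .v).pow_two.div (hq .r) hr)).add ((hq .r).mul (hs .p))).add
        ((hs .r).mul (hq .Hθ).pow_two)).add (((hq .r).mul (hq .Hθ)).mul (hs .Hθ)) |>.add
        (((hq .r).mul (hq .Hz)).mul (hs .Hz))) ?_) hE⟩
      simp only [dflowA, Option.elim, hj]
      field_simp
      ring
    case v =>
      refine ⟨-(A * j.1.2.2 .Hθ / j.1.2.2 .r), .congr_fun (.congr_deriv ((((ht .v).add
        (((hq .u).mul (hq .v)).div (hq .r) hr)).sub
        ((((hc A).mul (hs .r)).mul (hq .Hθ)).div (hq .r) hr)).sub ((hc A).mul (hs .Hθ))) ?_) hE⟩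
      simp only [dflowA, Option.elim, hj]
      field_simp
      ring
    case w =>
      refine ⟨0, .congr_fun (.congr_deriv ((ht .w).sub ((hc A).mul (hs .Hz))) ?_) hE⟩
      simp [dflowA]
    case ρ =>
      refine ⟨j.1.2.2 .ρ ^ 2 * j.1.2.2 .u, .congr_fun (.congr_deriv ((ht .ρ).add
        ((hq .ρ).pow_two.mul (((hs .r).mul (hq .u)).add ((hq .r).mul (hs .u))))) ?_) hE⟩
      simp only [dflowA, Option.elim, hj]
      field_simp
      ring
    case p =>
      refine ⟨γ * j.1.2.2 .ρ * j.1.2.2 .p * j.1.2.2 .u, .congr_fun (.congr_deriv ((ht .p).add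
        ((((hc γ).mul (hq .ρ)).mul (hq .p)).mul
          (((hs .r).mul (hq .u)).add ((hq .r).mul (hs .u))))) ?_) hE⟩
      simp only [dflowA, Option.elim, hj]
      field_simp
      ring
    case Hθ =>
      refine ⟨A * j.1.2.2 .ρ * j.1.2.2 .v / j.1.2.2 .r, .congr_fun (.congr_deriv ((((ht .Hθ).sub
        (((hc A).mul (hq .ρ)).mul (hs .v))).add
        (((((hc A).mul (hq .ρ)).mul (hq .v)).mul (hs .r)).div (hq .r) hr)).add
        ((((hq .r).mul (hq .ρ)).mul (hq .Hθ)).mul (hs .u))) ?_) hE⟩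
      simp only [dflowA, Option.elim, hj]
      field_simp
      ring
    case Hz =>
      refine ⟨j.1.2.2 .ρ * j.1.2.2 .Hz * j.1.2.2 .u, .congr_fun (.congr_deriv ((ht .Hz).sub
        ((hq .ρ).mul (((hc A).mul (hs .w)).sub
          ((hq .Hz).mul (((hs .r).mul (hq .u)).add ((hq .r).mul (hs .u))))))) ?_) hE⟩
      simp only [dflowA, Option.elim, hj]
      field_simp
      ring

theorem systemA_eq_zero_iff (γ A : ℝ) (j : Jet VarA) (hr : j.1.2.2 .r ≠ 0)
    (hρ : j.1.2.2 .ρ ≠ 0) : (∀ k, systemA γ A k j = 0) ↔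
      j.2.2 .r = (j.1.2.2 .r)⁻¹ * (j.1.2.2 .ρ)⁻¹ ∧
      ∀ a, j.2.1 a = flowA γ A (j.1.2.2 .r)⁻¹ (j.1.2.2 .ρ)⁻¹ j.1.2.2 j.2.2 a := by
  simp only [systemA_eq_expandedA γ A _ j hr, Option.forall]
  have h0 : expandedA γ A none j = 0 ↔ j.2.2 .r = (j.1.2.2 .r)⁻¹ * (j.1.2.2 .ρ)⁻¹ := by
    simp only [expandedA, sub_eq_zero, one_div, mul_inv]
  rw [h0]
  refine and_congr_right fun hj => forall_congr' fun a => ?_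
  rw [← sub_eq_zero (a := j.2.1 a)]
  suffices h : expandedA γ A (some a) j =
      j.2.1 a - flowA γ A (j.1.2.2 .r)⁻¹ (j.1.2.2 .ρ)⁻¹ j.1.2.2 j.2.2 a by rw [h]
  cases a <;> simp only [expandedA, flowA, hj] <;> field_simp <;> ring

/-- The linearized system is triangular: once the constraint `none` holds, the multiples of it in
the other equations drop out. -/
theorem fderiv_systemA_eq_zero_iff (γ A : ℝ) (j v : Jet VarA) (hr : j.1.2.2 .r ≠ 0)
    (hρ : j.1.2.2 .ρ ≠ 0) (hj : j.2.2 .r = (j.1.2.2 .r)⁻¹ * (j.1.2.2 .ρ)⁻¹) :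
    (∀ k, fderiv ℝ (systemA γ A k) j v = 0) ↔
      v.2.2 .r = -((j.1.2.2 .r)⁻¹ * (j.1.2.2 .ρ)⁻¹ *
          ((j.1.2.2 .r)⁻¹ * v.1.2.2 .r + (j.1.2.2 .ρ)⁻¹ * v.1.2.2 .ρ)) ∧
      ∀ a, v.2.1 a = dflowA γ A (j.1.2.2 .r)⁻¹ (j.1.2.2 .ρ)⁻¹ j.1.2.2 j.2.2 v.1.2.2 v.2.2 a := by
  choose m hm using fun k => hasDirDeriv_systemA γ A k j v hr hρ hj
  simp only [fun k => (hm k).2, Option.forall, Option.elim, zero_add, one_mul]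
  rw [← sub_eq_zero (a := v.2.2 .r), sub_neg_eq_add]
  refine and_congr_right fun h => forall_congr' fun a => ?_
  rw [h, mul_zero, add_zero, sub_eq_zero]

/-! ### The abstract differential ring and its model -/

/-- A commutative algebra with commuting partial derivatives with respect to the independent and
dependent variables, none of which is a zero divisor. -/
structure Calculus (D : Type) (R : Type*) [DecidableEq D] [CommRing R] [Algebra ℝ R] where
  d : Coord D → Derivation ℝ R R
  x : Coord D → R
  d_x : ∀ i j, d i (x j) = if i = j then 1 else 0
  comm : ∀ i j f, d i (d j f) = d j (d i f)
  cancel : ∀ i f, x i * f = 0 → f = 0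

namespace Calculus

variable {D : Type} {R : Type*} [DecidableEq D] [CommRing R] [Algebra ℝ R] (C : Calculus D R)

/-- The total derivative along `i`, where `σ` are the derivatives of the dependent variables. -/
def tot [Fintype D] (i : Coord D) (σ : D → R) (f : R) : R := C.d i f + ∑ a, σ a * C.d (.q a) f

/-- The coefficients of the first prolongation at the derivatives `σ` along `i`, where `τ'`, `σ'`
are the derivatives along `t` and `s`. -/
def prol [Fintype D] (ξt ξs : R) (η : D → R) (τ' σ' : D → R) (i : Coord D) (σ : D → R) (a : D) :
    R := C.tot i σ (η a) - τ' a * C.tot i σ ξt - σ' a * C.tot i σ ξs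

/-- The values of the dependent variables. -/
abbrev v (a : D) : R := C.x (.q a)

end Calculus

section

open TopologicalSpace Smooth

variable {D : Type} [Fintype D]

/-- A smooth function without zeros is invertible. -/
theorem Smooth.exists_inv {U : Opens (Base D)} (f : Smooth U) (hf : ∀ y, eval y f ≠ 0) :
    ∃ g : Smooth U, f * g = 1 ∧ ∀ y, eval y g = (eval y f)⁻¹ := by
  have hg : ContDiffOn ℝ ∞ (fun y => (extend f y)⁻¹) U :=
    (contDiffOn_extend f).inv fun y hy => by
      rw [extend_apply f ⟨y, hy⟩]
      exact hf _
  have h : ∀ y, eval y (of _ hg) = (eval y f)⁻¹ := fun y => by rw [eval_of, extend_apply]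
  exact ⟨of _ hg, ext_eval fun y => by rw [map_mul, h, mul_inv_cancel₀ (hf y), map_one], h⟩

variable [DecidableEq D]

/-- The calculus of smooth functions on an open set. -/
noncomputable def smoothCalculus (U : Opens (Base D)) : Calculus D (Smooth U) where
  d := par
  x := crd
  d_x := par_crd
  comm := par_comm
  cancel := fun i _ h => eq_zero_of_crd_mul i h

variable {U : Opens (Base D)} {X : Base D → Base D}

/-- The coefficients of a smooth vector field. -/
noncomputable def coeff (hX : ContDiffOn ℝ ∞ X U) (i : Coord D) : Smooth U :=
  of (fun y => Coord.fn i (X y)) ((Coord.fn i).contDiff.comp_contDiffOn hX)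

theorem eval_tot_t {f : Smooth U} {g : Base D → ℝ} (h : ∀ y : U, g y = eval y f) (y : U)
    (τ : D → Smooth U) (σ : D → ℝ) : eval y ((smoothCalculus U).tot .t τ f) =
      Dt g ((y : Base D), fun a => eval y (τ a), σ) := by
  simp [Dt, fderiv_eq_sum h, Calculus.tot, smoothCalculus]

theorem eval_tot_s {f : Smooth U} {g : Base D → ℝ} (h : ∀ y : U, g y = eval y f) (y : U)
    (τ : D → ℝ) (σ : D → Smooth U) : eval y ((smoothCalculus U).tot .s σ f) =
      Ds g ((y : Base D), τ, fun a => eval y (σ a)) := by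
  simp [Ds, fderiv_eq_sum h, Calculus.tot, smoothCalculus]

/-- The values of the coefficients of the prolongation. -/
theorem eval_prol (hX : ContDiffOn ℝ ∞ X U) (τ σ : D → Smooth U) (y : U) :
    prolong X ((y : Base D), fun a => eval y (τ a), fun a => eval y (σ a)) =
      (X y, fun a => eval y ((smoothCalculus U).prol (coeff hX .t) (coeff hX .s)
          (fun a => coeff hX (.q a)) τ σ .t τ a),
        fun a => eval y ((smoothCalculus U).prol (coeff hX .t) (coeff hX .s)
          (fun a => coeff hX (.q a)) τ σ .s σ a)) := by
  have h : ∀ i : Coord D, ∀ y : U, Coord.fn i (X y) = eval y (coeff hX i) := fun i y => rfl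
  have ht := fun i : Coord D => eval_tot_t (g := fun y => Coord.fn i (X y)) (h i) y τ
    (fun a => eval y (σ a))
  have hs := fun i : Coord D => eval_tot_s (g := fun y => Coord.fn i (X y)) (h i) y
    (fun a => eval y (τ a)) σ
  simp only [prolong, Calculus.prol, map_sub, map_mul, ht, hs]
  rfl

end

/-! ### Determining equations for A ≠ 0 -/

section CaseA

open TopologicalSpace Smooth

/-- The determining equations of the symmetries of the system for `A ≠ 0`. -/
def IsSymmetryA {R : Type*} [CommRing R] [Algebra ℝ R] (C : Calculus VarA R) (g A ir iρ ξt ξs : R)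
    (η : VarA → R) : Prop :=
  ∀ σ : VarA → R, σ .r = ir * iρ →
    C.prol ξt ξs η (flowA g A ir iρ C.v σ) σ .s σ .r = -(ir * iρ * (ir * η .r + iρ * η .ρ)) ∧
    ∀ a, C.prol ξt ξs η (flowA g A ir iρ C.v σ) σ .t (flowA g A ir iρ C.v σ) a =
      dflowA g A ir iρ C.v σ η (C.prol ξt ξs η (flowA g A ir iρ C.v σ) σ .s σ) a

/-- For any smooth `σ` with the prescribed `σ r`, the jets `(y, τ y, σ y)` with `τ` given by the
flow lie on the solution manifold. The pointwise criterion along this family is an identity between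
elements of the ring. -/
theorem Admits.isSymmetryA {γ A : ℝ} {U : Opens (Base VarA)} (hU : (U : Set (Base VarA)) ⊆ domainA)
    {X : Base VarA → Base VarA} (hX : Admits (systemA γ A) U X) :
    ∃ ir iρ : Smooth U, crd (.q .r) * ir = 1 ∧ crd (.q .ρ) * iρ = 1 ∧
      IsSymmetryA (smoothCalculus U) (algebraMap ℝ _ γ) (algebraMap ℝ _ A) ir iρ
        (coeff hX.1 .t) (coeff hX.1 .s) (fun a => coeff hX.1 (.q a)) := by
  have hr : ∀ y, eval y (crd (.q .r) : Smooth U) ≠ 0 := fun y => (hU y.2).1.ne'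
  have hρ : ∀ y, eval y (crd (.q .ρ) : Smooth U) ≠ 0 := fun y => (hU y.2).2.ne'
  obtain ⟨ir, hir, eir⟩ := Smooth.exists_inv _ hr
  obtain ⟨iρ, hiρ, eiρ⟩ := Smooth.exists_inv _ hρ
  refine ⟨ir, iρ, hir, hiρ, fun σ hσ => ?_⟩
  set τ := flowA (algebraMap ℝ (Smooth U) γ) (algebraMap ℝ _ A) ir iρ (smoothCalculus U).v σ
    with hτ
  have hc : ∀ y : U, eval y (σ .r) = ((y : Base VarA).2.2 .r)⁻¹ * ((y : Base VarA).2.2 .ρ)⁻¹ := by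
    intro y
    rw [hσ, map_mul, eir, eiρ]
    rfl
  have hτ' : ∀ (y : U) a, eval y (τ a) = flowA γ A ((y : Base VarA).2.2 .r)⁻¹
      ((y : Base VarA).2.2 .ρ)⁻¹ (y : Base VarA).2.2 (fun a => eval y (σ a)) a := by
    intro y a
    refine (map_flowA (eval y : Smooth U →+* ℝ) (algebraMap ℝ _ γ) (algebraMap ℝ _ A) ir iρ
      (smoothCalculus U).v σ a).trans ?_
    simp only [RingHom.coe_coe, AlgHom.commutes, eir, eiρ]
    rfl
  have main := fun y : U => (fderiv_systemA_eq_zero_iff γ A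
    ((y : Base VarA), fun a => eval y (τ a), fun a => eval y (σ a))
    (prolong X ((y : Base VarA), fun a => eval y (τ a), fun a => eval y (σ a)))
    (hr y) (hρ y) (hc y)).1
    (hX.2 _ y.2 ((systemA_eq_zero_iff γ A _ (hr y) (hρ y)).2 ⟨hc y, hτ' y⟩))
  simp only [eval_prol hX.1] at main
  refine ⟨ext_eval fun y => ?_, fun a => ext_eval fun y => ?_⟩
  · refine (main y).1.trans ?_
    simp only [map_mul, map_neg, map_add, eir, eiρ]
    rfl
  · refine ((main y).2 a).trans (Eq.symm ?_)
    refine (map_dflowA (eval y : Smooth U →+* ℝ) (algebraMap ℝ _ γ) (algebraMap ℝ _ A) ir iρ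
      (smoothCalculus U).v σ _ _ a).trans ?_
    simp only [RingHom.coe_coe, AlgHom.commutes, eir, eiρ]
    rfl

end CaseA

/-! ### Cancellation rules and the contact condition -/

namespace Calculus

theorem cancel_const {R : Type*} [CommRing R] [Algebra ℝ R] {c : ℝ} (hc : c ≠ 0)
    {f : R} (h : algebraMap ℝ R c * f = 0) : f = 0 := by
  rw [← Algebra.smul_def] at h
  simpa [smul_smul, hc] using congrArg (c⁻¹ • ·) h

variable {D : Type} {R : Type*} [DecidableEq D] [CommRing R] [Algebra ℝ R] (C : Calculus D R)

theorem d_v (i : Coord D) (a : D) : C.d i (C.v a) = if i = .q a then 1 else 0 := C.d_x i _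

theorem d_inv {a : D} {f : R} (h : C.v a * f = 1) (i : Coord D) :
    C.d i f = if i = .q a then -f ^ 2 else 0 := by
  have h1 := congrArg (C.d i) h
  simp only [Derivation.leibniz, smul_eq_mul, d_v, Derivation.map_one_eq_zero] at h1
  split_ifs at h1 ⊢
  · linear_combination f * h1 - C.d i f * h
  · linear_combination f * h1 - C.d i f * h

theorem d_two (i : Coord D) : C.d i 2 = 0 := by
  simpa using (C.d i).map_natCast 2

theorem d_comm_zero {i j : Coord D} {f : R} (h : C.d j f = 0) : C.d j (C.d i f) = 0 := by
  rw [C.comm, h, map_zero]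

/-- A generator that preserves the relation `dr = u dt + ds / (r ρ)` modulo the other
differentials is determined by functions of the variables in this relation. -/
theorem contact {r u ρ : D} (hru : r ≠ u) (hrρ : r ≠ ρ) (huρ : u ≠ ρ) {ir iρ ξt ξs ηr : R}
    (hir : C.v r * ir = 1) (hiρ : C.v ρ * iρ = 1)
    (h : ∀ a, a ≠ r → C.d (.q a) ηr = C.v u * C.d (.q a) ξt + ir * iρ * C.d (.q a) ξs) :
    (∀ a, a ≠ r → a ≠ u → a ≠ ρ → C.d (.q a) ξt = 0 ∧ C.d (.q a) ξs = 0) ∧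
      C.d (.q ρ) ξt = -(ir * iρ ^ 2 * C.d (.q u) ξs) := by
  -- Equality of the mixed second derivatives of `ηr`. The second derivatives of `ξt` and `ξs`
  -- cancel, and only derivatives of `u` and of `ir * iρ` remain. For `a` outside `r, u, ρ`, the
  -- choice `b = u` leaves `∂_a ξt` and `b = ρ` leaves a unit times `∂_a ξs`. The pair `ρ, u` gives
  -- the last relation.
  have key : ∀ a b, a ≠ r → b ≠ r →
      C.d (.q b) (C.v u * C.d (.q a) ξt + ir * iρ * C.d (.q a) ξs) =
        C.d (.q a) (C.v u * C.d (.q b) ξt + ir * iρ * C.d (.q b) ξs) := by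
    intro a b ha hb
    rw [← h a ha, ← h b hb, C.comm]
  simp only [map_add, Derivation.leibniz, smul_eq_mul, d_v, C.d_inv hir, C.d_inv hiρ,
    Coord.q.injEq] at key
  constructor
  · intro a hr hu hρ
    have h1 := key a u hr hru.symm
    have h2 := key a ρ hr hrρ.symm
    rw [C.comm (.q u), C.comm (.q u)] at h1
    rw [C.comm (.q ρ), C.comm (.q ρ)] at h2
    simp only [hr, hu, hρ, hru.symm, hrρ.symm, huρ, huρ.symm, if_true, if_false] at h1 h2
    refine ⟨by linear_combination h1, ?_⟩
    linear_combination -C.v r * C.v ρ ^ 2 * h2 - C.d (.q a) ξs * (C.v ρ ^ 2 * iρ ^ 2) * hir -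
      C.d (.q a) ξs * (C.v ρ * iρ + 1) * hiρ
  · have h1 := key ρ u hrρ.symm hru.symm
    rw [C.comm (.q u), C.comm (.q u)] at h1
    simp only [hru.symm, hrρ.symm, huρ, huρ.symm, if_true, if_false] at h1
    linear_combination h1

end Calculus

/-! ### Solution of the determining equations for A ≠ 0 -/

section CaseA

/-- The `s`-derivatives in the case `A ≠ 0`. -/
def sderivA {R : Type*} (c θ z u v w ρ p h k : R) : VarA → R
  | .r => c | .θ => θ | .z => z | .u => u | .v => v | .w => w | .ρ => ρ | .p => p | .Hθ => h
  | .Hz => k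

variable {R : Type*} [CommRing R] [Algebra ℝ R] {C : Calculus VarA R} {γ A : ℝ}
  {ir iρ ξt ξs : R} {η : VarA → R}

/-- The coefficient of `a_s` in the prolonged equation `r_s = 1/(rρ)`, whose right side contains no
other s-derivative. -/
theorem IsSymmetryA.contact (h : IsSymmetryA C (algebraMap ℝ R γ) (algebraMap ℝ R A) ir iρ ξt ξs η)
    (a : VarA) (ha : a ≠ .r) :
    C.d (.q a) (η .r) = C.v .u * C.d (.q a) ξt + ir * iρ * C.d (.q a) ξs := by
  have h0 := (h (fun b => if b = .r then ir * iρ else 0) (by simp)).1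
  have h1 := (h (fun b => if b = .r then ir * iρ else if b = a then 1 else 0) (by simp)).1
  simp only [Calculus.prol, Calculus.tot, VarA.sum_eq, flowA] at h0 h1
  cases a <;> simp at ha h0 h1 <;> linear_combination h1 - h0

/-- The coefficient at `∂_s` depends on `s` only, and those at `∂_t` and `∂_r` on `t`, `s`, `r`. -/
theorem IsSymmetryA.base (hir : C.v .r * ir = 1) (hiρ : C.v .ρ * iρ = 1)
    (h : IsSymmetryA C (algebraMap ℝ R γ) (algebraMap ℝ R A) ir iρ ξt ξs η) :
    (C.d .t ξs = 0 ∧ ∀ a, C.d (.q a) ξs = 0) ∧ (∀ a, a ≠ .r → C.d (.q a) ξt = 0) ∧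
      ∀ a, a ≠ .r → C.d (.q a) (η .r) = 0 := by
  obtain ⟨h1, h2⟩ := C.contact (by decide) (by decide) (by decide) hir hiρ h.contact
  have hs := fun a => fun b c d => (h1 a b c d).2
  have ht := fun a => fun b c d => (h1 a b c d).1
  -- No equation contains `θ_s`; in the prolonged equation for `θ` it occurs only in `-θ_s * D_t
  -- ξs`, so `D_t ξs = 0`.
  have hθ : ∀ z u v w ρ p k l : R,
      C.tot .t (flowA (algebraMap ℝ R γ) (algebraMap ℝ R A) ir iρ C.v
        (sderivA (ir * iρ) 0 z u v w ρ p k l)) ξs = 0 := by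
    intro z u v w ρ p k l
    have e0 := (h (sderivA (ir * iρ) 0 z u v w ρ p k l) rfl).2 .θ
    have e1 := (h (sderivA (ir * iρ) 1 z u v w ρ p k l) rfl).2 .θ
    simp only [Calculus.prol, Calculus.tot, VarA.sum_eq, flowA, dflowA, sderivA] at e0 e1 ⊢
    linear_combination e0 - e1
  simp only [Calculus.tot, VarA.sum_eq, flowA, sderivA, hs .θ (by decide) (by decide) (by decide),
    hs .z (by decide) (by decide) (by decide), hs .v (by decide) (by decide) (by decide),
    hs .w (by decide) (by decide) (by decide), hs .p (by decide) (by decide) (by decide),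
    hs .Hθ (by decide) (by decide) (by decide), hs .Hz (by decide) (by decide) (by decide)] at hθ
  -- In `D_t ξs = 0` the derivative `p_s` enters only through `u_t`, and then `u_s` only through
  -- `ρ_t`. What remains is affine in `u`.
  have su : C.d (.q .u) ξs = 0 := C.cancel (.q .r) _ (by
    linear_combination hθ 0 0 0 0 0 0 0 0 - hθ 0 0 0 0 0 1 0 0)
  have sρ : C.d (.q .ρ) ξs = 0 := C.cancel (.q .r) _ (C.cancel (.q .ρ) _ (C.cancel (.q .ρ) _ (by
    linear_combination hθ 0 0 0 0 0 0 0 0 - hθ 0 1 0 0 0 0 0 0)))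
  have s0 : C.d .t ξs + C.v .u * C.d (.q .r) ξs = 0 := by
    have := hθ 0 0 0 0 0 0 0 0
    rw [su, sρ] at this
    linear_combination this
  have sr : C.d (.q .r) ξs = 0 := by
    have := congrArg (C.d (.q .u)) s0
    simp only [map_add, Derivation.leibniz, smul_eq_mul, C.d_v, C.d_comm_zero su, map_zero] at this
    simpa using this
  have st : C.d .t ξs = 0 := by rw [sr] at s0; simpa using s0
  have hs' : ∀ a, C.d (.q a) ξs = 0 := by
    intro a
    cases a
    all_goals first
      | exact su | exact sρ | exact sr | exact hs _ (by decide) (by decide) (by decide)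
  have tρ : C.d (.q .ρ) ξt = 0 := by rw [h2, su]; ring
  have hu : ∀ p : R, _ := fun p => (h (sderivA (ir * iρ) 0 0 0 0 0 0 p 0 0) rfl).2 .u
  simp only [Calculus.prol, Calculus.tot, VarA.sum_eq, flowA, dflowA, sderivA, hs', tρ, st,
    ht .θ (by decide) (by decide) (by decide),
    ht .z (by decide) (by decide) (by decide), ht .v (by decide) (by decide) (by decide),
    ht .w (by decide) (by decide) (by decide), ht .p (by decide) (by decide) (by decide),
    ht .Hθ (by decide) (by decide) (by decide), ht .Hz (by decide) (by decide) (by decide)] at hu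
  have tu : C.d (.q .u) ξt = 0 := by
    refine C.cancel (.q .r) _ (C.cancel (.q .r) _ (Calculus.cancel_const (c := 2) (by simp) ?_))
    rw [map_ofNat]
    linear_combination 2 * hu 0 - hu 1 - hu (-1)
  have ht' : ∀ a, a ≠ .r → C.d (.q a) ξt = 0 := by
    intro a ha
    cases a
    all_goals first
      | exact tu | exact tρ | exact absurd rfl ha | exact ht _ (by decide) (by decide) (by decide)
  refine ⟨⟨st, hs'⟩, ht', fun a ha => ?_⟩
  rw [h.contact a ha, hs', ht' a ha]
  ring

end CaseA

section CaseA

variable {R : Type*} [CommRing R] [Algebra ℝ R] {C : Calculus VarA R} {γ A : ℝ}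
  {ir iρ ξt ξs : R} {η : VarA → R}

/-- Functions whose derivative along the flow does not depend on the `s`-derivatives. -/
theorem flowA_invariant (hA : A ≠ 0) {f K : R} (hf : ∀ u v w p k l : R,
      C.tot .t (flowA (algebraMap ℝ R γ) (algebraMap ℝ R A) ir iρ C.v
        (sderivA (ir * iρ) 0 0 u v w 0 p k l)) f = K) :
    (C.d (.q .u) f = 0 ∧ C.d (.q .v) f = 0 ∧ C.d (.q .w) f = 0 ∧ C.d (.q .Hθ) f = 0 ∧
      C.d (.q .Hz) f = 0) ∧
      C.v .ρ * C.d (.q .ρ) f + algebraMap ℝ R γ * C.v .p * C.d (.q .p) f = 0 ∧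
      K = C.d .t f + C.v .u * C.d (.q .r) f + C.v .v * ir * C.d (.q .θ) f
        + C.v .w * C.d (.q .z) f := by
  simp only [Calculus.tot, VarA.sum_eq, flowA, sderivA] at hf
  -- Each s-derivative switches on one of the flow components: `p_s` moves `u`, and because `A ≠ 0`,
  -- `Hθ_s` and `Hz_s` move `v` and `w`, while `v_s` and `w_s` move `Hθ` and `Hz`. The coefficient
  -- of `u_s` is the entropy-preserving direction.
  have fu : C.d (.q .u) f = 0 := C.cancel (.q .r) _ (by
    linear_combination hf 0 0 0 0 0 0 - hf 0 0 0 1 0 0)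
  have fv : C.d (.q .v) f = 0 := Calculus.cancel_const hA (by
    linear_combination hf 0 0 0 0 1 0 - hf 0 0 0 0 0 0 + C.v .r * C.v .Hθ * fu)
  have fw : C.d (.q .w) f = 0 := Calculus.cancel_const hA (by
    linear_combination hf 0 0 0 0 0 1 - hf 0 0 0 0 0 0 + C.v .r * C.v .Hz * fu)
  have fh : C.d (.q .Hθ) f = 0 := C.cancel (.q .ρ) _ (Calculus.cancel_const hA (by
    linear_combination hf 0 1 0 0 0 0 - hf 0 0 0 0 0 0))
  have fk : C.d (.q .Hz) f = 0 := C.cancel (.q .ρ) _ (Calculus.cancel_const hA (by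
    linear_combination hf 0 0 1 0 0 0 - hf 0 0 0 0 0 0))
  have fρ : C.v .ρ * C.d (.q .ρ) f + algebraMap ℝ R γ * C.v .p * C.d (.q .p) f = 0 :=
    C.cancel (.q .ρ) _ (C.cancel (.q .r) _ (by
      linear_combination hf 0 0 0 0 0 0 - hf 1 0 0 0 0 0
        - C.v .r * C.v .ρ * C.v .Hθ * fh - C.v .r * C.v .ρ * C.v .Hz * fk))
  refine ⟨⟨fu, fv, fw, fh, fk⟩, fρ, ?_⟩
  have := hf 0 0 0 0 0 0
  rw [fu, fv, fw, fh, fk] at this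
  linear_combination -this - C.v .u * ir * fρ

/-- The determining equations with the known derivatives of the coefficients at `∂_t` and `∂_s`. -/
theorem IsSymmetryA.reduce (hir : C.v .r * ir = 1) (hiρ : C.v .ρ * iρ = 1)
    (h : IsSymmetryA C (algebraMap ℝ R γ) (algebraMap ℝ R A) ir iρ ξt ξs η) (σ : VarA → R)
    (hσ : σ .r = ir * iρ) (a : VarA) :
    C.tot .t (flowA (algebraMap ℝ R γ) (algebraMap ℝ R A) ir iρ C.v σ) (η a) -
      flowA (algebraMap ℝ R γ) (algebraMap ℝ R A) ir iρ C.v σ a *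
        (C.d .t ξt + C.v .u * C.d (.q .r) ξt) =
      dflowA (algebraMap ℝ R γ) (algebraMap ℝ R A) ir iρ C.v σ η (fun b => C.tot .s σ (η b) -
        flowA (algebraMap ℝ R γ) (algebraMap ℝ R A) ir iρ C.v σ b *
          (C.d .s ξt + ir * iρ * C.d (.q .r) ξt) - σ b * C.d .s ξs) a := by
  obtain ⟨⟨h1, h2⟩, h3, h4⟩ := h.base hir hiρ
  have ht : C.tot .t (flowA (algebraMap ℝ R γ) (algebraMap ℝ R A) ir iρ C.v σ) ξt =
      C.d .t ξt + C.v .u * C.d (.q .r) ξt := by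
    simp [Calculus.tot, VarA.sum_eq, h3, flowA]
  have hs : C.tot .t (flowA (algebraMap ℝ R γ) (algebraMap ℝ R A) ir iρ C.v σ) ξs = 0 := by
    simp [Calculus.tot, h1, h2]
  have kt : C.tot .s σ ξt = C.d .s ξt + ir * iρ * C.d (.q .r) ξt := by
    simp [Calculus.tot, VarA.sum_eq, h3, hσ]
  have ks : C.tot .s σ ξs = C.d .s ξs := by
    simp [Calculus.tot, h2]
  have := (h σ hσ).2 a
  rw [show C.prol ξt ξs η _ σ .s σ = fun b => C.prol ξt ξs η _ σ .s σ b from rfl] at this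
  simp only [Calculus.prol, ht, hs, kt, ks, mul_zero, sub_zero] at this
  exact this

/-- Consequences of the kinematic equations for `r`, `θ`, `z`. -/
theorem IsSymmetryA.kinematics (hA : A ≠ 0) (hir : C.v .r * ir = 1) (hiρ : C.v .ρ * iρ = 1)
    (h : IsSymmetryA C (algebraMap ℝ R γ) (algebraMap ℝ R A) ir iρ ξt ξs η) :
    (C.d .t ξs = 0 ∧ (∀ a, C.d (.q a) ξs = 0) ∧ C.d .s (C.d .s ξs) = 0) ∧
    (C.d .s ξt = 0 ∧ C.d (.q .r) ξt = 0 ∧ ∀ a, a ≠ .r → C.d (.q a) ξt = 0) ∧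
    (C.d .s (η .r) = 0 ∧ C.d (.q .r) (η .r) = 2 * C.d .t ξt - C.d .s ξs - ir * η .r ∧
      ∀ a, a ≠ .r → C.d (.q a) (η .r) = 0) ∧
    (η .u = C.d .t (η .r) + C.v .u * C.d (.q .r) (η .r) - C.v .u * C.d .t ξt ∧
      η .v = C.v .r * (C.d .t (η .θ) + C.v .w * C.d (.q .z) (η .θ)) + C.v .v * C.d (.q .θ) (η .θ)
        - C.v .v * C.d .t ξt + C.v .v * ir * η .r ∧
      η .w = C.d .t (η .z) + C.v .v * ir * C.d (.q .θ) (η .z) + C.v .w * C.d (.q .z) (η .z)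
        - C.v .w * C.d .t ξt ∧
      η .ρ = 2 * C.v .ρ * (C.d .s ξs - C.d .t ξt)) ∧
    (C.d (.q .r) (η .θ) = 0 ∧ C.d (.q .u) (η .θ) = 0 ∧ C.d (.q .v) (η .θ) = 0 ∧
      C.d (.q .w) (η .θ) = 0 ∧ C.d (.q .Hθ) (η .θ) = 0 ∧ C.d (.q .Hz) (η .θ) = 0 ∧
      C.v .ρ * C.d (.q .ρ) (η .θ) + algebraMap ℝ R γ * C.v .p * C.d (.q .p) (η .θ) = 0) ∧
    (C.d (.q .r) (η .z) = 0 ∧ C.d (.q .u) (η .z) = 0 ∧ C.d (.q .v) (η .z) = 0 ∧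
      C.d (.q .w) (η .z) = 0 ∧ C.d (.q .Hθ) (η .z) = 0 ∧ C.d (.q .Hz) (η .z) = 0 ∧
      C.v .ρ * C.d (.q .ρ) (η .z) + algebraMap ℝ R γ * C.v .p * C.d (.q .p) (η .z) = 0) := by
  obtain ⟨⟨st, sq⟩, tq, rq⟩ := h.base hir hiρ
  have H := fun u v w ρ p k l => h.reduce hir hiρ (sderivA (ir * iρ) 0 0 u v w ρ p k l) rfl
  -- The equation `r_t = u` yields `η u`; the prolonged `r_s = 1/(rρ)` yields `η ρ` below.
  have ηu : η .u = C.d .t (η .r) + C.v .u * C.d (.q .r) (η .r)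
      - C.v .u * (C.d .t ξt + C.v .u * C.d (.q .r) ξt) := by
    have := H 0 0 0 0 0 0 0 .r
    simp only [Calculus.tot, VarA.sum_eq, flowA, dflowA, sderivA, rq, ne_eq, reduceCtorEq,
      not_false_eq_true] at this
    linear_combination -this
  have ηρ : η .ρ = C.v .ρ * (C.d .s ξs - ir * η .r - C.v .r * C.v .ρ * C.d .s (η .r)
      - C.d (.q .r) (η .r) + C.v .r * C.v .ρ * C.v .u * C.d .s ξt + C.v .u * C.d (.q .r) ξt) := by
    have := (h (sderivA (ir * iρ) 0 0 0 0 0 0 0 0 0) rfl).1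
    simp only [Calculus.prol, Calculus.tot, VarA.sum_eq, flowA, sderivA, rq, tq, sq, ne_eq,
      reduceCtorEq, not_false_eq_true] at this
    linear_combination (C.v .r * C.v .ρ ^ 2) * this -
      (C.v .ρ * (C.v .ρ * iρ) * (C.d (.q .r) (η .r) - C.v .u * C.d (.q .r) ξt - C.d .s ξs)
        + iρ * C.v .ρ ^ 2 * (ir * η .r + iρ * η .ρ)) * hir -
      (C.v .ρ * (C.d (.q .r) (η .r) - C.v .u * C.d (.q .r) ξt - C.d .s ξs)
        + C.v .ρ * ir * η .r + (C.v .ρ * iρ + 1) * η .ρ) * hiρ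
  -- In `θ_t = v/r` no s-derivative occurs, so `D_t η θ` is the same for all of them; likewise for
  -- `z_t = w`.
  obtain ⟨⟨θu, θv, θw, θh, θk⟩, θρ, ηv⟩ := flowA_invariant (f := η .θ)
    (K := η .v * ir - C.v .v * ir ^ 2 * η .r + C.v .v * ir * (C.d .t ξt + C.v .u * C.d (.q .r) ξt))
    hA (fun u v w p k l => by
      have := H u v w 0 p k l .θ
      simp only [flowA, dflowA] at this
      linear_combination this)
  obtain ⟨⟨zu, zv, zw, zh, zk⟩, zρ, ηw⟩ := flowA_invariant (f := η .z)
    (K := η .w + C.v .w * (C.d .t ξt + C.v .u * C.d (.q .r) ξt))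
    hA (fun u v w p k l => by
      have := H u v w 0 p k l .z
      simp only [flowA, dflowA] at this
      linear_combination this)
  replace ηw : η .w = C.d .t (η .z) + C.v .u * C.d (.q .r) (η .z)
      + C.v .v * ir * C.d (.q .θ) (η .z) + C.v .w * C.d (.q .z) (η .z)
      - C.v .w * (C.d .t ξt + C.v .u * C.d (.q .r) ξt) := by
    linear_combination ηw
  have uw : C.d (.q .w) (η .u) = 0 := by
    rw [ηu]
    simp [C.d_v, C.d_comm_zero (rq .w (by decide)), C.d_comm_zero (tq .w (by decide))]
  have wk : C.d (.q .Hz) (η .w) = 0 := by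
    rw [ηw]
    simp [C.d_v, C.d_inv hir, C.d_comm_zero zk, C.d_comm_zero (tq .Hz (by decide))]
  have wu : C.d (.q .u) (η .w) = C.d (.q .r) (η .z) - C.v .w * C.d (.q .r) ξt := by
    rw [ηw]
    simp [C.d_v, C.d_inv hir, C.d_comm_zero zu, C.d_comm_zero (tq .u (by decide))]
  have ρk : C.d (.q .Hz) (η .ρ) = 0 := by
    rw [ηρ]
    simp [C.d_v, C.d_inv hir, C.d_comm_zero (rq .Hz (by decide)), C.d_comm_zero (sq .Hz),
      C.d_comm_zero (tq .Hz (by decide)), rq]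
  have ew := fun u w ρ l => H u 0 w ρ 0 0 l .w
  have ek := fun w => H 0 0 w 0 0 0 0 .Hz
  simp only [Calculus.tot, VarA.sum_eq, flowA, dflowA, sderivA, wk] at ew ek
  -- Coefficients of `w_s` and `ρ_s` in the `w` equation. Since `η Hz` turns out free of `ρ`,
  -- differentiating `kw` in `ρ` separates `∂_s ξt` from `∂_r ξt`.
  have kw : C.d (.q .w) (η .Hz) =
      algebraMap ℝ R A * C.v .ρ * (C.d .s ξt + ir * iρ * C.d (.q .r) ξt) := by
    refine sub_eq_zero.1 (Calculus.cancel_const hA ?_)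
    linear_combination ew 0 0 0 0 - ew 0 1 0 0
  have kρ : C.d (.q .ρ) (η .Hz) = 0 := by
    refine Calculus.cancel_const hA ?_
    linear_combination ew 0 0 0 0 - ew 0 0 1 0
  have ts : C.d .s ξt = 0 := by
    have := congrArg (C.d (.q .ρ)) kw
    simp [C.d_v, C.d_inv hir, C.d_inv hiρ, C.d_comm_zero (tq .ρ (by decide)),
      C.d_comm_zero kρ] at this
    refine Calculus.cancel_const hA ?_
    linear_combination -this + algebraMap ℝ R A * ir * iρ * C.d (.q .r) ξt * hiρ
  -- The coefficient of `w_s` in the `Hz` equation and that of `Hz_s` in the `w` equation both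
  -- contain `∂_w η w - ∂_Hz η Hz`. Eliminating it determines `η ρ`.
  have star : algebraMap ℝ R A * (η .ρ + 2 * C.v .ρ * (C.d .t ξt + C.v .u * C.d (.q .r) ξt)
      - 2 * C.v .ρ * C.d .s ξs) = - (C.v .r * C.v .ρ * C.v .Hz * C.d (.q .u) (η .w)) := by
    linear_combination ek 0 - ek 1 - C.v .ρ * (ew 0 0 0 1 - ew 0 0 0 0)
      + C.v .r * C.v .ρ * C.v .Hz * uw
  -- The left side of `star` does not depend on `Hz`, while the right side is linear in it.
  have wu0 : C.d (.q .u) (η .w) = 0 := by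
    have h1 := congrArg (C.d (.q .Hz)) star
    simp [C.d_v, ρk, C.d_comm_zero (tq .Hz (by decide)), C.d_comm_zero (sq .Hz),
      C.d_comm_zero wk, C.d_two] at h1
    exact C.cancel (.q .r) _ (C.cancel (.q .ρ) _ (by linear_combination h1))
  have tr : C.d (.q .r) ξt = 0 := by
    have h1 := congrArg (C.d (.q .w)) wu
    simp [wu0, C.d_v, C.d_comm_zero zw, C.d_comm_zero (tq .w (by decide))] at h1
    exact h1
  have zr : C.d (.q .r) (η .z) = 0 := by
    rw [wu0, tr] at wu
    linear_combination -wu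
  simp only [tr, ts, wu0, mul_zero, add_zero, sub_zero, neg_zero] at H ηu ηρ ηv ηw star
  have ηρ' : η .ρ = 2 * C.v .ρ * (C.d .s ξs - C.d .t ξt) := by
    refine sub_eq_zero.1 (Calculus.cancel_const hA ?_)
    linear_combination star
  -- Both formulas for `η ρ`, divided by `ρ`. Only the term with `∂_s η r` still depends on `ρ`, so
  -- it vanishes.
  have h1 : C.d .s ξs - ir * η .r - C.v .r * C.v .ρ * C.d .s (η .r) - C.d (.q .r) (η .r) =
      2 * (C.d .s ξs - C.d .t ξt) := by
    linear_combination iρ * (ηρ' - ηρ) + (C.d .s ξs + ir * η .r + C.v .r * C.v .ρ * C.d .s (η .r)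
      + C.d (.q .r) (η .r) - 2 * C.d .t ξt) * hiρ
  have rs : C.d .s (η .r) = 0 := by
    have h2 := congrArg (C.d (.q .ρ)) h1
    simp [C.d_v, C.d_inv hir, rq, C.d_comm_zero (rq .ρ (by decide)), C.d_comm_zero (sq .ρ),
      C.d_comm_zero (tq .ρ (by decide)), C.d_two] at h2
    exact C.cancel (.q .r) _ (by linear_combination h2)
  have rr : C.d (.q .r) (η .r) = 2 * C.d .t ξt - C.d .s ξs - ir * η .r := by
    rw [rs] at h1
    linear_combination -h1
  have ss : C.d .s (C.d .s ξs) = 0 := by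
    have h2 := congrArg (C.d .s) rr
    simp [C.d_inv hir, rs, C.d_comm_zero rs, C.d_comm_zero ts, C.d_two] at h2
    linear_combination h2
  replace ηv : η .v = C.v .r * (C.d .t (η .θ) + C.v .u * C.d (.q .r) (η .θ)
      + C.v .w * C.d (.q .z) (η .θ)) + C.v .v * C.d (.q .θ) (η .θ)
      - C.v .v * C.d .t ξt + C.v .v * ir * η .r := by
    linear_combination C.v .r * ηv + (C.v .v * C.d (.q .θ) (η .θ)
      - C.v .v * C.d .t ξt + C.v .v * ir * η .r - η .v) * hir
  have uv : C.d (.q .v) (η .u) = 0 := by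
    rw [ηu]
    simp [C.d_v, C.d_comm_zero (rq .v (by decide)), C.d_comm_zero (tq .v (by decide))]
  have vh : C.d (.q .Hθ) (η .v) = 0 := by
    rw [ηv]
    simp [C.d_v, C.d_inv hir, C.d_comm_zero θh, C.d_comm_zero (tq .Hθ (by decide)), rq]
  have vu : C.d (.q .u) (η .v) = C.v .r * C.d (.q .r) (η .θ) := by
    rw [ηv]
    simp [C.d_v, C.d_inv hir, C.d_comm_zero θu, C.d_comm_zero (tq .u (by decide)), rq]
  -- The elimination behind `star`, now for the pair `v`, `Hθ`. As `η ρ` is known, it forces `∂_u η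
  -- v = r ∂_r η θ` to vanish.
  have θr : C.d (.q .r) (η .θ) = 0 := by
    have ev := fun k => H 0 0 0 0 0 k 0 .v
    have eh := fun v => H 0 v 0 0 0 0 0 .Hθ
    simp only [Calculus.tot, VarA.sum_eq, flowA, dflowA, sderivA, vh, uv, vu] at ev eh
    refine C.cancel (.q .r) _ (C.cancel (.q .ρ) _ (C.cancel (.q .Hθ) _ (C.cancel (.q .r) _ ?_)))
    linear_combination eh 0 - eh 1 - C.v .ρ * (ev 1 - ev 0) - algebraMap ℝ R A * ηρ'
  simp only [θr, zr, mul_zero, add_zero] at ηv ηw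
  exact ⟨⟨st, sq, ss⟩, ⟨ts, tr, tq⟩, ⟨rs, rr, rq⟩, ⟨ηu, ηv, ηw, ηρ'⟩, ⟨θr, θu, θv, θw, θh, θk, θρ⟩,
    ⟨zr, zu, zv, zw, zh, zk, zρ⟩⟩

end CaseA

section CaseA

variable {R : Type*} [CommRing R] [Algebra ℝ R] {C : Calculus VarA R} {γ A : ℝ}
  {ir iρ ξt ξs : R} {η : VarA → R}

/-- Consequences of the equations for the velocity, the pressure and the magnetic field. -/
theorem IsSymmetryA.field_coefficients (hA : A ≠ 0) (hir : C.v .r * ir = 1) (hiρ : C.v .ρ * iρ = 1)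
    (h : IsSymmetryA C (algebraMap ℝ R γ) (algebraMap ℝ R A) ir iρ ξt ξs η) :
    (C.d (.q .θ) (η .θ) = 0 ∧ C.d (.q .z) (η .θ) = 0) ∧
    (C.d (.q .θ) (η .z) = 0 ∧ 2 * C.d (.q .z) (η .z) = 2 * C.d .t ξt - C.d .s ξs) ∧
    2 * η .r = C.v .r * (2 * C.d .t ξt - C.d .s ξs) ∧
    2 * η .Hθ = C.v .Hθ * (C.d .s ξs - 2 * C.d .t ξt) ∧
    2 * η .Hz = C.v .Hz * (C.d .s ξs - 2 * C.d .t ξt) ∧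
    C.d (.q .Hθ) (η .p) = 0 ∧ C.d (.q .Hz) (η .p) = 0 := by
  obtain ⟨⟨st, sq, ss⟩, ⟨ts, tr, tq⟩, ⟨rs, rr, rq⟩, ⟨ηu, ηv, ηw, ηρ⟩,
    ⟨θr, θu, θv, θw, θh, θk, θρ⟩, ⟨zr, zu, zv, zw, zh, zk, zρ⟩⟩ := h.kinematics hA hir hiρ
  have H := fun u v w ρ p k l => h.reduce hir hiρ (sderivA (ir * iρ) 0 0 u v w ρ p k l) rfl
  simp only [tr, ts, mul_zero, add_zero, sub_zero] at H
  have uu : C.d (.q .u) (η .u) = C.d (.q .r) (η .r) - C.d .t ξt := by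
    rw [ηu]
    simp [C.d_v, C.d_comm_zero (rq .u (by decide)), C.d_comm_zero (tq .u (by decide))]
  have uq : ∀ a, a ≠ .r → a ≠ .u → C.d (.q a) (η .u) = 0 := by
    intro a h1 h2
    rw [ηu]
    simp [C.d_v, C.d_comm_zero (rq a h1), C.d_comm_zero (tq a h1), h2]
  have wu : C.d (.q .u) (η .w) = 0 := by
    rw [ηw]
    simp [C.d_v, C.d_inv hir, C.d_comm_zero zu, C.d_comm_zero (tq .u (by decide))]
  have wv : C.d (.q .v) (η .w) = ir * C.d (.q .θ) (η .z) := by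
    rw [ηw]
    simp [C.d_v, C.d_inv hir, C.d_comm_zero zv, C.d_comm_zero (tq .v (by decide))]
    ring
  have ww : C.d (.q .w) (η .w) = C.d (.q .z) (η .z) - C.d .t ξt := by
    rw [ηw]
    simp [C.d_v, C.d_inv hir, C.d_comm_zero zw, C.d_comm_zero (tq .w (by decide))]
  have wh : C.d (.q .Hθ) (η .w) = 0 := by
    rw [ηw]
    simp [C.d_v, C.d_inv hir, C.d_comm_zero zh, C.d_comm_zero (tq .Hθ (by decide))]
  have wk : C.d (.q .Hz) (η .w) = 0 := by
    rw [ηw]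
    simp [C.d_v, C.d_inv hir, C.d_comm_zero zk, C.d_comm_zero (tq .Hz (by decide))]
  have vu : C.d (.q .u) (η .v) = 0 := by
    rw [ηv]
    simp [C.d_v, C.d_inv hir, C.d_comm_zero θu, C.d_comm_zero (tq .u (by decide)), rq]
  have vv : C.d (.q .v) (η .v) = C.d (.q .θ) (η .θ) - C.d .t ξt + ir * η .r := by
    rw [ηv]
    simp [C.d_v, C.d_inv hir, C.d_comm_zero θv, C.d_comm_zero (tq .v (by decide)), rq]
    ring
  have vw : C.d (.q .w) (η .v) = C.v .r * C.d (.q .z) (η .θ) := by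
    rw [ηv]
    simp [C.d_v, C.d_inv hir, C.d_comm_zero θw, C.d_comm_zero (tq .w (by decide)), rq]
  have vh : C.d (.q .Hθ) (η .v) = 0 := by
    rw [ηv]
    simp [C.d_v, C.d_inv hir, C.d_comm_zero θh, C.d_comm_zero (tq .Hθ (by decide)), rq]
  have vk : C.d (.q .Hz) (η .v) = 0 := by
    rw [ηv]
    simp [C.d_v, C.d_inv hir, C.d_comm_zero θk, C.d_comm_zero (tq .Hz (by decide)), rq]
  -- The right side `A Hz_s` of the `w` equation exposes all derivatives of `η Hz` in `p, Hθ, Hz`;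
  -- the `v` equation does the same for `η Hθ`.
  have ew := fun p k l => H 0 0 0 0 p k l .w
  simp only [Calculus.tot, VarA.sum_eq, flowA, dflowA, sderivA, wu, wv, ww, wh, wk] at ew
  have kp : C.d (.q .p) (η .Hz) = 0 := Calculus.cancel_const hA (by
    linear_combination ew 0 0 0 - ew 1 0 0)
  have kh : C.d (.q .Hθ) (η .Hz) = ir * C.d (.q .θ) (η .z) := sub_eq_zero.1 <|
    Calculus.cancel_const hA (by linear_combination ew 0 0 0 - ew 0 1 0)
  have kk : C.d (.q .Hz) (η .Hz) = C.d (.q .z) (η .z) - 2 * C.d .t ξt + C.d .s ξs :=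
    sub_eq_zero.1 <| Calculus.cancel_const hA (by linear_combination ew 0 0 0 - ew 0 0 1)
  have ev := fun p k l => H 0 0 0 0 p k l .v
  simp only [Calculus.tot, VarA.sum_eq, flowA, dflowA, sderivA, vu, vv, vw, vh, vk] at ev
  have hp : C.d (.q .p) (η .Hθ) = 0 := Calculus.cancel_const hA (by
    linear_combination ev 0 0 0 - ev 1 0 0)
  have hh : C.d (.q .Hθ) (η .Hθ) =
      C.d (.q .θ) (η .θ) - 2 * C.d .t ξt + ir * η .r + C.d .s ξs := sub_eq_zero.1 <|
    Calculus.cancel_const hA (by linear_combination ev 0 0 0 - ev 0 1 0)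
  have hk : C.d (.q .Hz) (η .Hθ) = C.v .r * C.d (.q .z) (η .θ) := sub_eq_zero.1 <|
    Calculus.cancel_const hA (by linear_combination ev 0 0 0 - ev 0 0 1)
  have ep := fun v w => H 0 v w 0 0 0 0 .p
  simp only [Calculus.tot, VarA.sum_eq, flowA, dflowA, sderivA, uq, ne_eq, reduceCtorEq,
    not_false_eq_true] at ep
  have ph : C.d (.q .Hθ) (η .p) = 0 := C.cancel (.q .ρ) _ <| Calculus.cancel_const hA (by
    linear_combination ep 1 0 - ep 0 0)
  have pk : C.d (.q .Hz) (η .p) = 0 := C.cancel (.q .ρ) _ <| Calculus.cancel_const hA (by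
    linear_combination ep 0 1 - ep 0 0)
  -- The magnetic pressure terms make `η Hθ` and `η Hz` themselves appear as coefficients of `Hθ_s`
  -- and `Hz_s`. Differentiating these formulas and comparing with the derivatives found above fixes
  -- the rest.
  have eu := fun p k l => H 0 0 0 0 p k l .u
  simp only [Calculus.tot, VarA.sum_eq, flowA, dflowA, sderivA, uu, uq, ph, pk, kp, kh, kk, hp, hh,
    hk, rr, ne_eq, reduceCtorEq, not_false_eq_true] at eu
  have eh : C.v .r * η .Hθ = C.v .r * C.v .Hθ * (2 * C.d .t ξt - C.d .s ξs - 2 * ir * η .r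
      - C.d (.q .θ) (η .θ)) - η .r * C.v .Hθ - C.v .Hz * C.d (.q .θ) (η .z) := by
    linear_combination eu 0 1 0 - eu 0 0 0 - C.v .Hz * C.d (.q .θ) (η .z) * hir
  have ek : C.v .r * η .Hz = C.v .r * C.v .Hz * (2 * C.d .t ξt - C.d .s ξs - ir * η .r
      - C.d (.q .z) (η .z)) - η .r * C.v .Hz - C.v .r ^ 2 * C.v .Hθ * C.d (.q .z) (η .θ) := by
    linear_combination eu 0 0 1 - eu 0 0 0
  have two : ∀ f : R, 2 * f = 0 → f = 0 := fun f hf =>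
    Calculus.cancel_const (c := 2) (by simp) (by rwa [map_ofNat])
  -- The `Hz`-derivative of `eh` reads `r² ∂_z η θ + ∂_θ η z = 0`. Neither derivative depends on
  -- `r`, so both vanish: `θ` and `z` do not mix.
  have θz : C.d (.q .z) (η .θ) = 0 := by
    have h1 := congrArg (C.d (.q .Hz)) eh
    simp [C.d_v, C.d_inv hir, C.d_comm_zero θk, C.d_comm_zero zk, C.d_comm_zero (sq .Hz),
      C.d_comm_zero (tq .Hz (by decide)), rq, C.d_two, hk] at h1
    have h2 := congrArg (C.d (.q .r)) h1
    simp [C.d_v, C.d_comm_zero zr, C.d_comm_zero θr] at h2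
    exact C.cancel (.q .r) _ (two _ (by linear_combination h2))
  have zθ : C.d (.q .θ) (η .z) = 0 := by
    have h1 := congrArg (C.d (.q .Hz)) eh
    simp [C.d_v, C.d_inv hir, C.d_comm_zero θk, C.d_comm_zero zk, C.d_comm_zero (sq .Hz),
      C.d_comm_zero (tq .Hz (by decide)), rq, C.d_two, hk, θz] at h1
    exact h1
  rw [θz] at ek
  rw [zθ] at eh
  have θθ : 2 * C.d (.q .θ) (η .θ) = 4 * C.d .t ξt - 2 * C.d .s ξs - 4 * ir * η .r := by
    have h1 := congrArg (C.d (.q .Hθ)) eh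
    simp [C.d_v, C.d_inv hir, C.d_comm_zero θh, C.d_comm_zero (sq .Hθ),
      C.d_comm_zero (tq .Hθ (by decide)), rq, C.d_two, hh] at h1
    linear_combination ir * h1 - (2 * C.d (.q .θ) (η .θ) - 4 * C.d .t ξt + 2 * C.d .s ξs
      + 3 * ir * η .r) * hir
  have zz : 2 * C.d (.q .z) (η .z) = 4 * C.d .t ξt - 2 * C.d .s ξs - 2 * ir * η .r := by
    have h1 := congrArg (C.d (.q .Hz)) ek
    simp [C.d_v, C.d_inv hir, C.d_comm_zero zk, C.d_comm_zero (sq .Hz),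
      C.d_comm_zero (tq .Hz (by decide)), rq, C.d_two, kk] at h1
    linear_combination ir * h1 - (2 * C.d (.q .z) (η .z) - 4 * C.d .t ξt + 2 * C.d .s ξs
      + ir * η .r) * hir
  -- In `zz` the left side does not depend on `r`; its `r`-derivative together with `rr` makes `η r`
  -- linear in `r`.
  have er : 2 * η .r = C.v .r * (2 * C.d .t ξt - C.d .s ξs) := by
    have h1 := congrArg (C.d (.q .r)) zz
    have four : C.d (.q .r) 4 = 0 := by simpa using (C.d (.q .r)).map_natCast 4
    simp [C.d_inv hir, C.d_comm_zero zr, C.d_comm_zero (sq .r), C.d_comm_zero tr, C.d_two,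
      four, rr] at h1
    have h2 : 2 * ir * η .r = 2 * C.d .t ξt - C.d .s ξs := sub_eq_zero.1 (two _ (by
      linear_combination -C.v .r * h1 + 2 * (2 * C.d .t ξt - C.d .s ξs - 2 * ir * η .r) * hir))
    linear_combination C.v .r * h2 - 2 * η .r * hir
  have θθ' : C.d (.q .θ) (η .θ) = 0 := two _ (by
    linear_combination θθ - 2 * ir * er - 2 * (2 * C.d .t ξt - C.d .s ξs) * hir)
  have zz' : 2 * C.d (.q .z) (η .z) = 2 * C.d .t ξt - C.d .s ξs := by
    linear_combination zz - ir * er - (2 * C.d .t ξt - C.d .s ξs) * hir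
  have eh' : 2 * η .Hθ = C.v .Hθ * (C.d .s ξs - 2 * C.d .t ξt) :=
    sub_eq_zero.1 <| C.cancel (.q .r) _ (by
      linear_combination 2 * eh - 4 * η .r * C.v .Hθ * hir - 3 * C.v .Hθ * er
        - 2 * C.v .r * C.v .Hθ * θθ')
  have ek' : 2 * η .Hz = C.v .Hz * (C.d .s ξs - 2 * C.d .t ξt) :=
    sub_eq_zero.1 <| C.cancel (.q .r) _ (by
      linear_combination 2 * ek - 2 * η .r * C.v .Hz * hir - 2 * C.v .Hz * er
        - C.v .r * C.v .Hz * zz')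
  exact ⟨⟨θθ', θz⟩, ⟨zθ, zz'⟩, er, eh', ek', ph, pk⟩

end CaseA

section CaseA

variable {R : Type*} [CommRing R] [Algebra ℝ R] {C : Calculus VarA R} {γ A : ℝ}
  {ir iρ ξt ξs : R} {η : VarA → R}

/-- The coefficients in terms of a single scaling parameter `m`. -/
theorem IsSymmetryA.scaling_parameter (hA : A ≠ 0) (hir : C.v .r * ir = 1)
    (hiρ : C.v .ρ * iρ = 1)
    (h : IsSymmetryA C (algebraMap ℝ R γ) (algebraMap ℝ R A) ir iρ ξt ξs η) :
    ∃ m : R, C.d .s ξs = 2 * C.d .t ξt - 2 * m ∧ (∀ a, C.d (.q a) m = 0) ∧ C.d .s m = 0 ∧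
      C.d .t m = C.d .t (C.d .t ξt) ∧
      η .r = C.v .r * m ∧ η .Hθ = -(C.v .Hθ * m) ∧ η .Hz = -(C.v .Hz * m) ∧
      η .u = C.v .r * C.d .t m - C.v .u * (C.d .t ξt - m) ∧
      η .v = C.v .r * C.d .t (η .θ) - C.v .v * (C.d .t ξt - m) ∧
      η .w = C.d .t (η .z) - C.v .w * (C.d .t ξt - m) ∧
      η .ρ = C.v .ρ * (2 * C.d .t ξt - 4 * m) ∧ C.d (.q .z) (η .z) = m := by
  obtain ⟨⟨st, sq, ss⟩, ⟨ts, tr, tq⟩, ⟨rs, rr, rq⟩, ⟨ηu, ηv, ηw, ηρ⟩,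
    ⟨θr, θu, θv, θw, θh, θk, θρ⟩, ⟨zr, zu, zv, zw, zh, zk, zρ⟩⟩ := h.kinematics hA hir hiρ
  obtain ⟨⟨θθ', θz⟩, ⟨zθ, zz'⟩, er, eh', ek', ph, pk⟩ := h.field_coefficients hA hir hiρ
  have two : ∀ f g : R, 2 * (f - g) = 0 → f = g := fun f g hf =>
    sub_eq_zero.1 (Calculus.cancel_const (c := 2) (by simp) (by rwa [map_ofNat]))
  -- The choice `m = ∂_t ξt - ∂_s ξs / 2` isolates the coefficient of `X₄`: the part `X₃`
  -- contributes `ξs = 2s` with `ξt = t` and cancels.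
  obtain ⟨m, hm⟩ : ∃ m : R, C.d .s ξs = 2 * C.d .t ξt - 2 * m :=
    ⟨algebraMap ℝ R (1 / 2) * (2 * C.d .t ξt - C.d .s ξs), by
      have : (2 : R) * algebraMap ℝ R (1 / 2) = 1 := by
        rw [← map_ofNat (algebraMap ℝ R) 2, ← map_mul]; norm_num
      linear_combination (2 * C.d .t ξt - C.d .s ξs) * this⟩
  have Bq : ∀ a, C.d (.q a) (C.d .t ξt) = 0 := fun a => by
    by_cases ha : a = .r
    · subst ha; exact C.d_comm_zero tr
    · exact C.d_comm_zero (tq a ha)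
  have mq : ∀ a, C.d (.q a) m = 0 := fun a => two _ _ (by
    have h1 := congrArg (C.d (.q a)) hm
    simp [C.d_two, Bq, C.d_comm_zero (sq a)] at h1
    linear_combination h1)
  have ms : C.d .s m = 0 := two _ _ (by
    have h1 := congrArg (C.d .s) hm
    simp [C.d_two, ss, C.d_comm_zero ts] at h1
    linear_combination h1)
  have mt : C.d .t m = C.d .t (C.d .t ξt) := two _ _ (by
    have h1 := congrArg (C.d .t) hm
    simp [C.d_two, C.d_comm_zero st] at h1
    linear_combination h1)
  rw [hm] at er eh' ek' zz' rr ηρ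
  have hr : η .r = C.v .r * m := two _ _ (by linear_combination er)
  have hz : C.d (.q .z) (η .z) = m := two _ _ (by linear_combination zz')
  have hrr : C.d (.q .r) (η .r) = m := by
    rw [hr]; simp [C.d_v, mq]
  have hrt : C.d .t (η .r) = C.v .r * C.d .t m := by
    rw [hr]; simp [C.d_v]
  refine ⟨m, hm, mq, ms, mt, hr, two _ _ (by linear_combination eh'),
    two _ _ (by linear_combination ek'), ?_, ?_, ?_, ?_, hz⟩
  · rw [ηu, hrr, hrt]; ring
  · rw [ηv, θθ', θz, hr]; linear_combination C.v .v * m * hir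
  · rw [ηw, zθ, hz]; ring
  · rw [ηρ]; ring

/-- The solution of the determining equations in the case `A ≠ 0`. -/
theorem IsSymmetryA.solve (hγ : 1 < γ) (hA : A ≠ 0) (hir : C.v .r * ir = 1)
    (hiρ : C.v .ρ * iρ = 1)
    (h : IsSymmetryA C (algebraMap ℝ R γ) (algebraMap ℝ R A) ir iρ ξt ξs η) :
    ∃ m : R, (∀ i, C.d i m = 0) ∧ (∀ i, C.d i (C.d .t ξt) = 0) ∧
      (∀ i, C.d i (C.d .t (η .z)) = 0) ∧
      (C.d .t ξs = 0 ∧ C.d .s ξs = 2 * C.d .t ξt - 2 * m ∧ ∀ a, C.d (.q a) ξs = 0) ∧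
      (C.d .s ξt = 0 ∧ ∀ a, C.d (.q a) ξt = 0) ∧
      (η .r = C.v .r * m ∧ η .u = -(C.v .u * (C.d .t ξt - m)) ∧
        η .v = -(C.v .v * (C.d .t ξt - m)) ∧
        η .w = C.d .t (η .z) - C.v .w * (C.d .t ξt - m) ∧
        η .ρ = C.v .ρ * (2 * C.d .t ξt - 4 * m) ∧ η .p = -(2 * C.v .p * m) ∧
        η .Hθ = -(C.v .Hθ * m) ∧ η .Hz = -(C.v .Hz * m)) ∧
      (C.d .t (η .θ) = 0 ∧ (∀ a, a ≠ .ρ → a ≠ .p → C.d (.q a) (η .θ) = 0) ∧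
        C.v .ρ * C.d (.q .ρ) (η .θ) + algebraMap ℝ R γ * C.v .p * C.d (.q .p) (η .θ) = 0) ∧
      (C.d (.q .z) (η .z) = m ∧
        (∀ a, a ≠ .ρ → a ≠ .p → a ≠ .z → C.d (.q a) (η .z) = 0) ∧
        C.v .ρ * C.d (.q .ρ) (η .z) + algebraMap ℝ R γ * C.v .p * C.d (.q .p) (η .z) = 0) := by
  obtain ⟨⟨st, sq, ss⟩, ⟨ts, tr, tq⟩, ⟨rs, rr, rq⟩, -,
    ⟨θr, θu, θv, θw, θh, θk, θρ⟩, ⟨zr, zu, zv, zw, zh, zk, zρ⟩⟩ := h.kinematics hA hir hiρ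
  obtain ⟨⟨θθ, θz⟩, ⟨zθ, -⟩, -, -, -, ph, pk⟩ := h.field_coefficients hA hir hiρ
  obtain ⟨m, hm, mq, ms, mt, er, eh, ek, eu, ev, ew, eρ, zz⟩ := h.scaling_parameter hA hir hiρ
  have tq' : ∀ a, C.d (.q a) ξt = 0 := fun a => by
    by_cases ha : a = .r
    · subst ha; exact tr
    · exact tq a ha
  have Bq : ∀ a, C.d (.q a) (C.d .t ξt) = 0 := fun a => C.d_comm_zero (tq' a)
  have mtq : ∀ a, C.d (.q a) (C.d .t m) = 0 := fun a => C.d_comm_zero (mq a)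
  have mts : C.d .s (C.d .t m) = 0 := C.d_comm_zero ms
  have Bs : C.d .s (C.d .t ξt) = 0 := C.d_comm_zero ts
  have H := fun θ z u v w ρ p k l => h.reduce hir hiρ (sderivA (ir * iρ) θ z u v w ρ p k l) rfl
  simp only [tr, ts, hm, mul_zero, add_zero, sub_zero] at H
  -- All s-derivatives of the momentum equation through the pressure gradient; `p_s` fixes `∂_p η
  -- p`.
  have pq : C.d (.q .θ) (η .p) = 0 ∧ C.d (.q .z) (η .p) = 0 ∧ C.d (.q .u) (η .p) = 0 ∧
      C.d (.q .v) (η .p) = 0 ∧ C.d (.q .w) (η .p) = 0 ∧ C.d (.q .ρ) (η .p) = 0 ∧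
      C.d (.q .p) (η .p) = -(2 * m) := by
    have e := fun θ z u v w ρ p => H θ z u v w ρ p 0 0 .u
    simp [Calculus.tot, VarA.sum_eq, flowA, dflowA, sderivA, eu, er, eh, ek, C.d_v, mq, mtq,
      Bq] at e
    refine ⟨C.cancel (.q .r) _ ?_, C.cancel (.q .r) _ ?_, C.cancel (.q .r) _ ?_,
      C.cancel (.q .r) _ ?_, C.cancel (.q .r) _ ?_, C.cancel (.q .r) _ ?_,
      sub_eq_zero.1 <| C.cancel (.q .r) _ ?_⟩
    · linear_combination e 1 0 0 0 0 0 0 - e 0 0 0 0 0 0 0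
    · linear_combination e 0 1 0 0 0 0 0 - e 0 0 0 0 0 0 0
    · linear_combination e 0 0 1 0 0 0 0 - e 0 0 0 0 0 0 0
    · linear_combination e 0 0 0 1 0 0 0 - e 0 0 0 0 0 0 0
    · linear_combination e 0 0 0 0 1 0 0 - e 0 0 0 0 0 0 0
    · linear_combination e 0 0 0 0 0 1 0 - e 0 0 0 0 0 0 0
    · linear_combination e 0 0 0 0 0 0 1 - e 0 0 0 0 0 0 0
  obtain ⟨pθ, pz, pu, pv, pw, pρ, pp⟩ := pq
  -- The coefficient of `u_s` in the pressure equation gives `η p` itself, since `γ ≠ 0`.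
  have ep : η .p = -(2 * C.v .p * m) := by
    have e := fun u => H 0 0 u 0 0 0 0 0 0 .p
    simp [Calculus.tot, VarA.sum_eq, flowA, dflowA, sderivA, eu, er, eρ, C.d_v, mq, mtq, Bq, pθ,
      pz, pu, pv, pw, pρ, pp, ph, pk] at e
    refine sub_eq_zero.1 (C.cancel (.q .r) _ (C.cancel (.q .ρ) _
      (Calculus.cancel_const (c := γ) (by positivity) ?_)))
    linear_combination e 1 - e 0
  -- The term `A ρ w_s` brings in the s-derivative of `η w`, which contains `∂_t η z`. Its
  -- coefficients at `ρ_s` and `p_s` vanish, and the remainder is `e1`.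
  have e := fun ρ p => H 0 0 0 0 0 ρ p 0 0 .Hz
  simp [Calculus.tot, VarA.sum_eq, flowA, dflowA, sderivA, eu, er, eρ, ek, ew, C.d_v, mq, mtq, Bq,
    ms, mts, Bs, C.d_comm_zero zr] at e
  have ztρ : C.d (.q .ρ) (C.d .t (η .z)) = 0 := C.cancel (.q .ρ) _ (Calculus.cancel_const hA (by
    linear_combination e 0 0 - e 1 0))
  have ztp : C.d (.q .p) (C.d .t (η .z)) = 0 := C.cancel (.q .ρ) _ (Calculus.cancel_const hA (by
    linear_combination e 0 0 - e 0 1))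
  have e1 : algebraMap ℝ R A * C.v .ρ * C.d .s (C.d .t (η .z)) = C.v .Hz * C.d .t m := by
    linear_combination -e 0 0 + C.v .Hz * C.d .t m * hiρ
      + C.v .Hz * (C.d .t m * (C.v .ρ * iρ + 1) - C.v .u * ir * m) * hir
  -- In `e1` only the right side depends on `Hz`: a time-dependent scaling is impossible.
  have mt0 : C.d .t m = 0 := by
    have e2 := congrArg (C.d (.q .Hz)) e1
    have := C.d_comm_zero (i := .s) (C.d_comm_zero (i := .t) zk)
    simp [C.d_v, mtq, this] at e2
    exact e2.symm
  have zts : C.d .s (C.d .t (η .z)) = 0 := C.cancel (.q .ρ) _ (Calculus.cancel_const hA (by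
    rw [mt0] at e1
    linear_combination e1))
  rw [mt0] at eu mt
  clear e e1
  have e := H 0 0 0 0 0 0 0 0 0 .v
  simp [Calculus.tot, VarA.sum_eq, flowA, dflowA, sderivA, eu, er, eρ, eh, ev, C.d_v, mq, Bq,
    ms, mt0, ← mt, C.d_comm_zero θr, C.d_comm_zero θθ, C.d_comm_zero θz, C.d_comm_zero θu,
    C.d_comm_zero θv, C.d_comm_zero θw, C.d_comm_zero θh, C.d_comm_zero θk] at e
  have θt : C.d .t (η .θ) = 0 := by
    have e1 := congrArg (C.d .t) θρ
    simp [C.d_v] at e1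
    rw [C.comm .t, C.comm .t (.q .p)] at e1
    -- The terms with `∂_ρ η θ` and `∂_p η θ` disappear by the time derivative of `θρ`. Since `η θ`
    -- is free of `u`, the coefficient of `u` vanishes, which excludes rotating frames.
    have e2 : C.v .r * C.d .t (C.d .t (η .θ)) + 2 * C.v .u * C.d .t (η .θ) = 0 := by
      linear_combination e + C.v .u * ir * C.v .r * e1
        - (C.v .u * (C.d .t (η .θ) - m * C.v .v * ir)
          + 2 * m * ir ^ 2 * algebraMap ℝ R A * C.v .Hθ * iρ) * hir
        + (4 * m - 2 * C.d .t ξt) * ir ^ 2 * algebraMap ℝ R A * C.v .Hθ * iρ * hiρ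
    have e3 := congrArg (C.d (.q .u)) e2
    simp [C.d_v, C.d_comm_zero θu, C.d_comm_zero (i := .t) (C.d_comm_zero (i := .t) θu),
      C.d_two] at e3
    exact Calculus.cancel_const (c := 2) (by simp) (by rw [map_ofNat]; linear_combination e3)
  clear e
  have ztt : C.d .t (C.d .t (η .z)) = 0 := by
    have e := H 0 0 0 0 0 0 0 0 0 .w
    have h1 : C.d (.q .z) (C.d .t (η .z)) = 0 := by rw [C.comm, zz, mt0]
    simp [Calculus.tot, VarA.sum_eq, flowA, dflowA, sderivA, ek, ew, C.d_v, mq, Bq,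
      ms, mt0, ← mt, C.d_comm_zero zr, C.d_comm_zero zθ, C.d_comm_zero zu, C.d_comm_zero zv,
      C.d_comm_zero zw, C.d_comm_zero zh, C.d_comm_zero zk, ztρ, ztp, h1] at e
    linear_combination e
  refine ⟨m, ?_, ?_, ?_, ⟨st, hm, sq⟩, ⟨ts, tq'⟩, ⟨er, ?_, ?_, ew, eρ, ep, eh, ek⟩,
    ⟨θt, ?_, θρ⟩, zz, ?_, zρ⟩
  · rintro (_ | _ | a)
    exacts [mt0, ms, mq a]
  · rintro (_ | _ | a)
    exacts [mt.symm, Bs, Bq a]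
  · rintro (_ | _ | a)
    · exact ztt
    · exact zts
    · cases a
      case z => rw [C.comm, zz, mt0]
      all_goals first | exact ztρ | exact ztp | exact C.d_comm_zero ‹_›
  · rw [eu]; ring
  · rw [ev, θt]; ring
  · intro a h1 h2
    cases a <;> first | assumption | contradiction
  · intro a h1 h2 h3
    cases a <;> first | assumption | contradiction

end CaseA

/-! ### Local factorization through invariants -/

section Factor

open TopologicalSpace Smooth

variable {D : Type} [Fintype D]

theorem Coord.ext {x y : Base D} (h : ∀ i, Coord.fn i x = Coord.fn i y) : x = y :=
  Prod.ext (h .t) (Prod.ext (h .s) (funext fun a => h (.q a)))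

/-- A smooth function whose derivatives vanish along the fibres of `π ∘ Φ`, where `Φ` is a change
of variables with the inverse `Ψ`, is locally a smooth function of `π ∘ Φ`. -/
theorem exists_local_factor {G : Type*} [NormedAddCommGroup G] [NormedSpace ℝ G]
    {U : Opens (Base D)} (f : Smooth U) {W : Set (Base D)} (hW : IsOpen W)
    (hUW : (U : Set (Base D)) ⊆ W) {Φ Ψ : Base D → Base D} (hΦ : ContinuousOn Φ W)
    (hΦW : ∀ y ∈ W, Φ y ∈ W) (hΨ : ContDiffOn ℝ ∞ Ψ W) (hΨΦ : ∀ y ∈ W, Ψ (Φ y) = y)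
    (hΦΨ : ∀ y ∈ W, Φ (Ψ y) = y)
    (π : Base D →L[ℝ] G) (ι : G →L[ℝ] Base D) (hπι : ∀ g, π (ι g) = g)
    (hker : ∀ y : U, ∀ w, π w = 0 → ∃ v : Base D, (∀ i, HasDirDeriv (fun x => Coord.fn i (Ψ x))
      (Φ y) w (Coord.fn i v)) ∧ fderiv ℝ (extend f) y v = 0) (y₀ : U) :
    ∃ V : Set (Base D), IsOpen V ∧ (y₀ : Base D) ∈ V ∧ V ⊆ U ∧ ∃ F : G → ℝ,
      ∀ y : U, (y : Base D) ∈ V → ContDiffAt ℝ ∞ F (π (Φ y)) ∧ eval y f = F (π (Φ y)) := by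
  set N : Set (Base D) := W ∩ Ψ ⁻¹' U with hN
  have hNo : IsOpen N := hΨ.continuousOn.isOpen_inter_preimage hW U.isOpen
  set k : Base D → ℝ := fun x => extend f (Ψ x) with hk
  have hkN : ContDiffOn ℝ ∞ k N :=
    (contDiffOn_extend f).comp (hΨ.mono Set.inter_subset_left) fun x hx => hx.2
  have hkd : ∀ x ∈ N, ∀ w, π w = 0 → fderiv ℝ k x w = 0 := by
    intro x hx w hw
    obtain ⟨v, hv, h0⟩ := hker ⟨Ψ x, hx.2⟩ w hw
    have hd : DifferentiableAt ℝ Ψ x :=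
      (hΨ.contDiffAt (hW.mem_nhds hx.1)).differentiableAt (by simp)
    have hf : DifferentiableAt ℝ (extend f) (Ψ x) :=
      differentiableAt (contDiffOn_extend f) ⟨_, hx.2⟩
    -- At `y = Ψ x` the base point `Φ y` in `hker` is `x`, so the vector `v` supplied there is the
    -- image of `w` under the differential of `Ψ`.
    have hv' : fderiv ℝ Ψ x w = v := Coord.ext fun i => by
      have h1 := (hv i).2
      simp only [hΦΨ x hx.1] at h1
      rw [← h1]
      have := ((Coord.fn i).hasFDerivAt.comp x hd.hasFDerivAt).fderiv
      simp only [Function.comp_def] at this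
      rw [this]
      rfl
    have h2 := (hf.hasFDerivAt.comp x hd.hasFDerivAt).fderiv
    simp only [Function.comp_def] at h2
    rw [hk, h2, ContinuousLinearMap.comp_apply, hv', h0]
  have hx₀ : Φ y₀ ∈ N := ⟨hΦW _ (hUW y₀.2), by
    rw [Set.mem_preimage, hΨΦ _ (hUW y₀.2)]; exact y₀.2⟩
  set x₀ := Φ y₀ with hx₀'
  obtain ⟨ε, hε, hball⟩ := Metric.isOpen_iff.1 hNo x₀ hx₀
  -- The retraction onto the slice through `x₀` transversal to the fibres of `π`. The values of `k`
  -- on this slice define the function `F`.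
  set ret : Base D → Base D := fun x => x₀ + ι (π x - π x₀) with hret
  have hretc : Continuous ret := by fun_prop
  have hret0 : ret x₀ = x₀ := by simp [hret]
  set B : Set (Base D) := Metric.ball x₀ ε ∩ ret ⁻¹' Metric.ball x₀ ε with hB
  have hBo : IsOpen B := Metric.isOpen_ball.inter (Metric.isOpen_ball.preimage hretc)
  -- The segment from `ret x` to `x` lies in the ball by convexity and has direction in the kernel
  -- of `π`, so `k` is constant on it. Fibres in `U` need not be connected, hence the restriction to
  -- a small neighbourhood.
  have key : ∀ x ∈ B, k x = k (ret x) := by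
    intro x hx
    have hseg : ∀ τ ∈ Set.Icc (0 : ℝ) 1, ret x + τ • (x - ret x) ∈ N := fun τ hτ =>
      hball ((convex_ball x₀ ε).add_smul_sub_mem hx.2 hx.1 hτ)
    have hπ : π (x - ret x) = 0 := by simp [hret, hπι]
    have hder : ∀ τ ∈ Set.Icc (0 : ℝ) 1,
        HasDerivAt (fun τ : ℝ => k (ret x + τ • (x - ret x))) 0 τ := by
      intro τ hτ
      have h1 : HasDerivAt (fun τ : ℝ => ret x + τ • (x - ret x)) (x - ret x) τ := by
        simpa using ((hasDerivAt_id τ).smul_const (x - ret x)).const_add (ret x)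
      have h2 := ((hkN.contDiffAt (hNo.mem_nhds (hseg τ hτ))).differentiableAt
        (by simp)).hasFDerivAt.comp_hasDerivAt τ h1
      rwa [hkd _ (hseg τ hτ) _ hπ] at h2
    have := constant_of_has_deriv_right_zero
      (fun τ hτ => (hder τ hτ).continuousAt.continuousWithinAt)
      (fun τ hτ => (hder τ ⟨hτ.1, hτ.2.le⟩).hasDerivWithinAt) 1 (by simp)
    simpa using this
  refine ⟨U ∩ (W ∩ Φ ⁻¹' B), U.isOpen.inter (hΦ.isOpen_inter_preimage hW hBo),
    ⟨y₀.2, hUW y₀.2, ?_⟩, Set.inter_subset_left, fun g => k (x₀ + ι (g - π x₀)), ?_⟩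
  · exact ⟨Metric.mem_ball_self hε, by
      rw [Set.mem_preimage, ← hx₀', hret0]; exact Metric.mem_ball_self hε⟩
  · intro y hy
    constructor
    · have h1 : ContDiffAt ℝ ∞ k (ret (Φ y)) := hkN.contDiffAt (hNo.mem_nhds (hball hy.2.2.2))
      have h2 : ContDiff ℝ ∞ fun g => x₀ + ι (g - π x₀) := by fun_prop
      exact ContDiffAt.comp (g := k) (f := fun g => x₀ + ι (g - π x₀)) _ h1 h2.contDiffAt
    · have h1 := key _ hy.2.2
      rw [hk] at h1
      simp only [hΨΦ _ hy.2.1] at h1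
      rw [extend_apply] at h1
      exact h1

end Factor

/-! ### Invariants and the form of the generators for A ≠ 0 -/

section CaseA

open TopologicalSpace Smooth

theorem isOpen_domainA : IsOpen domainA :=
  (isOpen_lt continuous_const (Coord.fn (.q VarA.r)).continuous).inter
    (isOpen_lt continuous_const (Coord.fn (.q VarA.ρ)).continuous)

/-- The projection to the variables `s` and `p`. -/
noncomputable def projA : Base VarA →L[ℝ] ℝ × ℝ := (Coord.fn .s).prod (Coord.fn (.q .p))

/-- The inclusion of the variables `s` and `p`. -/
noncomputable def inclA : ℝ × ℝ →L[ℝ] Base VarA :=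
  (0 : ℝ × ℝ →L[ℝ] ℝ).prod ((ContinuousLinearMap.fst ℝ ℝ ℝ).prod
    (ContinuousLinearMap.pi fun a => if a = .p then ContinuousLinearMap.snd ℝ ℝ ℝ else 0))

/-- The field `ρ ∂_ρ + γ p ∂_p` annihilates `p / ρ ^ γ`. Replacing `p` by this quotient turns it
into a multiple of `∂_ρ`, and then `f` depends on two coordinates only. -/
theorem exists_local_factorA {γ : ℝ} {U : Opens (Base VarA)}
    (hU : (U : Set (Base VarA)) ⊆ domainA) (f : Smooth U) (ht : par .t f = 0)
    (ha : ∀ a : VarA, a ≠ .ρ → a ≠ .p → par (.q a) f = 0)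
    (hρ : crd (.q .ρ) * par (.q .ρ) f
      + algebraMap ℝ (Smooth U) γ * crd (.q .p) * par (.q .p) f = 0) (y₀ : U) :
    ∃ V : Set (Base VarA), IsOpen V ∧ (y₀ : Base VarA) ∈ V ∧ V ⊆ U ∧ ∃ F : ℝ × ℝ → ℝ,
      ∀ y : U, (y : Base VarA) ∈ V → ContDiffAt ℝ ∞ F (invA γ y) ∧ eval y f = F (invA γ y) := by
  have hpos : ∀ y ∈ domainA, (0 : ℝ) < y.2.2 .ρ ^ γ := fun y hy => Real.rpow_pos_of_pos hy.2 γ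
  have hsm : ContDiffOn ℝ ∞ (fun y : Base VarA => y.2.2 .ρ ^ γ) domainA := by
    refine ContDiffOn.rpow_const_of_ne (ContDiff.contDiffOn ?_) fun y hy => hy.2.ne'
    exact (Coord.fn (.q VarA.ρ)).contDiff
  have hval : ∀ a : VarA, ContDiffOn ℝ ∞ (fun y : Base VarA => y.2.2 a) domainA := fun a =>
    (Coord.fn (.q a)).contDiff.contDiffOn
  have hsmooth : ∀ g : Base VarA → ℝ, ContDiffOn ℝ ∞ g domainA →
      ContDiffOn ℝ ∞ (fun y : Base VarA => ((y.1, y.2.1, Function.update y.2.2 .p (g y)) :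
        Base VarA)) domainA := by
    intro g hg
    refine (contDiff_fst.contDiffOn).prodMk ((contDiff_fst.comp contDiff_snd).contDiffOn.prodMk ?_)
    refine contDiffOn_pi.2 fun a => ?_
    by_cases h : a = .p
    · subst h; simpa using hg
    · simpa [h] using hval a
  refine exists_local_factor f isOpen_domainA hU
    (Φ := fun y => (y.1, y.2.1, Function.update y.2.2 .p (y.2.2 .p / y.2.2 .ρ ^ γ)))
    (Ψ := fun y => (y.1, y.2.1, Function.update y.2.2 .p (y.2.2 .p * y.2.2 .ρ ^ γ)))
    (hsmooth _ ((hval .p).div hsm fun y hy => (hpos y hy).ne')).continuousOn (fun y hy => ?_)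
    (hsmooth _ ((hval .p).mul hsm)) (fun y hy => ?_) (fun y hy => ?_) projA inclA (fun g => ?_)
    (fun y w hw => ?_) y₀
  · simpa [domainA, val] using hy
  · have := (hpos y hy).ne'
    simp [this]
  · have := (hpos y hy).ne'
    simp [this]
  · simp [projA, inclA, Coord.fn]
  · have hρy : (0 : ℝ) < (y : Base VarA).2.2 .ρ := (hU y.2).2
    have hw1 : w.2.1 = 0 := congrArg Prod.fst hw
    have hw2 : w.2.2 .p = 0 := congrArg Prod.snd hw
    -- At fixed `p / ρ ^ γ`, a change of `ρ` changes `p` at the rate `γ p / ρ`.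
    refine ⟨(w.1, 0, Function.update w.2.2 .p
      (γ * ((y : Base VarA).2.2 .p / (y : Base VarA).2.2 .ρ) * w.2.2 .ρ)), ?_, ?_⟩
    · rintro (_ | _ | a)
      · exact hasDirDeriv_t _ _
      · exact (hasDirDeriv_s _ _).congr_deriv hw1
      · by_cases h : a = .p
        · subst h
          simp only [Coord.fn]
          refine HasDirDeriv.congr_fun (HasDirDeriv.congr_deriv ((hasDirDeriv_val .p _ _).mul
            ((hasDirDeriv_val .ρ _ _).rpow_const ?_ γ)) ?_) (.of_eq (by ext; simp))
          · simpa using hρy.ne'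
          · simp [hw2, Real.rpow_sub_one hρy.ne']
            field_simp
        · refine HasDirDeriv.congr_fun (HasDirDeriv.congr_deriv (hasDirDeriv_val a _ _) ?_)
            (.of_eq (by ext; simp [h, Coord.fn]))
          simp [h, Coord.fn]
    · rw [fderiv_eq_sum (f := f) (extend_apply f), VarA.sum_eq]
      have := congrArg (eval y) hρ
      simp only [map_add, map_mul, AlgHom.commutes, map_zero] at this
      simp only [ht, ha, ne_eq, reduceCtorEq, not_false_eq_true, map_zero, mul_zero, add_zero,
        zero_mul, zero_add, Function.update_self, Function.update_of_ne]
      field_simp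
      change (y : Base VarA).2.2 .ρ * _ + γ * (y : Base VarA).2.2 .p * _ = 0 at this
      linear_combination w.2.2 .ρ * this

end CaseA

section CaseA

open TopologicalSpace Smooth

theorem Smooth.eq_const {D : Type} [Fintype D] [DecidableEq D] {U : Opens (Base D)}
    (hU : IsPreconnected (U : Set (Base D))) {f : Smooth U} (h : ∀ i, par i f = 0) :
    ∃ c : ℝ, f = algebraMap ℝ _ c := by
  obtain ⟨c, hc⟩ := exists_eq_const hU h
  exact ⟨c, ext_eval fun y => by rw [hc, AlgHom.commutes]; rfl⟩

/-- The symmetries of the system for `A ≠ 0`. -/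
theorem Admits.eq_combinationA {γ A : ℝ} (hγ : 1 < γ) (hA : A ≠ 0) {U : Set (Base VarA)}
    (hUo : IsOpen U) (hU : U ⊆ domainA) (hUc : IsPreconnected U) {X : Base VarA → Base VarA}
    (hX : Admits (systemA γ A) U X) :
    ∃ a₁ a₂ a₃ a₄ a₅ : ℝ, ∀ y₀ ∈ U, ∃ V : Set (Base VarA), IsOpen V ∧ y₀ ∈ V ∧ V ⊆ U ∧
      ∃ f₁ f₂ : ℝ × ℝ → ℝ,
        (∀ y ∈ V, ContDiffAt ℝ ∞ f₁ (invA γ y) ∧ ContDiffAt ℝ ∞ f₂ (invA γ y)) ∧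
        ∀ y ∈ V, X y = a₁ • A1 y + a₂ • A2 y + a₃ • A3 y + a₄ • A4 y + a₅ • A5 y
          + A6 γ f₁ y + A7 γ f₂ y := by
  lift U to Opens (Base VarA) using hUo
  obtain ⟨ir, iρ, hir, hiρ, hS⟩ := hX.isSymmetryA hU
  obtain ⟨m, hm, hB, hT, ⟨st, ss, sq⟩, ⟨ts, tq⟩, ⟨er, eu, ev, ew, eρ, ep, eh, ek⟩,
    ⟨θt, θq, θρ⟩, ⟨zz, zq, zρ⟩⟩ := hS.solve hγ hA hir hiρ
  simp only [smoothCalculus, Calculus.v] at hm hB hT st ss sq ts tq er eu ev ew eρ ep eh ek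
  simp only [smoothCalculus, Calculus.v] at θt θq θρ zz zq zρ
  obtain ⟨a₄, rfl⟩ := Smooth.eq_const hUc hm
  obtain ⟨a₃, h₃⟩ := Smooth.eq_const hUc hB
  obtain ⟨a₅, h₅⟩ := Smooth.eq_const hUc hT
  rw [h₃] at ss eu ev ew eρ
  rw [h₅] at ew
  -- Subtracting the contribution of the scalings leaves constants, the coefficients of the
  -- translations in `t` and `s`.
  have ht : ∃ a₁ : ℝ, coeff hX.1 .t - algebraMap ℝ _ a₃ * crd .t = algebraMap ℝ _ a₁ :=
    Smooth.eq_const hUc (by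
      rintro (_ | _ | a) <;> simp [par_crd, h₃, ts, tq])
  have hs : ∃ a₂ : ℝ, coeff hX.1 .s - (2 * algebraMap ℝ _ a₃ - 2 * algebraMap ℝ _ a₄) * crd .s =
      algebraMap ℝ _ a₂ := Smooth.eq_const hUc (by
    have h2 := fun i => (smoothCalculus U).d_two i
    rintro (_ | _ | a) <;> simp [par_crd, st, sq, ss, show ∀ i, par i 2 = 0 from h2] )
  obtain ⟨a₁, h₁⟩ := ht
  obtain ⟨a₂, h₂⟩ := hs
  refine ⟨a₁, a₂, a₃, a₄, a₅, fun y₀ hy₀ => ?_⟩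
  obtain ⟨V₁, hV₁, hy₁, hU₁, f₁, hf₁⟩ := exists_local_factorA hU _ θt θq θρ ⟨y₀, hy₀⟩
  -- The scaling `a₄ z` and the boost `a₅ t` are removed from `η z` first; what remains is a
  -- function of the invariants.
  obtain ⟨V₂, hV₂, hy₂, hU₂, f₂, hf₂⟩ := exists_local_factorA (γ := γ) hU
    (coeff hX.1 (.q .z) - algebraMap ℝ _ a₄ * crd (.q .z) - algebraMap ℝ _ a₅ * crd .t)
    (by simp [par_crd, h₅])
    (fun a h1 h2 => by
      by_cases h : a = .z
      · subst h; simp [par_crd, zz]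
      · simp [par_crd, zq a h1 h2 h, h])
    (by simpa [par_crd] using zρ) ⟨y₀, hy₀⟩
  refine ⟨V₁ ∩ V₂, hV₁.inter hV₂, ⟨hy₁, hy₂⟩, fun y hy => hU₁ hy.1, f₁, f₂,
    fun y hy => ⟨(hf₁ ⟨y, hU₁ hy.1⟩ hy.1).1, (hf₂ ⟨y, hU₁ hy.1⟩ hy.2).1⟩, fun y hy => ?_⟩
  set z : U := ⟨y, hU₁ hy.1⟩ with hz
  have e6 := (hf₁ z hy.1).2
  have e7 := (hf₂ z hy.2).2
  have c1 : ∀ i, eval z (coeff hX.1 i) = Coord.fn i (X y) := fun i => rfl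
  have c2 : ∀ i, eval z (crd i) = Coord.fn i y := fun i => rfl
  have h2 : eval z 2 = 2 := map_ofNat _ 2
  have h4 : eval z 4 = 4 := map_ofNat _ 4
  replace h₁ := congrArg (eval z) h₁
  replace h₂ := congrArg (eval z) h₂
  replace er := congrArg (eval z) er
  replace eu := congrArg (eval z) eu
  replace ev := congrArg (eval z) ev
  replace ew := congrArg (eval z) ew
  replace eρ := congrArg (eval z) eρ
  replace ep := congrArg (eval z) ep
  replace eh := congrArg (eval z) eh
  replace ek := congrArg (eval z) ek
  simp only [map_sub, map_mul, map_neg, AlgHom.commutes, c1, c2, h2, h4,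
    Algebra.algebraMap_self, RingHom.id_apply] at h₁ h₂ er eu ev ew eρ ep eh ek e6 e7
  refine Coord.ext fun i => ?_
  simp only [Coord.fn] at h₁ h₂ er eu ev ew eρ ep eh ek e6 e7 ⊢
  rcases i with _ | _ | a
  · simp [A1, A2, A3, A4, A5, A6, A7] at h₁ h₂ ⊢
    linear_combination h₁
  · simp [A1, A2, A3, A4, A5, A6, A7] at h₁ h₂ ⊢
    linear_combination h₂
  · cases a <;> simp [A1, A2, A3, A4, A5, A6, A7] at er eu ev ew eρ ep eh ek e6 e7 ⊢
    · linear_combination er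
    · linear_combination e6
    · linear_combination e7
    · linear_combination eu
    · linear_combination ev
    · linear_combination ew
    · linear_combination eρ
    · linear_combination ep
    · linear_combination eh
    · linear_combination ek

end CaseA

/-! ### Verification of the generators for A ≠ 0 -/

section

variable {D : Type} [Fintype D]

theorem prolong_eq {X : Base D → Base D} {j : Jet D} {Xt Xs : Base D}
    (ht : ∀ i, HasDirDeriv (fun y => Coord.fn i (X y)) j.1 (1, 0, j.2.1) (Coord.fn i Xt))
    (hs : ∀ i, HasDirDeriv (fun y => Coord.fn i (X y)) j.1 (0, 1, j.2.2) (Coord.fn i Xs)) :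
    prolong X j = (X j.1, fun a => Xt.2.2 a - j.2.1 a * Xt.1 - j.2.2 a * Xt.2.1,
      fun a => Xs.2.2 a - j.2.1 a * Xs.1 - j.2.2 a * Xs.2.1) := by
  have h1 := fun i => (ht i).2
  have h2 := fun i => (hs i).2
  have t1 := h1 .t
  have t2 := h1 .s
  have t3 := fun a => h1 (.q a)
  have s1 := h2 .t
  have s2 := h2 .s
  have s3 := fun a => h2 (.q a)
  simp only [Coord.fn, ContinuousLinearMap.coe_fst', ContinuousLinearMap.coe_comp,
    Function.comp_apply, ContinuousLinearMap.coe_snd', ContinuousLinearMap.proj_apply]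
    at t1 t2 t3 s1 s2 s3
  simp only [prolong, Dt, Ds, t1, t2, t3, s1, s2, s3]

theorem contDiffOn_of_coord {X : Base D → Base D} {U : Set (Base D)}
    (h : ∀ i, ContDiffOn ℝ ∞ (fun y => Coord.fn i (X y)) U) : ContDiffOn ℝ ∞ X U :=
  (h .t).prodMk ((h .s).prodMk (contDiffOn_pi.2 fun a => h (.q a)))

end

section CaseA

/-- The pointwise converse of `Admits.isSymmetryA`: `Xt` and `Xs` are the derivatives of the
generator along the directions of the two total derivatives. -/
theorem admitsA_of {γ A : ℝ} {U : Set (Base VarA)} (hU : U ⊆ domainA)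
    {X : Base VarA → Base VarA} (hX : ∀ i, ContDiffOn ℝ ∞ (fun y => Coord.fn i (X y)) U)
    (h : ∀ y ∈ U, ∀ τ σ : VarA → ℝ, σ .r = (y.2.2 .r)⁻¹ * (y.2.2 .ρ)⁻¹ →
      (∀ a, τ a = flowA γ A (y.2.2 .r)⁻¹ (y.2.2 .ρ)⁻¹ y.2.2 σ a) → ∃ Xt Xs : Base VarA,
      (∀ i, HasDirDeriv (fun y => Coord.fn i (X y)) y (1, 0, τ) (Coord.fn i Xt)) ∧
      (∀ i, HasDirDeriv (fun y => Coord.fn i (X y)) y (0, 1, σ) (Coord.fn i Xs)) ∧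
      Xs.2.2 .r - τ .r * Xs.1 - σ .r * Xs.2.1 = -((y.2.2 .r)⁻¹ * (y.2.2 .ρ)⁻¹ *
        ((y.2.2 .r)⁻¹ * (X y).2.2 .r + (y.2.2 .ρ)⁻¹ * (X y).2.2 .ρ)) ∧
      ∀ a, Xt.2.2 a - τ a * Xt.1 - σ a * Xt.2.1 = dflowA γ A (y.2.2 .r)⁻¹ (y.2.2 .ρ)⁻¹ y.2.2 σ
        (X y).2.2 (fun a => Xs.2.2 a - τ a * Xs.1 - σ a * Xs.2.1) a) :
    Admits (systemA γ A) U X := by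
  refine ⟨contDiffOn_of_coord hX, fun j hj hF => ?_⟩
  have hr : j.1.2.2 .r ≠ 0 := (hU hj).1.ne'
  have hρ : j.1.2.2 .ρ ≠ 0 := (hU hj).2.ne'
  obtain ⟨h1, h2⟩ := (systemA_eq_zero_iff γ A j hr hρ).1 hF
  obtain ⟨Xt, Xs, ht, hs, e1, e2⟩ := h j.1 hj j.2.1 j.2.2 h1 h2
  refine (fderiv_systemA_eq_zero_iff γ A j _ hr hρ h1).2 ?_
  rw [prolong_eq ht hs]
  exact ⟨e1, e2⟩

/-- A generic combination is checked at once, and unit vectors of coefficients recover the five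
generators. All coefficients are affine, so their derivatives are the linear parts. -/
theorem admitsA_affine {γ A : ℝ} {U : Set (Base VarA)} (hU : U ⊆ domainA) (a₁ a₂ a₃ a₄ a₅ : ℝ)
    {X : Base VarA → Base VarA}
    (hX : ∀ y, X y = a₁ • A1 y + a₂ • A2 y + a₃ • A3 y + a₄ • A4 y + a₅ • A5 y) :
    Admits (systemA γ A) U X := by
  obtain rfl : X = _ := funext hX
  -- The fields `A3` and `A4` are linear; of `A5` only `t ∂_z` is linear, whence the `Pi.single`
  -- term and the coefficient `d`, used for `z` alone.
  have form : ∀ a, ∃ c d e : ℝ, (∀ y : Base VarA, Coord.fn (.q a) (a₁ • A1 y +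
      a₂ • A2 y + a₃ • A3 y + a₄ • A4 y + a₅ • A5 y) = c * y.2.2 a + d * y.1 + e) ∧
      ∀ v : Base VarA, Coord.fn (.q a) (a₃ • A3 v + a₄ • A4 v +
        a₅ • ((0, 0, Pi.single .z v.1) : Base VarA)) = c * v.2.2 a + d * v.1 := by
    intro a
    cases a
    case r => exact ⟨a₄, 0, 0, by intro y; simp [Coord.fn, A1, A2, A3, A4, A5],
      by intro v; simp [Coord.fn, A3, A4]⟩
    case θ => exact ⟨0, 0, 0, by intro y; simp [Coord.fn, A1, A2, A3, A4, A5],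
      by intro v; simp [Coord.fn, A3, A4]⟩
    case z => exact ⟨a₄, a₅, 0, by intro y; simp [Coord.fn, A1, A2, A3, A4, A5],
      by intro v; simp [Coord.fn, A3, A4]⟩
    case w => exact ⟨a₄ - a₃, 0, a₅, by intro y; simp [Coord.fn, A1, A2, A3, A4, A5]; ring,
      by intro v; simp [Coord.fn, A3, A4]; ring⟩
    case ρ => exact ⟨2 * a₃ - 4 * a₄, 0, 0,
      by intro y; simp [Coord.fn, A1, A2, A3, A4, A5]; ring,
      by intro v; simp [Coord.fn, A3, A4]; ring⟩
    case p => exact ⟨-2 * a₄, 0, 0,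
      by intro y; simp [Coord.fn, A1, A2, A3, A4, A5]; ring,
      by intro v; simp [Coord.fn, A3, A4]; ring⟩
    case Hθ => exact ⟨-a₄, 0, 0, by intro y; simp [Coord.fn, A1, A2, A3, A4, A5],
      by intro v; simp [Coord.fn, A3, A4]⟩
    case Hz => exact ⟨-a₄, 0, 0, by intro y; simp [Coord.fn, A1, A2, A3, A4, A5],
      by intro v; simp [Coord.fn, A3, A4]⟩
    all_goals exact ⟨a₄ - a₃, 0, 0, by intro y; simp [Coord.fn, A1, A2, A3, A4, A5]; ring,
      by intro v; simp [Coord.fn, A3, A4]; ring⟩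
  have key : ∀ i (y v : Base VarA), HasDirDeriv (fun y => Coord.fn i (a₁ • A1 y + a₂ • A2 y +
      a₃ • A3 y + a₄ • A4 y + a₅ • A5 y)) y v
      (Coord.fn i (a₃ • A3 v + a₄ • A4 v + a₅ • ((0, 0, Pi.single .z v.1) : Base VarA))) := by
    intro i y v
    have hc : ∀ c : ℝ, HasDirDeriv (fun _ : Base VarA => c) y v 0 := fun c => .const c
    have h1 := hasDirDeriv_t y v
    have h2 := hasDirDeriv_s y v
    have h3 := fun a => hasDirDeriv_val a y v
    rcases i with _ | _ | a
    · refine (((hc a₃).mul h1).add (hc a₁)).congr_deriv ?_ |>.congr_fun (.of_eq ?_)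
      · simp [Coord.fn, A3, A4]
      · ext y; simp [Coord.fn, A1, A2, A3, A4, A5]; ring
    · refine (((hc (2 * a₃ - 2 * a₄)).mul h2).add (hc a₂)).congr_deriv ?_ |>.congr_fun (.of_eq ?_)
      · simp [Coord.fn, A3, A4]; ring
      · ext y; simp [Coord.fn, A1, A2, A3, A4, A5]; ring
    · have h4 : ∀ c d e, HasDirDeriv (fun y : Base VarA => c * y.2.2 a + d * y.1 + e) y v
          (c * v.2.2 a + d * v.1) := fun c d e =>
        ((((hc c).mul (h3 a)).add ((hc d).mul h1)).add (hc e)).congr_deriv (by ring)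
      obtain ⟨c, d, e, h5, h6⟩ := form a
      rw [h6]
      exact (h4 c d e).congr_fun (.of_eq (funext h5))
  refine admitsA_of hU (fun i => ?_) fun y hy τ σ h1 h2 => ?_
  · rcases i with _ | _ | a
    · have : (fun y => Coord.fn .t (a₁ • A1 y + a₂ • A2 y + a₃ • A3 y + a₄ • A4 y + a₅ • A5 y)) =
          fun y => a₃ * y.1 + a₁ := by
        ext y; simp [Coord.fn, A1, A2, A3, A4, A5]; ring
      rw [this]
      fun_prop
    · have : (fun y => Coord.fn .s (a₁ • A1 y + a₂ • A2 y + a₃ • A3 y + a₄ • A4 y + a₅ • A5 y)) =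
          fun y => (2 * a₃ - 2 * a₄) * y.2.1 + a₂ := by
        ext y; simp [Coord.fn, A1, A2, A3, A4, A5]; ring
      rw [this]
      fun_prop
    · obtain ⟨c, d, e, h5, -⟩ := form a
      rw [funext h5]
      fun_prop
  · have hr : y.2.2 .r ≠ 0 := (hU hy).1.ne'
    have hρ : y.2.2 .ρ ≠ 0 := (hU hy).2.ne'
    refine ⟨_, _, fun i => key i y _, fun i => key i y _, ?_, fun a => ?_⟩
    · simp [val, h1, h2, A1, A2, A3, A4, A5]
      field_simp
      ring
    · cases a <;> simp [val, h1, h2, A1, A2, A3, A4, A5, flowA, dflowA] <;> field_simp <;> ring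

end CaseA

section CaseA

theorem hasDirDeriv_invA {γ : ℝ} {y v : Base VarA} (hρ : 0 < y.2.2 .ρ) :
    HasDirDeriv (invA γ) y v (v.2.1, (v.2.2 .p - γ * y.2.2 .p * v.2.2 .ρ / y.2.2 .ρ) /
      y.2.2 .ρ ^ γ) := by
  have h := Real.rpow_pos_of_pos hρ γ
  refine (hasDirDeriv_s y v).prodMk (((hasDirDeriv_val .p y v).div
    ((hasDirDeriv_val .ρ y v).rpow_const hρ.ne' γ) h.ne').congr_deriv ?_)
  rw [Real.rpow_sub_one hρ.ne']
  field_simp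

theorem contDiffAt_invA {γ : ℝ} {y : Base VarA} (hρ : 0 < y.2.2 .ρ) :
    ContDiffAt ℝ ∞ (invA γ) y := by
  have h1 : ∀ a : VarA, ContDiffAt ℝ ∞ (fun y : Base VarA => y.2.2 a) y := fun a => by fun_prop
  exact ContDiffAt.prodMk (by fun_prop)
    ((h1 .p).div ((h1 .ρ).rpow_const_of_ne hρ.ne') (Real.rpow_pos_of_pos hρ γ).ne')

/-- Entropy is conserved along particle trajectories: the flow satisfies `p_t = γ p ρ_t / ρ`, and
`s` is a Lagrangian label. -/
theorem hasDirDeriv_comp_invA {γ A : ℝ} {y : Base VarA} (hr : 0 < y.2.2 .r) (hρ : 0 < y.2.2 .ρ)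
    {f : ℝ × ℝ → ℝ} (hf : ContDiffAt ℝ ∞ f (invA γ y)) {τ σ : VarA → ℝ}
    (h : ∀ a, τ a = flowA γ A (y.2.2 .r)⁻¹ (y.2.2 .ρ)⁻¹ y.2.2 σ a) :
    HasDirDeriv (fun y => f (invA γ y)) y (1, 0, τ) 0 := by
  refine ((HasDirDeriv.comp (hf.differentiableAt (by simp)) (hasDirDeriv_invA hρ)).congr_deriv ?_)
  have : (τ .p - γ * y.2.2 .p * τ .ρ / y.2.2 .ρ) / y.2.2 .ρ ^ γ = 0 := by
    rw [h, h, div_eq_zero_iff]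
    left
    simp only [flowA]
    field_simp
    ring
  rw [this]
  exact map_zero _

/-- The variables `θ` and `z` enter the system only through `θ_t` and `z_t`, and the total
t-derivative of a function of the invariants vanishes. -/
theorem admitsA_fiber {γ A : ℝ} {U : Set (Base VarA)} (hU : U ⊆ domainA) {f : ℝ × ℝ → ℝ}
    (hf : ∀ y ∈ U, ContDiffAt ℝ ∞ f (invA γ y)) {b : VarA} (hb : b = .θ ∨ b = .z)
    {X : Base VarA → Base VarA} (hX : ∀ y, X y = (0, 0, Pi.single b (f (invA γ y)))) :
    Admits (systemA γ A) U X := by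
  have hc : ∀ y v : Base VarA, HasDirDeriv (fun _ : Base VarA => (0 : ℝ)) y v 0 :=
    fun y v => .const 0
  have ht : ∀ y, Coord.fn .t (X y) = 0 := fun y => by rw [hX]; rfl
  have hs : ∀ y, Coord.fn .s (X y) = 0 := fun y => by rw [hX]; rfl
  have ha : ∀ a, a ≠ b → ∀ y, Coord.fn (.q a) (X y) = 0 := fun a h y => by
    rw [hX]; simp [Coord.fn, h]
  have hb' : ∀ y, Coord.fn (.q b) (X y) = f (invA γ y) := fun y => by
    rw [hX]; simp [Coord.fn]
  have key : ∀ y (v : Base VarA) d, HasDirDeriv (fun y => f (invA γ y)) y v d →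
      ∀ i, HasDirDeriv (fun y => Coord.fn i (X y)) y v (Coord.fn i (0, 0, Pi.single b d)) := by
    intro y v d hd i
    rcases i with _ | _ | a
    · rw [funext ht]; exact hc y v
    · rw [funext hs]; exact hc y v
    · by_cases h : a = b
      · subst h
        rw [funext hb']
        exact hd.congr_deriv (by simp [Coord.fn])
      · rw [funext (ha a h)]
        exact (hc y v).congr_deriv (by simp [Coord.fn, h])
  refine admitsA_of hU (fun i => ?_) fun y hy τ σ h1 h2 => ?_
  · rcases i with _ | _ | a
    · rw [funext ht]; exact contDiffOn_const
    · rw [funext hs]; exact contDiffOn_const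
    · by_cases h : a = b
      · subst h
        rw [funext hb']
        exact fun y hy => ((hf y hy).comp y (contDiffAt_invA (hU hy).2)).contDiffWithinAt
      · rw [funext (ha a h)]; exact contDiffOn_const
  · refine ⟨_, _, key y _ _ (hasDirDeriv_comp_invA (hU hy).1 (hU hy).2 (hf y hy) h2),
      key y _ _ (HasDirDeriv.comp ((hf y hy).differentiableAt (by simp))
        (hasDirDeriv_invA (hU hy).2)), ?_, fun a => ?_⟩
    · rcases hb with rfl | rfl <;> simp [hX]
    · rcases hb with rfl | rfl <;> cases a <;> simp [hX, dflowA]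

theorem admitsA {γ A : ℝ} {U : Set (Base VarA)} (hU : U ⊆ domainA) :
    Admits (systemA γ A) U A1 ∧ Admits (systemA γ A) U A2 ∧ Admits (systemA γ A) U A3 ∧
      Admits (systemA γ A) U A4 ∧ Admits (systemA γ A) U A5 ∧
      (∀ f : ℝ × ℝ → ℝ, (∀ y ∈ U, ContDiffAt ℝ ∞ f (invA γ y)) →
        Admits (systemA γ A) U (A6 γ f)) ∧
      (∀ f : ℝ × ℝ → ℝ, (∀ y ∈ U, ContDiffAt ℝ ∞ f (invA γ y)) →
        Admits (systemA γ A) U (A7 γ f)) :=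
  ⟨admitsA_affine hU 1 0 0 0 0 (by simp), admitsA_affine hU 0 1 0 0 0 (by simp),
    admitsA_affine hU 0 0 1 0 0 (by simp), admitsA_affine hU 0 0 0 1 0 (by simp),
    admitsA_affine hU 0 0 0 0 1 (by simp),
    fun _ hf => admitsA_fiber hU hf (.inl rfl) fun _ =>
      Prod.ext rfl (Prod.ext rfl (funext fun a => by cases a <;> simp [A6])),
    fun _ hf => admitsA_fiber hU hf (.inr rfl) fun _ =>
      Prod.ext rfl (Prod.ext rfl (funext fun a => by cases a <;> simp [A7]))⟩

end CaseA

/-! ### The system for A = 0 and its linearization -/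

theorem VarO.sum_eq {M : Type*} [AddCommMonoid M] (f : VarO → M) :
    ∑ a, f a = f .r + f .θ + f .u + f .v + f .ρ + f .p + f .Hθ + f .Hz := by
  simp [Finset.univ, Fintype.elems, add_assoc]

/-- The derivatives `q_t` on the solutions of the system for `A = 0`, where `ir` and `iρ` stand
for the inverses of `r` and `ρ`. -/
def flowO {R : Type*} [CommRing R] (g ir iρ : R) (q σ : VarO → R) : VarO → R
  | .r => q .u
  | .θ => q .v * ir
  | .u => q .v ^ 2 * ir - q .r * σ .p - q .Hθ ^ 2 * (ir * iρ) - q .r * q .Hθ * σ .Hθ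
      - q .r * q .Hz * σ .Hz
  | .v => -(q .u * q .v * ir)
  | .ρ => -(q .ρ ^ 2 * q .r * σ .u) - q .ρ * q .u * ir
  | .p => -(g * q .p * q .ρ * q .r * σ .u) - g * q .p * q .u * ir
  | .Hθ => -(q .r * q .ρ * q .Hθ * σ .u)
  | .Hz => -(q .r * q .ρ * q .Hz * σ .u) - q .Hz * q .u * ir

/-- The differential of `flowO`. -/
def dflowO {R : Type*} [CommRing R] (g ir iρ : R) (q σ η ησ : VarO → R) : VarO → R
  | .r => η .u
  | .θ => η .v * ir - q .v * ir ^ 2 * η .r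
  | .u => 2 * q .v * η .v * ir - q .v ^ 2 * ir ^ 2 * η .r - η .r * σ .p - q .r * ησ .p
      - 2 * q .Hθ * η .Hθ * (ir * iρ) + q .Hθ ^ 2 * (ir * iρ) * (ir * η .r + iρ * η .ρ)
      - (η .r * q .Hθ + q .r * η .Hθ) * σ .Hθ - q .r * q .Hθ * ησ .Hθ
      - (η .r * q .Hz + q .r * η .Hz) * σ .Hz - q .r * q .Hz * ησ .Hz
  | .v => -((η .u * q .v + q .u * η .v) * ir) + q .u * q .v * ir ^ 2 * η .r
  | .ρ => -(2 * q .ρ * η .ρ * q .r * σ .u) - q .ρ ^ 2 * (η .r * σ .u + q .r * ησ .u)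
      - (η .ρ * q .u + q .ρ * η .u) * ir + q .ρ * q .u * ir ^ 2 * η .r
  | .p => -(g * (η .p * q .ρ * q .r + q .p * η .ρ * q .r + q .p * q .ρ * η .r) * σ .u)
      - g * q .p * q .ρ * q .r * ησ .u
      - g * (η .p * q .u + q .p * η .u) * ir + g * q .p * q .u * ir ^ 2 * η .r
  | .Hθ => -((η .r * q .ρ * q .Hθ + q .r * η .ρ * q .Hθ + q .r * q .ρ * η .Hθ) * σ .u)
      - q .r * q .ρ * q .Hθ * ησ .u
  | .Hz => -((η .r * q .ρ * q .Hz + q .r * η .ρ * q .Hz + q .r * q .ρ * η .Hz) * σ .u)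
      - q .r * q .ρ * q .Hz * ησ .u
      - (η .Hz * q .u + q .Hz * η .u) * ir + q .Hz * q .u * ir ^ 2 * η .r

theorem map_flowO {R S : Type*} [CommRing R] [CommRing S] (φ : R →+* S) (g ir iρ : R)
    (q σ : VarO → R) (a : VarO) : φ (flowO g ir iρ q σ a) =
      flowO (φ g) (φ ir) (φ iρ) (fun a => φ (q a)) (fun a => φ (σ a)) a := by
  cases a <;> simp [flowO]

theorem map_dflowO {R S : Type*} [CommRing R] [CommRing S] (φ : R →+* S) (g ir iρ : R)
    (q σ η ησ : VarO → R) (a : VarO) : φ (dflowO g ir iρ q σ η ησ a) =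
      dflowO (φ g) (φ ir) (φ iρ) (fun a => φ (q a)) (fun a => φ (σ a)) (fun a => φ (η a))
        (fun a => φ (ησ a)) a := by
  have h : φ 2 = 2 := map_ofNat φ 2
  cases a <;> simp [dflowO, h]

/-- The left-hand sides of the system for `A = 0` with the products differentiated. -/
noncomputable def expandedO (γ : ℝ) : Option VarO → Jet VarO → ℝ
  | some .r => fun j => j.2.1 .r - j.1.2.2 .u
  | some .θ => fun j => j.2.1 .θ - j.1.2.2 .v / j.1.2.2 .r
  | some .u => fun j => j.2.1 .u - j.1.2.2 .v ^ 2 / j.1.2.2 .r + j.1.2.2 .r * j.2.2 .p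
      + j.2.2 .r * j.1.2.2 .Hθ ^ 2 + j.1.2.2 .r * j.1.2.2 .Hθ * j.2.2 .Hθ
      + j.1.2.2 .r * j.1.2.2 .Hz * j.2.2 .Hz
  | some .v => fun j => j.2.1 .v + j.1.2.2 .u * j.1.2.2 .v / j.1.2.2 .r
  | some .ρ => fun j => j.2.1 .ρ
      + j.1.2.2 .ρ ^ 2 * (j.2.2 .r * j.1.2.2 .u + j.1.2.2 .r * j.2.2 .u)
  | some .p => fun j => j.2.1 .p
      + γ * j.1.2.2 .ρ * j.1.2.2 .p * (j.2.2 .r * j.1.2.2 .u + j.1.2.2 .r * j.2.2 .u)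
  | some .Hθ => fun j => j.2.1 .Hθ + j.1.2.2 .r * j.1.2.2 .ρ * j.1.2.2 .Hθ * j.2.2 .u
  | some .Hz => fun j => j.2.1 .Hz
      + j.1.2.2 .ρ * j.1.2.2 .Hz * (j.2.2 .r * j.1.2.2 .u + j.1.2.2 .r * j.2.2 .u)
  | none => fun j => j.2.2 .r - 1 / (j.1.2.2 .r * j.1.2.2 .ρ)

theorem systemO_eq_expandedO (γ : ℝ) (k : Option VarO) (j : Jet VarO) (hr : j.1.2.2 .r ≠ 0) :
    systemO γ k j = expandedO γ k j := by
  have h0 : ∀ a : VarO, HasDirDeriv (fun y : Base VarO => y.2.2 a) j.1 (0, 1, j.2.2) (j.2.2 a) :=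
    fun a => hasDirDeriv_val a _ _
  have h1 := ((h0 .r).mul (h0 .u)).2
  have h2 := ((h0 .r).pow_two.mul (h0 .Hθ).pow_two).2
  have h3 := ((h0 .Hz).pow_two).2
  rcases k with _ | a
  · simp only [systemO, expandedO, ds, val]
  · cases a <;> simp only [systemO, expandedO, dt, ds, val, Ds, h1, h2, h3] <;>
      field_simp <;> ring

/-- The multiplier `m` is again the coefficient of `r_s`, which `flowO` has eliminated. -/
theorem hasDirDeriv_systemO (γ : ℝ) (k : Option VarO) (j v : Jet VarO) (hr : j.1.2.2 .r ≠ 0)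
    (hρ : j.1.2.2 .ρ ≠ 0) (hj : j.2.2 .r = (j.1.2.2 .r)⁻¹ * (j.1.2.2 .ρ)⁻¹) :
    ∃ m : ℝ, HasDirDeriv (systemO γ k) j v
      (k.elim 0 (fun a => v.2.1 a - dflowO γ (j.1.2.2 .r)⁻¹ (j.1.2.2 .ρ)⁻¹ j.1.2.2 j.2.2
        v.1.2.2 v.2.2 a) + k.elim 1 (fun _ => m) * (v.2.2 .r + (j.1.2.2 .r)⁻¹ * (j.1.2.2 .ρ)⁻¹ *
          ((j.1.2.2 .r)⁻¹ * v.1.2.2 .r + (j.1.2.2 .ρ)⁻¹ * v.1.2.2 .ρ))) := by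
  have hE : systemO γ k =ᶠ[nhds j] expandedO γ k := by
    have : ContinuousAt (fun j : Jet VarO => j.1.2.2 .r) j := by fun_prop
    filter_upwards [this.eventually_ne hr] with i hi using systemO_eq_expandedO γ k i hi
  have hc : ∀ c : ℝ, HasDirDeriv (fun _ : Jet VarO => c) j v 0 := fun c => .const c
  have hq := fun a => hasDirDeriv_jet_val a j v
  have ht := fun a => hasDirDeriv_dt a j v
  have hs := fun a => hasDirDeriv_ds a j v
  rcases k with _ | a
  · refine ⟨0, .congr_fun (.congr_deriv ((hs .r).sub ((hc 1).div ((hq .r).mul (hq .ρ))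
      (mul_ne_zero hr hρ))) ?_) hE⟩
    simp only [Option.elim]
    field_simp
    ring
  · cases a
    case r =>
      refine ⟨0, .congr_fun (.congr_deriv ((ht .r).sub (hq .u)) ?_) hE⟩
      simp [dflowO]
    case θ =>
      refine ⟨0, .congr_fun (.congr_deriv ((ht .θ).sub ((hq .v).div (hq .r) hr)) ?_) hE⟩
      simp only [dflowO, Option.elim]
      field_simp
      ring
    case u =>
      refine ⟨j.1.2.2 .Hθ ^ 2, .congr_fun (.congr_deriv (((((ht .u).sub
        ((hq .v).pow_two.div (hq .r) hr)).add ((hq .r).mul (hs .p))).add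
        ((hs .r).mul (hq .Hθ).pow_two)).add (((hq .r).mul (hq .Hθ)).mul (hs .Hθ)) |>.add
        (((hq .r).mul (hq .Hz)).mul (hs .Hz))) ?_) hE⟩
      simp only [dflowO, Option.elim, hj]
      field_simp
      ring
    case v =>
      refine ⟨0, .congr_fun (.congr_deriv ((ht .v).add
        (((hq .u).mul (hq .v)).div (hq .r) hr)) ?_) hE⟩
      simp only [dflowO, Option.elim]
      field_simp
      ring
    case ρ =>
      refine ⟨j.1.2.2 .ρ ^ 2 * j.1.2.2 .u, .congr_fun (.congr_deriv ((ht .ρ).add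
        ((hq .ρ).pow_two.mul (((hs .r).mul (hq .u)).add ((hq .r).mul (hs .u))))) ?_) hE⟩
      simp only [dflowO, Option.elim, hj]
      field_simp
      ring
    case p =>
      refine ⟨γ * j.1.2.2 .ρ * j.1.2.2 .p * j.1.2.2 .u, .congr_fun (.congr_deriv ((ht .p).add
        ((((hc γ).mul (hq .ρ)).mul (hq .p)).mul
          (((hs .r).mul (hq .u)).add ((hq .r).mul (hs .u))))) ?_) hE⟩
      simp only [dflowO, Option.elim, hj]
      field_simp
      ring
    case Hθ =>
      refine ⟨0, .congr_fun (.congr_deriv ((ht .Hθ).add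
        ((((hq .r).mul (hq .ρ)).mul (hq .Hθ)).mul (hs .u))) ?_) hE⟩
      simp only [dflowO, Option.elim]
      ring
    case Hz =>
      refine ⟨j.1.2.2 .ρ * j.1.2.2 .Hz * j.1.2.2 .u, .congr_fun (.congr_deriv ((ht .Hz).add
        (((hq .ρ).mul (hq .Hz)).mul (((hs .r).mul (hq .u)).add ((hq .r).mul (hs .u))))) ?_) hE⟩
      simp only [dflowO, Option.elim, hj]
      field_simp
      ring

theorem systemO_eq_zero_iff (γ : ℝ) (j : Jet VarO) (hr : j.1.2.2 .r ≠ 0)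
    (hρ : j.1.2.2 .ρ ≠ 0) : (∀ k, systemO γ k j = 0) ↔
      j.2.2 .r = (j.1.2.2 .r)⁻¹ * (j.1.2.2 .ρ)⁻¹ ∧
      ∀ a, j.2.1 a = flowO γ (j.1.2.2 .r)⁻¹ (j.1.2.2 .ρ)⁻¹ j.1.2.2 j.2.2 a := by
  simp only [systemO_eq_expandedO γ _ j hr, Option.forall]
  have h0 : expandedO γ none j = 0 ↔ j.2.2 .r = (j.1.2.2 .r)⁻¹ * (j.1.2.2 .ρ)⁻¹ := by
    simp only [expandedO, sub_eq_zero, one_div, mul_inv]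
  rw [h0]
  refine and_congr_right fun hj => forall_congr' fun a => ?_
  rw [← sub_eq_zero (a := j.2.1 a)]
  suffices h : expandedO γ (some a) j =
      j.2.1 a - flowO γ (j.1.2.2 .r)⁻¹ (j.1.2.2 .ρ)⁻¹ j.1.2.2 j.2.2 a by rw [h]
  cases a <;> simp only [expandedO, flowO, hj] <;> field_simp <;> ring

theorem fderiv_systemO_eq_zero_iff (γ : ℝ) (j v : Jet VarO) (hr : j.1.2.2 .r ≠ 0)
    (hρ : j.1.2.2 .ρ ≠ 0) (hj : j.2.2 .r = (j.1.2.2 .r)⁻¹ * (j.1.2.2 .ρ)⁻¹) :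
    (∀ k, fderiv ℝ (systemO γ k) j v = 0) ↔
      v.2.2 .r = -((j.1.2.2 .r)⁻¹ * (j.1.2.2 .ρ)⁻¹ *
          ((j.1.2.2 .r)⁻¹ * v.1.2.2 .r + (j.1.2.2 .ρ)⁻¹ * v.1.2.2 .ρ)) ∧
      ∀ a, v.2.1 a = dflowO γ (j.1.2.2 .r)⁻¹ (j.1.2.2 .ρ)⁻¹ j.1.2.2 j.2.2 v.1.2.2 v.2.2 a := by
  choose m hm using fun k => hasDirDeriv_systemO γ k j v hr hρ hj
  simp only [fun k => (hm k).2, Option.forall, Option.elim, zero_add, one_mul]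
  rw [← sub_eq_zero (a := v.2.2 .r), sub_neg_eq_add]
  refine and_congr_right fun h => forall_congr' fun a => ?_
  rw [h, mul_zero, add_zero, sub_eq_zero]

/-! ### Determining equations for A = 0 -/

section CaseO

open TopologicalSpace Smooth

/-- The determining equations of the symmetries of the system for `A = 0`. -/
def IsSymmetryO {R : Type*} [CommRing R] [Algebra ℝ R] (C : Calculus VarO R) (g ir iρ ξt ξs : R)
    (η : VarO → R) : Prop :=
  ∀ σ : VarO → R, σ .r = ir * iρ →
    C.prol ξt ξs η (flowO g ir iρ C.v σ) σ .s σ .r = -(ir * iρ * (ir * η .r + iρ * η .ρ)) ∧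
    ∀ a, C.prol ξt ξs η (flowO g ir iρ C.v σ) σ .t (flowO g ir iρ C.v σ) a =
      dflowO g ir iρ C.v σ η (C.prol ξt ξs η (flowO g ir iρ C.v σ) σ .s σ) a

theorem Admits.isSymmetryO {γ : ℝ} {U : Opens (Base VarO)} (hU : (U : Set (Base VarO)) ⊆ domainO)
    {X : Base VarO → Base VarO} (hX : Admits (systemO γ) U X) :
    ∃ ir iρ : Smooth U, crd (.q .r) * ir = 1 ∧ crd (.q .ρ) * iρ = 1 ∧
      IsSymmetryO (smoothCalculus U) (algebraMap ℝ _ γ) ir iρ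
        (coeff hX.1 .t) (coeff hX.1 .s) (fun a => coeff hX.1 (.q a)) := by
  have hr : ∀ y, eval y (crd (.q .r) : Smooth U) ≠ 0 := fun y => (hU y.2).1.ne'
  have hρ : ∀ y, eval y (crd (.q .ρ) : Smooth U) ≠ 0 := fun y => (hU y.2).2.ne'
  obtain ⟨ir, hir, eir⟩ := Smooth.exists_inv _ hr
  obtain ⟨iρ, hiρ, eiρ⟩ := Smooth.exists_inv _ hρ
  refine ⟨ir, iρ, hir, hiρ, fun σ hσ => ?_⟩
  set τ := flowO (algebraMap ℝ (Smooth U) γ) ir iρ (smoothCalculus U).v σ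
    with hτ
  have hc : ∀ y : U, eval y (σ .r) = ((y : Base VarO).2.2 .r)⁻¹ * ((y : Base VarO).2.2 .ρ)⁻¹ := by
    intro y
    rw [hσ, map_mul, eir, eiρ]
    rfl
  have hτ' : ∀ (y : U) a, eval y (τ a) = flowO γ ((y : Base VarO).2.2 .r)⁻¹
      ((y : Base VarO).2.2 .ρ)⁻¹ (y : Base VarO).2.2 (fun a => eval y (σ a)) a := by
    intro y a
    refine (map_flowO (eval y : Smooth U →+* ℝ) (algebraMap ℝ _ γ) ir iρ
      (smoothCalculus U).v σ a).trans ?_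
    simp only [RingHom.coe_coe, AlgHom.commutes, eir, eiρ]
    rfl
  have main := fun y : U => (fderiv_systemO_eq_zero_iff γ
    ((y : Base VarO), fun a => eval y (τ a), fun a => eval y (σ a))
    (prolong X ((y : Base VarO), fun a => eval y (τ a), fun a => eval y (σ a)))
    (hr y) (hρ y) (hc y)).1
    (hX.2 _ y.2 ((systemO_eq_zero_iff γ _ (hr y) (hρ y)).2 ⟨hc y, hτ' y⟩))
  simp only [eval_prol hX.1] at main
  refine ⟨ext_eval fun y => ?_, fun a => ext_eval fun y => ?_⟩
  · refine (main y).1.trans ?_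
    simp only [map_mul, map_neg, map_add, eir, eiρ]
    rfl
  · refine ((main y).2 a).trans (Eq.symm ?_)
    refine (map_dflowO (eval y : Smooth U →+* ℝ) (algebraMap ℝ _ γ) ir iρ
      (smoothCalculus U).v σ _ _ a).trans ?_
    simp only [RingHom.coe_coe, AlgHom.commutes, eir, eiρ]
    rfl

end CaseO

/-! ### Solution of the determining equations for A = 0 -/

section CaseO

/-- The `s`-derivatives in the case `A = 0`. -/
def sderivO {R : Type*} (c θ u v ρ p h k : R) : VarO → R
  | .r => c | .θ => θ | .u => u | .v => v | .ρ => ρ | .p => p | .Hθ => h | .Hz => k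

variable {R : Type*} [CommRing R] [Algebra ℝ R] {C : Calculus VarO R} {γ : ℝ}
  {ir iρ ξt ξs : R} {η : VarO → R}

theorem IsSymmetryO.contact (h : IsSymmetryO C (algebraMap ℝ R γ) ir iρ ξt ξs η)
    (a : VarO) (ha : a ≠ .r) :
    C.d (.q a) (η .r) = C.v .u * C.d (.q a) ξt + ir * iρ * C.d (.q a) ξs := by
  have h0 := (h (fun b => if b = .r then ir * iρ else 0) (by simp)).1
  have h1 := (h (fun b => if b = .r then ir * iρ else if b = a then 1 else 0) (by simp)).1
  simp only [Calculus.prol, Calculus.tot, VarO.sum_eq, flowO] at h0 h1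
  cases a <;> simp at ha h0 h1 <;> linear_combination h1 - h0

/-- The coefficient at `∂_s` depends on `s` only, and those at `∂_t` and `∂_r` on `t`, `s`, `r`. -/
theorem IsSymmetryO.base (hir : C.v .r * ir = 1) (hiρ : C.v .ρ * iρ = 1)
    (h : IsSymmetryO C (algebraMap ℝ R γ) ir iρ ξt ξs η) :
    (C.d .t ξs = 0 ∧ ∀ a, C.d (.q a) ξs = 0) ∧ (∀ a, a ≠ .r → C.d (.q a) ξt = 0) ∧
      ∀ a, a ≠ .r → C.d (.q a) (η .r) = 0 := by
  obtain ⟨h1, h2⟩ := C.contact (by decide) (by decide) (by decide) hir hiρ h.contact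
  have hs := fun a => fun b c d => (h1 a b c d).2
  have ht := fun a => fun b c d => (h1 a b c d).1
  -- Again `θ_s` occurs only in `-θ_s * D_t ξs`.
  have hθ : ∀ u v ρ p k l : R,
      C.tot .t (flowO (algebraMap ℝ R γ) ir iρ C.v
        (sderivO (ir * iρ) 0 u v ρ p k l)) ξs = 0 := by
    intro u v ρ p k l
    have e0 := (h (sderivO (ir * iρ) 0 u v ρ p k l) rfl).2 .θ
    have e1 := (h (sderivO (ir * iρ) 1 u v ρ p k l) rfl).2 .θ
    simp only [Calculus.prol, Calculus.tot, VarO.sum_eq, flowO, dflowO, sderivO] at e0 e1 ⊢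
    linear_combination e0 - e1
  simp only [Calculus.tot, VarO.sum_eq, flowO, sderivO, hs .θ (by decide) (by decide) (by decide),
    hs .v (by decide) (by decide) (by decide), hs .p (by decide) (by decide) (by decide),
    hs .Hθ (by decide) (by decide) (by decide), hs .Hz (by decide) (by decide) (by decide)] at hθ
  have su : C.d (.q .u) ξs = 0 := C.cancel (.q .r) _ (by
    linear_combination hθ 0 0 0 0 0 0 - hθ 0 0 0 1 0 0)
  have sρ : C.d (.q .ρ) ξs = 0 := C.cancel (.q .r) _ (C.cancel (.q .ρ) _ (C.cancel (.q .ρ) _ (by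
    linear_combination hθ 0 0 0 0 0 0 - hθ 1 0 0 0 0 0)))
  have s0 : C.d .t ξs + C.v .u * C.d (.q .r) ξs = 0 := by
    have := hθ 0 0 0 0 0 0
    rw [su, sρ] at this
    linear_combination this
  have sr : C.d (.q .r) ξs = 0 := by
    have := congrArg (C.d (.q .u)) s0
    simp only [map_add, Derivation.leibniz, smul_eq_mul, C.d_v, C.d_comm_zero su, map_zero] at this
    simpa using this
  have st : C.d .t ξs = 0 := by rw [sr] at s0; simpa using s0
  have hs' : ∀ a, C.d (.q a) ξs = 0 := by
    intro a
    cases a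
    all_goals first
      | exact su | exact sρ | exact sr | exact hs _ (by decide) (by decide) (by decide)
  have tρ : C.d (.q .ρ) ξt = 0 := by rw [h2, su]; ring
  have hu : ∀ p : R, _ := fun p => (h (sderivO (ir * iρ) 0 0 0 0 p 0 0) rfl).2 .u
  simp only [Calculus.prol, Calculus.tot, VarO.sum_eq, flowO, dflowO, sderivO, hs', tρ, st,
    ht .θ (by decide) (by decide) (by decide), ht .v (by decide) (by decide) (by decide),
    ht .p (by decide) (by decide) (by decide),
    ht .Hθ (by decide) (by decide) (by decide), ht .Hz (by decide) (by decide) (by decide)] at hu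
  have tu : C.d (.q .u) ξt = 0 := by
    refine C.cancel (.q .r) _ (C.cancel (.q .r) _ (Calculus.cancel_const (c := 2) (by simp) ?_))
    rw [map_ofNat]
    linear_combination 2 * hu 0 - hu 1 - hu (-1)
  have ht' : ∀ a, a ≠ .r → C.d (.q a) ξt = 0 := by
    intro a ha
    cases a
    all_goals first
      | exact tu | exact tρ | exact absurd rfl ha | exact ht _ (by decide) (by decide) (by decide)
  refine ⟨⟨st, hs'⟩, ht', fun a ha => ?_⟩
  rw [h.contact a ha, hs', ht' a ha]
  ring

/-- The determining equations with the known derivatives of the coefficients at `∂_t` and `∂_s`. -/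
theorem IsSymmetryO.reduce (hir : C.v .r * ir = 1) (hiρ : C.v .ρ * iρ = 1)
    (h : IsSymmetryO C (algebraMap ℝ R γ) ir iρ ξt ξs η) (σ : VarO → R)
    (hσ : σ .r = ir * iρ) (a : VarO) :
    C.tot .t (flowO (algebraMap ℝ R γ) ir iρ C.v σ) (η a) -
      flowO (algebraMap ℝ R γ) ir iρ C.v σ a * (C.d .t ξt + C.v .u * C.d (.q .r) ξt) =
      dflowO (algebraMap ℝ R γ) ir iρ C.v σ η (fun b => C.tot .s σ (η b) -
        flowO (algebraMap ℝ R γ) ir iρ C.v σ b *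
          (C.d .s ξt + ir * iρ * C.d (.q .r) ξt) - σ b * C.d .s ξs) a := by
  obtain ⟨⟨h1, h2⟩, h3, h4⟩ := h.base hir hiρ
  have ht : C.tot .t (flowO (algebraMap ℝ R γ) ir iρ C.v σ) ξt =
      C.d .t ξt + C.v .u * C.d (.q .r) ξt := by
    simp [Calculus.tot, VarO.sum_eq, h3, flowO]
  have hs : C.tot .t (flowO (algebraMap ℝ R γ) ir iρ C.v σ) ξs = 0 := by
    simp [Calculus.tot, h1, h2]
  have kt : C.tot .s σ ξt = C.d .s ξt + ir * iρ * C.d (.q .r) ξt := by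
    simp [Calculus.tot, VarO.sum_eq, h3, hσ]
  have ks : C.tot .s σ ξs = C.d .s ξs := by
    simp [Calculus.tot, h2]
  have := (h σ hσ).2 a
  rw [show C.prol ξt ξs η _ σ .s σ = fun b => C.prol ξt ξs η _ σ .s σ b from rfl] at this
  simp only [Calculus.prol, ht, hs, kt, ks, mul_zero, sub_zero] at this
  exact this

end CaseO

section CaseO

variable {R : Type*} [CommRing R] [Algebra ℝ R] {C : Calculus VarO R} {γ : ℝ}
  {ir iρ ξt ξs : R} {η : VarO → R}

/-- The coefficient of a symmetry at `∂_t` depends on `t` only. -/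
theorem IsSymmetryO.kinematics (hγ : γ ≠ 0) (hir : C.v .r * ir = 1) (hiρ : C.v .ρ * iρ = 1)
    (h : IsSymmetryO C (algebraMap ℝ R γ) ir iρ ξt ξs η) :
    (C.d .s ξt = 0 ∧ ∀ a, C.d (.q a) ξt = 0) ∧
    (η .u = C.d .t (η .r) + C.v .u * (C.d (.q .r) (η .r) - C.d .t ξt) ∧
      η .ρ = C.v .ρ * (C.d .s ξs - ir * η .r - C.v .r * C.v .ρ * C.d .s (η .r)
        - C.d (.q .r) (η .r))) ∧
    (C.d (.q .u) (η .θ) = 0 ∧ C.d (.q .u) (η .v) = 0 ∧ C.d (.q .u) (η .p) = 0 ∧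
      C.d (.q .u) (η .Hθ) = 0 ∧ C.d (.q .u) (η .Hz) = 0) := by
  obtain ⟨⟨st, sq⟩, tq, rq⟩ := h.base hir hiρ
  have H := fun u p => h.reduce hir hiρ (sderivO (ir * iρ) 0 u 0 0 p 0 0) rfl
  have ηu : η .u = C.d .t (η .r) + C.v .u * C.d (.q .r) (η .r)
      - C.v .u * (C.d .t ξt + C.v .u * C.d (.q .r) ξt) := by
    have := H 0 0 .r
    simp only [Calculus.tot, VarO.sum_eq, flowO, dflowO, sderivO, rq, ne_eq, reduceCtorEq,
      not_false_eq_true] at this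
    linear_combination -this
  have ηρ : η .ρ = C.v .ρ * (C.d .s ξs - ir * η .r - C.v .r * C.v .ρ * C.d .s (η .r)
      - C.d (.q .r) (η .r) + C.v .r * C.v .ρ * C.v .u * C.d .s ξt + C.v .u * C.d (.q .r) ξt) := by
    have := (h (sderivO (ir * iρ) 0 0 0 0 0 0 0) rfl).1
    simp only [Calculus.prol, Calculus.tot, VarO.sum_eq, flowO, sderivO, rq, tq, sq, ne_eq,
      reduceCtorEq, not_false_eq_true] at this
    linear_combination (C.v .r * C.v .ρ ^ 2) * this -
      (C.v .ρ * (C.v .ρ * iρ) * (C.d (.q .r) (η .r) - C.v .u * C.d (.q .r) ξt - C.d .s ξs)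
        + iρ * C.v .ρ ^ 2 * (ir * η .r + iρ * η .ρ)) * hir -
      (C.v .ρ * (C.d (.q .r) (η .r) - C.v .u * C.d (.q .r) ξt - C.d .s ξs)
        + C.v .ρ * ir * η .r + (C.v .ρ * iρ + 1) * η .ρ) * hiρ
  have uq : ∀ a, a ≠ .r → a ≠ .u → C.d (.q a) (η .u) = 0 := by
    intro a h1 h2
    rw [ηu]
    simp [C.d_v, C.d_comm_zero (rq a h1), C.d_comm_zero (tq a h1), h2]
  -- `D` is the total s-derivative of `ξt`, because `ξt` depends on `r` as the only dependent
  -- variable.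
  set D := C.d .s ξt + ir * iρ * C.d (.q .r) ξt with hD
  have ep := fun u p => H u p .p
  have eh := fun u p => H u p .Hθ
  have ek := fun u p => H u p .Hz
  have eu := fun u p => H u p .u
  have eθ := fun u p => H u p .θ
  have ev := fun u p => H u p .v
  simp only [Calculus.tot, VarO.sum_eq, flowO, dflowO, sderivO, uq, ne_eq, reduceCtorEq,
    not_false_eq_true] at ep eh ek eu eθ ev
  -- The derivative `p_s` enters these equations through `u_t`, so its coefficient shows the
  -- dependence of each `η` on `u`.
  have pu : C.d (.q .u) (η .p) = algebraMap ℝ R γ * C.v .p * C.v .ρ * C.v .r * D :=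
    sub_eq_zero.1 <| C.cancel (.q .r) _ (by linear_combination ep 0 0 - ep 0 1)
  have hu : C.d (.q .u) (η .Hθ) = C.v .r * C.v .ρ * C.v .Hθ * D :=
    sub_eq_zero.1 <| C.cancel (.q .r) _ (by linear_combination eh 0 0 - eh 0 1)
  have ku : C.d (.q .u) (η .Hz) = C.v .r * C.v .ρ * C.v .Hz * D :=
    sub_eq_zero.1 <| C.cancel (.q .r) _ (by linear_combination ek 0 0 - ek 0 1)
  have θu : C.d (.q .u) (η .θ) = 0 :=
    C.cancel (.q .r) _ (by linear_combination eθ 0 0 - eθ 0 1)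
  have vu : C.d (.q .u) (η .v) = 0 :=
    C.cancel (.q .r) _ (by linear_combination ev 0 0 - ev 0 1)
  rw [pu, hu, ku] at eu
  -- The coefficient of `u_s` in the momentum equation. The second factor is `ρ` times the squared
  -- magnetosonic speed; as `D` is free of `p`, its `p`-derivative gives `γ D = 0`.
  have e1 : D * (algebraMap ℝ R γ * C.v .p + C.v .Hθ ^ 2 + C.v .Hz ^ 2) = 0 := by
    refine C.cancel (.q .r) _ (C.cancel (.q .r) _ (C.cancel (.q .ρ) _
      (Calculus.cancel_const (c := 2) (by simp) ?_)))
    rw [map_ofNat]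
    linear_combination eu 1 0 - eu 0 0
  have Dp : C.d (.q .p) D = 0 := by
    simp [hD, C.d_inv hir, C.d_inv hiρ, C.d_comm_zero (tq .p (by decide))]
  have D0 : D = 0 := Calculus.cancel_const hγ (by
    have e2 := congrArg (C.d (.q .p)) e1
    simp [C.d_v, Dp] at e2
    linear_combination e2)
  have tr : C.d (.q .r) ξt = 0 := by
    have e2 := congrArg (C.d (.q .ρ)) (hD.symm.trans D0)
    simp [C.d_inv hir, C.d_inv hiρ, C.d_comm_zero (tq .ρ (by decide))] at e2
    linear_combination (C.v .r * C.v .ρ ^ 2) * e2 - C.d (.q .r) ξt * C.v .ρ ^ 2 * iρ ^ 2 * hir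
      - C.d (.q .r) ξt * (C.v .ρ * iρ + 1) * hiρ
  have ts : C.d .s ξt = 0 := by
    have e2 := hD.symm.trans D0
    rw [tr] at e2
    simpa using e2
  rw [D0, mul_zero] at pu hu ku
  rw [tr] at ηu
  rw [tr, ts] at ηρ
  refine ⟨⟨ts, fun a => ?_⟩, ⟨?_, ?_⟩, θu, vu, pu, hu, ku⟩
  · by_cases ha : a = .r
    · rw [ha, tr]
    · exact tq a ha
  · rw [ηu]; ring
  · rw [ηρ]; ring

end CaseO

section CaseO

variable {R : Type*} [CommRing R] [Algebra ℝ R]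

/-- The derivation `ρ ∂_ρ + γ p ∂_p + H^θ ∂_{H^θ} + H^z ∂_{H^z}`, the direction in which `u_s` moves
the thermodynamic and magnetic variables. -/
def Calculus.scaleO (C : Calculus VarO R) (γ : ℝ) : Derivation ℝ R R :=
  C.v .ρ • C.d (.q .ρ) + (algebraMap ℝ R γ * C.v .p) • C.d (.q .p) + C.v .Hθ • C.d (.q .Hθ)
    + C.v .Hz • C.d (.q .Hz)

variable {C : Calculus VarO R} {γ : ℝ} {ir iρ ξt ξs : R} {η : VarO → R}

theorem Calculus.scaleO_apply (f : R) : C.scaleO γ f = C.v .ρ * C.d (.q .ρ) f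
    + algebraMap ℝ R γ * C.v .p * C.d (.q .p) f + C.v .Hθ * C.d (.q .Hθ) f
    + C.v .Hz * C.d (.q .Hz) f := rfl

/-- Coefficients of the determining equations at the derivatives with respect to `s`. -/
theorem IsSymmetryO.transport_coefficients (hγ : γ ≠ 0) (hir : C.v .r * ir = 1)
    (hiρ : C.v .ρ * iρ = 1)
    (h : IsSymmetryO C (algebraMap ℝ R γ) ir iρ ξt ξs η) :
    (C.scaleO γ (η .θ) = 0 ∧ C.scaleO γ (η .v) = 0 ∧
      C.scaleO γ (η .p) = algebraMap ℝ R γ * (η .p - C.v .p * C.v .r * C.v .ρ * C.d .s (η .r)) ∧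
      C.scaleO γ (η .Hθ) = η .Hθ - C.v .r * C.v .ρ * C.v .Hθ * C.d .s (η .r) ∧
      C.scaleO γ (η .Hz) = η .Hz - C.v .r * C.v .ρ * C.v .Hz * C.d .s (η .r)) ∧
    ∀ K Q, K = C.d (.q .r) (η .r) - 2 * C.d .t ξt - ir * η .r + C.d .s ξs →
      Q = η .p + C.v .Hθ * η .Hθ + C.v .Hz * η .Hz →
      C.d (.q .p) Q = K ∧ C.d (.q .Hθ) Q = C.v .Hθ * K ∧ C.d (.q .Hz) Q = C.v .Hz * K ∧
      C.d (.q .θ) Q = 0 ∧ C.d (.q .v) Q = 0 ∧ C.d (.q .ρ) Q = 0 ∧ C.d (.q .u) Q = 0 := by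
  obtain ⟨⟨st, sq⟩, -, rq⟩ := h.base hir hiρ
  obtain ⟨⟨ts, tq⟩, ⟨ηu, ηρ⟩, θu, vu, pu, hu, ku⟩ := h.kinematics hγ hir hiρ
  have H := fun θ u v ρ p k l => h.reduce hir hiρ (sderivO (ir * iρ) θ u v ρ p k l) rfl
  simp only [ts, tq, mul_zero, add_zero, sub_zero] at H
  have uu : C.d (.q .u) (η .u) = C.d (.q .r) (η .r) - C.d .t ξt := by
    rw [ηu]
    simp [C.d_v, C.d_comm_zero (rq .u (by decide)), C.d_comm_zero (tq .u)]
  have uq : ∀ a, a ≠ .r → a ≠ .u → C.d (.q a) (η .u) = 0 := by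
    intro a h1 h2
    rw [ηu]
    simp [C.d_v, C.d_comm_zero (rq a h1), C.d_comm_zero (tq a), h2]
  -- In the equations for `θ, v, p, Hθ, Hz` the coefficient of `u_s` is extracted, which produces
  -- `scaleO`. In the momentum equation `u_s` is set to 0 and the other s-derivatives expose the
  -- gradient of `Q`.
  have eθ := fun u => H 0 u 0 0 0 0 0 .θ
  have ev := fun u => H 0 u 0 0 0 0 0 .v
  have ep := fun u => H 0 u 0 0 0 0 0 .p
  have eh := fun u => H 0 u 0 0 0 0 0 .Hθ
  have ek := fun u => H 0 u 0 0 0 0 0 .Hz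
  have eu := fun θ v ρ p k l => H θ 0 v ρ p k l .u
  simp only [Calculus.tot, VarO.sum_eq, flowO, dflowO, sderivO, uq, uu, θu, vu, pu, hu, ku, ηρ,
    ne_eq, reduceCtorEq, not_false_eq_true] at eθ ev ep eh ek eu
  clear H
  have cr : ∀ f g : R, C.v .r * (f - g) = 0 → f = g := fun f g hf =>
    sub_eq_zero.1 (C.cancel (.q .r) _ hf)
  have crρ : ∀ f g : R, C.v .r * (C.v .ρ * (f - g)) = 0 → f = g := fun f g hf =>
    sub_eq_zero.1 (C.cancel (.q .ρ) _ (C.cancel (.q .r) _ hf))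
  refine ⟨⟨crρ _ _ ?_, crρ _ _ ?_, crρ _ _ ?_, crρ _ _ ?_, crρ _ _ ?_⟩, ?_⟩
  · rw [C.scaleO_apply]
    linear_combination eθ 0 - eθ 1
  · rw [C.scaleO_apply]
    linear_combination ev 0 - ev 1
  · rw [C.scaleO_apply]
    linear_combination ep 0 - ep 1
      - algebraMap ℝ R γ * C.v .p * C.v .ρ * η .r * hir
  · rw [C.scaleO_apply]
    linear_combination eh 0 - eh 1 - C.v .Hθ * C.v .ρ * η .r * hir
  · rw [C.scaleO_apply]
    linear_combination ek 0 - ek 1 - C.v .Hz * C.v .ρ * η .r * hir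
  · rintro K Q rfl rfl
    simp [C.d_v, pu, hu, ku]
    refine ⟨cr _ _ ?_, cr _ _ ?_, cr _ _ ?_, cr _ _ ?_, cr _ _ ?_, cr _ _ ?_⟩
    · linear_combination eu 0 0 0 1 0 0 - eu 0 0 0 0 0 0 + η .r * hir
    · linear_combination eu 0 0 0 0 1 0 - eu 0 0 0 0 0 0 + C.v .Hθ * η .r * hir
    · linear_combination eu 0 0 0 0 0 1 - eu 0 0 0 0 0 0 + C.v .Hz * η .r * hir
    · linear_combination eu 1 0 0 0 0 0 - eu 0 0 0 0 0 0
    · linear_combination eu 0 1 0 0 0 0 - eu 0 0 0 0 0 0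
    · linear_combination eu 0 0 1 0 0 0 - eu 0 0 0 0 0 0

end CaseO

section CaseO

variable {R : Type*} [CommRing R] [Algebra ℝ R] {C : Calculus VarO R} {γ : ℝ}
  {ir iρ ξt ξs : R} {η : VarO → R}

/-- The perturbation of the total pressure. -/
theorem IsSymmetryO.total_pressure (hγ : 1 < γ) (hir : C.v .r * ir = 1) (hiρ : C.v .ρ * iρ = 1)
    (h : IsSymmetryO C (algebraMap ℝ R γ) ir iρ ξt ξs η) :
    C.d .s (η .r) = 0 ∧
    ∀ K, K = C.d (.q .r) (η .r) - 2 * C.d .t ξt - ir * η .r + C.d .s ξs →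
      2 * (η .p + C.v .Hθ * η .Hθ + C.v .Hz * η .Hz) =
        K * (2 * C.v .p + C.v .Hθ ^ 2 + C.v .Hz ^ 2) ∧
      (algebraMap ℝ R γ - 2) * (η .p - K * C.v .p) = 0 := by
  obtain ⟨⟨st, sq⟩, -, rq⟩ := h.base hir hiρ
  have hγ0 : γ ≠ 0 := by positivity
  obtain ⟨⟨ts, tq⟩, -, -⟩ := h.kinematics hγ0 hir hiρ
  obtain ⟨⟨-, -, Ep, Eh, Ek⟩, hQ⟩ := h.transport_coefficients hγ0 hir hiρ
  obtain ⟨K, hK⟩ : ∃ K, K = C.d (.q .r) (η .r) - 2 * C.d .t ξt - ir * η .r + C.d .s ξs := ⟨_, rfl⟩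
  obtain ⟨Q, hQ'⟩ : ∃ Q, Q = η .p + C.v .Hθ * η .Hθ + C.v .Hz * η .Hz := ⟨_, rfl⟩
  obtain ⟨Qp, Qh, Qk, -, -, Qρ, -⟩ := hQ K Q hK hQ'
  have Kq : ∀ a, a ≠ .r → C.d (.q a) K = 0 := fun a ha => by
    rw [hK]
    simp [C.d_inv hir, C.d_comm_zero (rq a ha), C.d_comm_zero (tq a), C.d_comm_zero (sq a), rq a ha,
      ha, C.d_two]
  have lq : ∀ a, a ≠ .r → C.d (.q a) (C.d .s (η .r)) = 0 := fun a ha => C.d_comm_zero (rq a ha)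
  have Eh' : C.scaleO γ (C.v .Hθ) = C.v .Hθ := by simp [C.scaleO_apply, C.d_v]
  have Ek' : C.scaleO γ (C.v .Hz) = C.v .Hz := by simp [C.scaleO_apply, C.d_v]
  -- `scaleO γ Q` computed in two ways: from the scaling of each `η`, and from the gradient of `Q`.
  have e : (algebraMap ℝ R γ - 2) * η .p + 2 * Q = (K + C.v .r * C.v .ρ * C.d .s (η .r)) *
      (algebraMap ℝ R γ * C.v .p + C.v .Hθ ^ 2 + C.v .Hz ^ 2) := by
    have e1 := congrArg (C.scaleO γ) hQ'
    simp only [map_add, Derivation.leibniz, smul_eq_mul, Ep, Eh, Ek, Eh', Ek'] at e1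
    rw [C.scaleO_apply, Qp, Qh, Qk, Qρ] at e1
    linear_combination -e1 + 2 * hQ'
  have hpp := congrArg (C.d (.q .p)) e
  have hph := congrArg (C.d (.q .Hθ)) e
  have hpk := congrArg (C.d (.q .Hz)) e
  have hpρ := congrArg (C.d (.q .ρ)) e
  simp [C.d_v, C.d_two, Kq, lq, Qp, Qh, Qk, Qρ] at hpp hph hpk hpρ
  -- `scaleO` applied to `e`, assembled from its four partial derivatives. The `p`-derivative of
  -- `e2` leaves `γ (γ - 1)` times `r ρ ∂_s η r`, which vanishes as `γ > 1`.
  have e2 : algebraMap ℝ R γ * (2 * Q - K * (2 * C.v .p + C.v .Hθ ^ 2 + C.v .Hz ^ 2))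
      + C.v .r * C.v .ρ * C.d .s (η .r) * ((algebraMap ℝ R γ ^ 2 - algebraMap ℝ R γ) * C.v .p
        + (3 - algebraMap ℝ R γ) * (C.v .Hθ ^ 2 + C.v .Hz ^ 2)) = 0 := by
    rw [C.scaleO_apply] at Ep
    linear_combination (algebraMap ℝ R γ - 2) * Ep - C.v .ρ * hpρ
      - algebraMap ℝ R γ * C.v .p * hpp - C.v .Hθ * hph - C.v .Hz * hpk
      + algebraMap ℝ R γ * e
  have l0 : C.d .s (η .r) = 0 := by
    have e3 := congrArg (C.d (.q .p)) e2
    have three : C.d (.q .p) 3 = 0 := by simpa using (C.d (.q .p)).map_natCast 3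
    simp [three, C.d_v, C.d_two, Kq, lq, Qp] at e3
    refine C.cancel (.q .r) _ (C.cancel (.q .ρ) _ (Calculus.cancel_const hγ0
      (Calculus.cancel_const (c := γ - 1) (by linarith) ?_)))
    rw [map_sub, map_one]
    linear_combination e3
  rw [l0] at e e2
  have e4 : 2 * Q = K * (2 * C.v .p + C.v .Hθ ^ 2 + C.v .Hz ^ 2) :=
    sub_eq_zero.1 (Calculus.cancel_const hγ0 (by linear_combination e2))
  refine ⟨l0, fun K' h' => ?_⟩
  rw [← hK] at h'
  subst h'
  rw [← hQ']
  exact ⟨e4, by linear_combination e - e4⟩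

end CaseO

section CaseO

variable {R : Type*} [CommRing R] [Algebra ℝ R] {C : Calculus VarO R} {γ : ℝ}
  {ir iρ ξt ξs : R} {η : VarO → R}

/-- Consequences of the momentum equation. -/
theorem IsSymmetryO.momentum (hγ : 1 < γ) (hir : C.v .r * ir = 1) (hiρ : C.v .ρ * iρ = 1)
    (h : IsSymmetryO C (algebraMap ℝ R γ) ir iρ ξt ξs η) :
    ∃ m n : R, η .r = C.v .r * m + n ∧ (∀ a, C.d (.q a) m = 0) ∧ (∀ a, C.d (.q a) n = 0) ∧
      C.d .s m = 0 ∧ C.d .s n = 0 ∧ C.d .s (C.d .s ξs) = 0 ∧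
      2 * C.d .t m = C.d .t (C.d .t ξt) ∧
      2 * C.v .v * η .v = C.v .r * (C.v .r * C.d .t (C.d .t m) + C.d .t (C.d .t n))
        + C.v .v ^ 2 * (2 * m - 2 * C.d .t ξt + ir * n) ∧
      4 * C.v .Hθ * η .Hθ = 2 * C.v .Hθ ^ 2 * (C.d .s ξs - 2 * C.d .t ξt)
        - ir * n * (2 * (algebraMap ℝ R γ - 1) * C.v .p + C.v .Hθ ^ 2 + C.v .Hz ^ 2) := by
  obtain ⟨⟨st, sq⟩, -, rq⟩ := h.base hir hiρ
  have hγ0 : γ ≠ 0 := by positivity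
  obtain ⟨⟨ts, tq⟩, ⟨ηu, ηρ⟩, θu, vu, pu, hu, ku⟩ := h.kinematics hγ0 hir hiρ
  obtain ⟨⟨-, Ev, -, Eh, -⟩, hQ⟩ := h.transport_coefficients hγ0 hir hiρ
  obtain ⟨rs, hK⟩ := h.total_pressure hγ hir hiρ
  obtain ⟨K, hK'⟩ : ∃ K, K = C.d (.q .r) (η .r) - 2 * C.d .t ξt - ir * η .r + C.d .s ξs := ⟨_, rfl⟩
  obtain ⟨hQ, -⟩ := hK K hK'
  obtain ⟨m, hm⟩ : ∃ m, C.d (.q .r) (η .r) = m := ⟨_, rfl⟩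
  rw [hm] at ηu ηρ hK'
  rw [rs] at ηρ Eh
  have mq : ∀ a, a ≠ .r → C.d (.q a) m = 0 := fun a ha => by
    rw [← hm]; exact C.d_comm_zero (rq a ha)
  have ms : C.d .s m = 0 := by rw [← hm]; exact C.d_comm_zero rs
  have mt : C.d (.q .r) (C.d .t (η .r)) = C.d .t m := by rw [C.comm, hm]
  have uu : C.d (.q .u) (η .u) = m - C.d .t ξt := by
    rw [ηu]
    simp [C.d_v, C.d_comm_zero (rq .u (by decide)), C.d_comm_zero (tq .u), mq]
  have uq : ∀ a, a ≠ .r → a ≠ .u → C.d (.q a) (η .u) = 0 := by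
    intro a h1 h2
    rw [ηu]
    simp [C.d_v, C.d_comm_zero (rq a h1), C.d_comm_zero (tq a), h2, mq a h1]
  have ut : C.d .t (η .u) = C.d .t (C.d .t (η .r)) + C.v .u * (C.d .t m - C.d .t (C.d .t ξt)) := by
    rw [ηu]; simp [C.d_v]
  have ur : C.d (.q .r) (η .u) = C.d .t m + C.v .u * C.d (.q .r) m := by
    rw [ηu]; simp [C.d_v, mt, C.d_comm_zero (tq .r)]
  have Qs := congrArg (C.d .s) hQ
  have Qr := congrArg (C.d (.q .r)) hQ
  simp [hK', C.d_v, C.d_two, ms, C.d_comm_zero ts, C.d_inv hir, rs, hm, C.d_comm_zero (tq .r),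
    C.d_comm_zero (sq .r)] at Qs Qr
  have F := h.reduce hir hiρ (sderivO (ir * iρ) 0 0 0 0 0 0 0) rfl .u
  simp only [Calculus.tot, VarO.sum_eq, flowO, dflowO, sderivO, tq, ts, ut, ur, uu, uq, ηρ, ne_eq,
    reduceCtorEq, not_false_eq_true] at F
  obtain ⟨P, hP⟩ : ∃ P, P = 2 * C.v .p + C.v .Hθ ^ 2 + C.v .Hz ^ 2 := ⟨_, rfl⟩
  -- The momentum equation times `2r`, with the derivatives of `Q` in `s` and `r` eliminated by the
  -- total pressure identity.
  replace F : 2 * C.v .r * (C.d .t (C.d .t (η .r)) + C.v .u * (C.d .t m - C.d .t (C.d .t ξt))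
        + C.v .u * (C.d .t m + C.v .u * C.d (.q .r) m))
      + 2 * (C.v .v ^ 2 - C.v .Hθ ^ 2 * iρ) * (m - 2 * C.d .t ξt)
      - 4 * C.v .v * η .v + 2 * C.v .v ^ 2 * ir * η .r + 4 * C.v .Hθ * η .Hθ * iρ
      - 2 * C.v .Hθ ^ 2 * iρ * (C.d .s ξs - m) + C.v .r ^ 2 * C.d .s (C.d .s ξs) * P
      + C.v .r * iρ * (C.d (.q .r) m + ir ^ 2 * η .r - ir * m) * P = 0 := by
    linear_combination 2 * C.v .r * F - C.v .r ^ 2 * Qs - C.v .r ^ 2 * (ir * iρ) * Qr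
      + C.v .r ^ 2 * (C.d .s (C.d .s ξs) + ir * iρ * (C.d (.q .r) m + ir ^ 2 * η .r - ir * m)) * hP
      + (4 * C.v .v * η .v - 2 * C.v .v ^ 2 * (m - 2 * C.d .t ξt + ir * η .r)
        - 4 * C.v .Hθ * iρ * η .Hθ + C.v .Hθ ^ 2 * iρ * (2 * C.d .s ξs - 4 * C.d .t ξt)
        - C.v .r * iρ * (C.d (.q .r) m + ir ^ 2 * η .r - ir * m) * P) * hir
      + C.v .r * C.v .Hθ ^ 2 * iρ * ir * (2 * C.d .s ξs - 2 * m - 2 * ir * η .r) * hiρ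
  have two : ∀ f g : R, 2 * (f - g) = 0 → f = g := fun f g hf =>
    sub_eq_zero.1 (Calculus.cancel_const (c := 2) (by simp) (by rwa [map_ofNat]))
  have Fu := congrArg (C.d (.q .u)) F
  have four : ∀ i, C.d i 4 = 0 := fun i => by simpa using (C.d i).map_natCast 4
  have Pu : C.d (.q .u) P = 0 := by simp [hP, C.d_v, C.d_two]
  have du : ∀ i f, C.d (.q .u) f = 0 → C.d (.q .u) (C.d i f) = 0 := fun i f => C.d_comm_zero
  simp only [map_add, map_sub, Derivation.leibniz, Derivation.leibniz_pow, smul_eq_mul, C.d_v,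
    C.d_two, four, C.d_inv hir, C.d_inv hiρ, vu, hu, Pu, mq .u (by decide), rq .u (by decide),
    du, tq .u, sq .u] at Fu
  simp at Fu
  -- The `u`-derivative of `F`; one more derivative in `u` gives `∂_r m = 0`, so `η r` is affine in
  -- `r` with remainder `n`.
  have e1 : 2 * C.d .t m - C.d .t (C.d .t ξt) + 2 * C.v .u * C.d (.q .r) m = 0 := by
    refine sub_eq_zero.1 (two _ _ (C.cancel (.q .r) _ ?_))
    linear_combination Fu
  have mr : C.d (.q .r) m = 0 := two _ _ (by
    have e2 := congrArg (C.d (.q .u)) e1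
    simp [C.d_v, C.d_two, du, tq, mq] at e2
    linear_combination e2)
  rw [mr] at e1 F
  obtain ⟨n, hn⟩ : ∃ n, n = η .r - C.v .r * m := ⟨_, rfl⟩
  have mq' : ∀ a, C.d (.q a) m = 0 := fun a => by
    by_cases ha : a = .r
    · rw [ha, mr]
    · exact mq a ha
  have nq : ∀ a, C.d (.q a) n = 0 := fun a => by
    rw [hn]
    by_cases ha : a = .r
    · simp [ha, C.d_v, hm, mr]
    · simp [C.d_v, ha, mq a ha, rq a ha]
  have ns : C.d .s n = 0 := by rw [hn]; simp [C.d_v, ms, rs]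
  have hrt : C.d .t (C.d .t (η .r)) = C.v .r * C.d .t (C.d .t m) + C.d .t (C.d .t n) := by
    rw [hn]; simp [C.d_v]
  have hr : η .r = C.v .r * m + n := by rw [hn]; ring
  rw [hrt, hr] at F
  replace F : 2 * C.v .r * (C.v .r * C.d .t (C.d .t m) + C.d .t (C.d .t n))
      + 2 * C.v .v ^ 2 * (2 * m - 2 * C.d .t ξt + ir * n) - 4 * (C.v .v * η .v)
      + (4 * (C.v .Hθ * η .Hθ) - 2 * C.v .Hθ ^ 2 * (C.d .s ξs - 2 * C.d .t ξt)) * iρ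
      + C.v .r ^ 2 * C.d .s (C.d .s ξs) * P + ir * n * iρ * P = 0 := by
    linear_combination F - C.v .r * C.v .u * 2 * e1 - (2 * C.v .v ^ 2 * m + ir * n * iρ * P
        + C.v .r * ir * m * iρ * P) * hir
  have E0 : ∀ f, (∀ a, C.d (.q a) f = 0) → C.scaleO γ f = 0 := fun f hf => by
    simp [C.scaleO_apply, hf]
  have dq : ∀ i f, (∀ a, C.d (.q a) f = 0) → ∀ a, C.d (.q a) (C.d i f) = 0 :=
    fun i f hf a => C.d_comm_zero (hf a)
  have Em : C.scaleO γ m = 0 := E0 _ mq'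
  have En : C.scaleO γ n = 0 := E0 _ nq
  have Emt : C.scaleO γ (C.d .t (C.d .t m)) = 0 := E0 _ (dq _ _ (dq _ _ mq'))
  have Ent : C.scaleO γ (C.d .t (C.d .t n)) = 0 := E0 _ (dq _ _ (dq _ _ nq))
  have EB : C.scaleO γ (C.d .t ξt) = 0 := E0 _ (dq _ _ tq)
  have Eb : C.scaleO γ (C.d .s ξs) = 0 := E0 _ (dq _ _ sq)
  have Ebs : C.scaleO γ (C.d .s (C.d .s ξs)) = 0 := E0 _ (dq _ _ (dq _ _ sq))
  have E2 : C.scaleO γ 2 = 0 := by simpa using (C.scaleO γ).map_natCast 2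
  have E4 : C.scaleO γ 4 = 0 := by simpa using (C.scaleO γ).map_natCast 4
  have Ev' : C.scaleO γ (C.v .v) = 0 := by simp [C.scaleO_apply, C.d_v]
  have Er' : C.scaleO γ (C.v .r) = 0 := by simp [C.scaleO_apply, C.d_v]
  have Ep' : C.scaleO γ (C.v .p) = algebraMap ℝ R γ * C.v .p := by simp [C.scaleO_apply, C.d_v]
  have Eh' : C.scaleO γ (C.v .Hθ) = C.v .Hθ := by simp [C.scaleO_apply, C.d_v]
  have Ek' : C.scaleO γ (C.v .Hz) = C.v .Hz := by simp [C.scaleO_apply, C.d_v]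
  have Eir : C.scaleO γ ir = 0 := by simp [C.scaleO_apply, C.d_inv hir]
  have Eiρ : C.scaleO γ iρ = -iρ := by
    simp [C.scaleO_apply, C.d_inv hiρ]; linear_combination iρ * hiρ
  have EP : C.scaleO γ P = 2 * algebraMap ℝ R γ * C.v .p + 2 * C.v .Hθ ^ 2 + 2 * C.v .Hz ^ 2 := by
    rw [hP]; simp [E2, Ep', Eh', Ek']; ring
  -- `F` is a sum of eigenvectors of `scaleO`: weight 0 for the terms with `r`, `v` and `η v`,
  -- weight 1 for those with `Hθ η Hθ / ρ`, and weights depending on `γ` for terms with `p`. `F2 = F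
  -- - F1` removes weight 1, and `F3` then removes weight 0.
  have F1 := congrArg (C.scaleO γ) F
  simp [E2, E4, Em, En, Emt, Ent, EB, Eb, Ebs, Ev', Er', Eh', Eir, Eiρ, EP, Ev, Eh] at F1
  have F2 : 2 * C.v .r * (C.v .r * C.d .t (C.d .t m) + C.d .t (C.d .t n))
      + 2 * C.v .v ^ 2 * (2 * m - 2 * C.d .t ξt + ir * n) - 4 * (C.v .v * η .v)
      + C.v .r ^ 2 * C.d .s (C.d .s ξs) * (2 * (1 - algebraMap ℝ R γ) * C.v .p
        - C.v .Hθ ^ 2 - C.v .Hz ^ 2)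
      + 2 * (2 - algebraMap ℝ R γ) * (ir * n * iρ * C.v .p) = 0 := by
    linear_combination F - F1 - (C.v .r ^ 2 * C.d .s (C.d .s ξs) + 2 * (ir * n * iρ)) * hP
  have F3 := congrArg (C.scaleO γ) F2
  have Eγ : C.scaleO γ (algebraMap ℝ R γ) = 0 := Derivation.map_algebraMap _ _
  simp [E2, E4, Em, En, Emt, Ent, EB, Ebs, Ev', Er', Ep', Eh', Ek', Eir, Eiρ, Ev, Eγ] at F3
  have bs : C.d .s (C.d .s ξs) = 0 := by
    have F4 := congrArg (C.d (.q .Hz)) F3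
    simp [C.d_v, C.d_two, C.d_inv hir, C.d_inv hiρ, nq, dq _ _ (dq _ _ sq)] at F4
    refine C.cancel (.q .r) _ (C.cancel (.q .r) _ (C.cancel (.q .Hz) _
      (Calculus.cancel_const (c := 4) (by simp) ?_)))
    rw [map_ofNat]
    linear_combination F4
  rw [bs] at F1 F2 F3
  -- For `γ = 2` this leaves `n` undetermined; the `v` equation removes it later.
  have hn2 : (2 - algebraMap ℝ R γ) * n = 0 := by
    refine C.cancel (.q .p) _ (Calculus.cancel_const (c := γ - 1) (by linarith)
      (Calculus.cancel_const (c := 2) (by simp) ?_))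
    rw [map_ofNat, map_sub, map_one]
    linear_combination C.v .r * C.v .ρ * F3 - 2 * (algebraMap ℝ R γ - 1) * C.v .p
      * ((2 - algebraMap ℝ R γ) * n) * (C.v .ρ * iρ * hir + hiρ)
  refine ⟨m, n, hr, mq', nq, ms, ns, bs, ?_, two _ _ ?_, ?_⟩
  · linear_combination e1
  · linear_combination -F2 + 2 * ir * iρ * C.v .p * hn2
  · linear_combination C.v .ρ * F1 + (2 * C.v .Hθ ^ 2 * (C.d .s ξs - 2 * C.d .t ξt)
      - 4 * C.v .Hθ * η .Hθ
      - ir * n * (2 * (algebraMap ℝ R γ - 1) * C.v .p + C.v .Hθ ^ 2 + C.v .Hz ^ 2)) * hiρ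
      + ir * n * C.v .ρ * iρ * hP

end CaseO

section CaseO

variable {R : Type*} [CommRing R] [Algebra ℝ R] {C : Calculus VarO R} {γ : ℝ}
  {ir iρ ξt ξs : R} {η : VarO → R}

/-- Consequences of the equations for `v` and `H^θ`. -/
theorem IsSymmetryO.velocity (hγ : 1 < γ) (hir : C.v .r * ir = 1) (hiρ : C.v .ρ * iρ = 1)
    (h : IsSymmetryO C (algebraMap ℝ R γ) ir iρ ξt ξs η) :
    ∃ m : R, (∀ i, C.d i m = 0) ∧ (∀ i, C.d i (C.d .t ξt) = 0) ∧ (∀ i, C.d i (C.d .s ξs) = 0) ∧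
      η .r = C.v .r * m ∧ η .v = C.v .v * (m - C.d .t ξt) ∧
      2 * η .Hθ = C.v .Hθ * (C.d .s ξs - 2 * C.d .t ξt) := by
  obtain ⟨⟨st, sq⟩, -, rq⟩ := h.base hir hiρ
  have hγ0 : γ ≠ 0 := by positivity
  obtain ⟨⟨ts, tq⟩, ⟨ηu, -⟩, θu, vu, pu, hu, ku⟩ := h.kinematics hγ0 hir hiρ
  obtain ⟨⟨-, Ev, -, Eh, -⟩, -⟩ := h.transport_coefficients hγ0 hir hiρ
  obtain ⟨m, n, hr, mq, nq, ms, ns, bs, mt, hv, hh⟩ := h.momentum hγ hir hiρ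
  have two : ∀ f g : R, 2 * (f - g) = 0 → f = g := fun f g hf =>
    sub_eq_zero.1 (Calculus.cancel_const (c := 2) (by simp) (by rwa [map_ofNat]))
  have dq : ∀ i f, (∀ a, C.d (.q a) f = 0) → ∀ a, C.d (.q a) (C.d i f) = 0 :=
    fun i f hf a => C.d_comm_zero (hf a)
  have ηu' : η .u = C.v .r * C.d .t m + C.d .t n + C.v .u * (m - C.d .t ξt) := by
    rw [ηu, hr]
    simp [C.d_v, mq, nq]
  have d0 : ∀ a, a ≠ .r → a ≠ .v → C.d (.q a) (η .v) = 0 := fun a h1 h2 => by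
    have e := congrArg (C.d (.q a)) hv
    simp [C.d_v, C.d_two, C.d_inv hir, h1, h2, dq _ _ (dq _ _ mq), dq _ _ (dq _ _ nq), mq, nq,
      dq _ _ tq] at e
    exact C.cancel (.q .v) _ (Calculus.cancel_const (c := 2) (by simp) (by
      rw [map_ofNat]; linear_combination e))
  have F := h.reduce hir hiρ (sderivO (ir * iρ) 0 0 0 0 0 0 0) rfl .v
  have vt := congrArg (C.d .t) hv
  have vr := congrArg (C.d (.q .r)) hv
  have vv := congrArg (C.d (.q .v)) hv
  simp [C.d_v, C.d_two, C.d_inv hir, dq _ _ (dq _ _ mq), dq _ _ (dq _ _ nq), mq, nq,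
    dq _ _ tq] at vt vr vv
  simp [Calculus.tot, VarO.sum_eq, flowO, dflowO, sderivO, tq, d0, hr, ηu'] at F
  -- The `v` equation with `η v` eliminated through its formula `hv`. As `m` and `n` depend on no
  -- dependent variable, `G` is an explicit polynomial in `u`, `v`, and `1/r`.
  have G : C.v .r * C.d .t (C.d .t (C.d .t m)) + C.d .t (C.d .t (C.d .t n))
      + C.v .v ^ 2 * ir ^ 2 * (3 * C.d .t n) + C.v .u * (4 * C.d .t (C.d .t m)
        + 3 * ir * C.d .t (C.d .t n) - 3 * C.v .v ^ 2 * ir ^ 3 * n) = 0 := by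
    linear_combination 2 * ir * C.v .v * F - ir * vt - ir * C.v .u * vr
      - 2 * C.v .v ^ 2 * ir * mt + C.v .v * ir ^ 2 * C.v .u * vv - 2 * ir ^ 2 * C.v .u * hv
      - (C.v .r * C.d .t (C.d .t (C.d .t m))
        + C.d .t (C.d .t (C.d .t n)) + 2 * C.v .v ^ 2 * ir * C.d .t m
        - 2 * C.v .v ^ 2 * ir ^ 2 * C.v .u * m
        + 2 * C.v .u * C.d .t (C.d .t m) * (C.v .r * ir + 2)
        + 2 * ir * C.v .u * C.d .t (C.d .t n)) * hir
  -- The coefficient of `u v²` in `G` is `-3 n / r³`. The coefficient of `u` then gives `∂_t ∂_t m =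
  -- 0`.
  have n0 : n = 0 := by
    have three : ∀ i, C.d i 3 = 0 := fun i => by simpa using (C.d i).map_natCast 3
    have four : ∀ i, C.d i 4 = 0 := fun i => by simpa using (C.d i).map_natCast 4
    have G1 := congrArg (C.d (.q .u)) G
    simp [three, four, C.d_v, C.d_inv hir, dq _ _ (dq _ _ mq), dq _ _ (dq _ _ nq),
      dq _ _ (dq _ _ (dq _ _ mq)), dq _ _ (dq _ _ (dq _ _ nq)), dq _ _ nq, nq] at G1
    have G2 := congrArg (C.d (.q .v)) G1
    simp [three, four, C.d_v, C.d_inv hir, dq _ _ (dq _ _ mq), dq _ _ (dq _ _ nq), nq] at G2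
    refine C.cancel (.q .v) _ (Calculus.cancel_const (c := 6) (by simp) ?_)
    rw [map_ofNat]
    linear_combination C.v .r ^ 3 * G2
      - 6 * C.v .v * n * (C.v .r ^ 2 * ir ^ 2 + C.v .r * ir + 1) * hir
  rw [n0] at hr hv hh G
  simp only [map_zero, mul_zero, add_zero, sub_zero] at hr hv hh G
  have mtt : C.d .t (C.d .t m) = 0 := by
    have four : ∀ i, C.d i 4 = 0 := fun i => by simpa using (C.d i).map_natCast 4
    have G1 := congrArg (C.d (.q .u)) G
    simp [four, C.d_v, dq _ _ (dq _ _ mq), dq _ _ (dq _ _ (dq _ _ mq))] at G1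
    exact Calculus.cancel_const (c := 4) (by simp) (by rw [map_ofNat]; exact G1)
  rw [mtt] at hv
  have ev : η .v = C.v .v * (m - C.d .t ξt) := two _ _ <| sub_eq_zero.1 (C.cancel (.q .v) _ (by
    linear_combination hv))
  have eh : 2 * η .Hθ = C.v .Hθ * (C.d .s ξs - 2 * C.d .t ξt) := two _ _ <|
    sub_eq_zero.1 (C.cancel (.q .Hθ) _ (by linear_combination hh))
  have ht := congrArg (C.d .t) eh
  simp [C.d_two, C.d_v, C.d_comm_zero st] at ht
  have hq : ∀ a, a ≠ .Hθ → C.d (.q a) (η .Hθ) = 0 := fun a ha => two _ _ (by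
    have e := congrArg (C.d (.q a)) eh
    simp [C.d_two, C.d_v, dq _ _ sq, dq _ _ tq, ha] at e
    linear_combination e)
  have us : C.d .s (η .u) = 0 := by
    rw [ηu', n0]
    simp [C.d_v, C.d_comm_zero ms, ms, C.d_comm_zero ts]
  have ur : C.d (.q .r) (η .u) = C.d .t m := by
    rw [ηu', n0]
    simp [C.d_v, dq _ _ mq, mq, dq _ _ tq]
  have uq : ∀ a, a ≠ .r → a ≠ .u → C.d (.q a) (η .u) = 0 := fun a h1 h2 => by
    rw [ηu', n0]
    simp [C.d_v, dq _ _ mq, mq, dq _ _ tq, h1, h2]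
  -- With `η Hθ` known, the `Hθ` equation contradicts `2 ∂_t m = ∂_t ∂_t ξt` unless `∂_t m = 0`;
  -- this rules out projective transformations of time.
  have E := h.reduce hir hiρ (sderivO (ir * iρ) 0 0 0 0 0 0 0) rfl .Hθ
  simp [Calculus.tot, VarO.sum_eq, flowO, dflowO, sderivO, tq, ts, hq, us, ur, uq] at E
  have mt0 : C.d .t m = 0 := C.cancel (.q .Hθ) _ (Calculus.cancel_const (c := 2) (by simp) (by
    rw [map_ofNat]
    linear_combination ht - 2 * E + 2 * C.v .Hθ * mt
      + 2 * C.v .Hθ * C.d .t m * (C.v .ρ * iρ * hir + hiρ)))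
  rw [mt0, mul_zero] at mt
  refine ⟨m, ?_, ?_, ?_, hr, ev, eh⟩
  · rintro (_ | _ | a)
    exacts [mt0, ms, mq a]
  · rintro (_ | _ | a)
    exacts [mt.symm, C.d_comm_zero ts, dq _ _ tq a]
  · rintro (_ | _ | a)
    exacts [C.d_comm_zero st, bs, dq _ _ sq a]

end CaseO

section CaseO

variable {R : Type*} [CommRing R] [Algebra ℝ R]

/-- The derivation `r ∂_r - v ∂_v + H^θ ∂_{H^θ}`. -/
def Calculus.rotO (C : Calculus VarO R) : Derivation ℝ R R :=
  C.v .r • C.d (.q .r) - C.v .v • C.d (.q .v) + C.v .Hθ • C.d (.q .Hθ)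

variable {C : Calculus VarO R} {γ : ℝ} {ir iρ ξt ξs : R} {η : VarO → R}

theorem Calculus.rotO_apply (f : R) : C.rotO f = C.v .r * C.d (.q .r) f
    - C.v .v * C.d (.q .v) f + C.v .Hθ * C.d (.q .Hθ) f := rfl

/-- Functions that are constant along the particle trajectories. -/
theorem Calculus.eq_zero_of_trajectory (hir : C.v .r * ir = 1) {f : R}
    (hu : C.d (.q .u) f = 0)
    (h : C.d .t f + C.v .v * ir * C.d (.q .θ) f + C.v .u * ir * C.rotO f = 0) :
    C.d .t f = 0 ∧ C.d (.q .θ) f = 0 ∧ C.rotO f = 0 := by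
  have h1 : C.rotO f = 0 := by
    have e := congrArg (C.d (.q .u)) h
    simp [C.rotO_apply, C.d_v, C.d_inv hir, C.d_comm_zero hu] at e
    have e' : ir * C.rotO f = 0 := by
      rw [C.rotO_apply]; linear_combination e
    linear_combination C.v .r * e' - C.rotO f * hir
  have h2 : C.d .t f = -(C.v .v * ir * C.d (.q .θ) f) := by
    rw [h1] at h; linear_combination h
  -- The derivations `∂_t + (v/r) ∂_θ` and `rotO` both annihilate `f`, hence so does their
  -- commutator. Since `rotO (v/r) = -2v/r`, this is a multiple of `(v/r) ∂_θ`.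
  have h3 : C.d (.q .θ) f = 0 := by
    have a1 := congrArg (C.d .t) h1
    have a2 := congrArg (C.d (.q .θ)) h1
    have a3 := congrArg (C.d (.q .r)) h2
    have a4 := congrArg (C.d (.q .v)) h2
    have a5 := congrArg (C.d (.q .Hθ)) h2
    simp [C.rotO_apply, C.d_v, C.d_inv hir] at a1 a2 a3 a4 a5
    rw [C.comm (.q .r)] at a3
    rw [C.comm (.q .v)] at a4
    rw [C.comm (.q .Hθ)] at a5
    rw [C.comm (.q .r) (.q .θ)] at a3
    rw [C.comm (.q .v) (.q .θ)] at a4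
    rw [C.comm (.q .Hθ) (.q .θ)] at a5
    refine C.cancel (.q .v) _ (Calculus.cancel_const (c := 2) (by simp) ?_)
    rw [map_ofNat]
    linear_combination C.v .r * (a1 - C.v .r * a3 + C.v .v * a4 - C.v .Hθ * a5
      + C.v .v * ir * a2) - C.v .v * C.d (.q .θ) f * (C.v .r * ir + 2) * hir
  refine ⟨by rw [h2, h3]; ring, h3, h1⟩

/-- Functions of `s`, `r v`, `p / ρ ^ γ`, `H^θ / (r ρ)`, `H^z / ρ`, characterized by their
derivatives. -/
def Calculus.IsInvariantO (C : Calculus VarO R) (γ : ℝ) (f : R) : Prop :=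
  C.d .t f = 0 ∧ C.d (.q .θ) f = 0 ∧ C.d (.q .u) f = 0 ∧ C.scaleO γ f = 0 ∧ C.rotO f = 0

end CaseO

section CaseO

variable {R : Type*} [CommRing R] [Algebra ℝ R] {C : Calculus VarO R} {γ : ℝ}
  {ir iρ ξt ξs : R} {η : VarO → R}

/-- The solution of the determining equations in the case `A = 0`. -/
theorem IsSymmetryO.solve (hγ : 1 < γ) (hir : C.v .r * ir = 1) (hiρ : C.v .ρ * iρ = 1)
    (h : IsSymmetryO C (algebraMap ℝ R γ) ir iρ ξt ξs η) :
    ∃ m k β : R, (∀ i, C.d i m = 0) ∧ (∀ i, C.d i k = 0) ∧ (∀ i, C.d i (C.d .t ξt) = 0) ∧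
      (C.d .t ξs = 0 ∧ C.d .s ξs = 2 * C.d .t ξt + 2 * k ∧ ∀ a, C.d (.q a) ξs = 0) ∧
      (C.d .s ξt = 0 ∧ ∀ a, C.d (.q a) ξt = 0) ∧
      (η .r = C.v .r * m ∧ η .u = C.v .u * (m - C.d .t ξt) ∧ η .v = C.v .v * (m - C.d .t ξt) ∧
        η .ρ = C.v .ρ * (2 * C.d .t ξt + 2 * k - 2 * m) ∧ η .p = 2 * C.v .p * k - C.v .Hz * β ∧
        η .Hθ = C.v .Hθ * k ∧ η .Hz = C.v .Hz * k + β) ∧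
      (algebraMap ℝ R γ - 2) * β = 0 ∧ C.IsInvariantO γ (η .θ) ∧ C.IsInvariantO γ (iρ * β) := by
  obtain ⟨⟨st, sq⟩, -, rq⟩ := h.base hir hiρ
  have hγ0 : γ ≠ 0 := by positivity
  obtain ⟨⟨ts, tq⟩, ⟨ηu, ηρ⟩, θu, vu, pu, hu, ku⟩ := h.kinematics hγ0 hir hiρ
  obtain ⟨⟨Eθ, -, -, -, Ek⟩, -⟩ := h.transport_coefficients hγ0 hir hiρ
  obtain ⟨rs, hK⟩ := h.total_pressure hγ hir hiρ
  obtain ⟨m, mc, Bc, bc, er, ev, eh⟩ := h.velocity hγ hir hiρ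
  have two : ∀ f g : R, 2 * (f - g) = 0 → f = g := fun f g hf =>
    sub_eq_zero.1 (Calculus.cancel_const (c := 2) (by simp) (by rwa [map_ofNat]))
  -- `k = ∂_s ξs / 2 - ∂_t ξt` is the scaling rate of `Hθ`, to which `X₄` and `X₅` contribute with
  -- opposite signs.
  obtain ⟨k, hk⟩ : ∃ k : R, C.d .s ξs = 2 * C.d .t ξt + 2 * k :=
    ⟨algebraMap ℝ R (1 / 2) * (C.d .s ξs - 2 * C.d .t ξt), by
      have : (2 : R) * algebraMap ℝ R (1 / 2) = 1 := by
        rw [← map_ofNat (algebraMap ℝ R) 2, ← map_mul]; norm_num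
      linear_combination -(C.d .s ξs - 2 * C.d .t ξt) * this⟩
  have kc : ∀ i, C.d i k = 0 := fun i => two _ _ (by
    have e := congrArg (C.d i) hk
    simp [C.d_two, Bc, bc] at e
    linear_combination -e)
  -- `β` is the deviation of `η Hz` from pure scaling. Total pressure transfers it to `η p` as `-Hz
  -- β`, and the factor `γ - 2` annihilates it.
  obtain ⟨β, hβ⟩ : ∃ β, β = η .Hz - C.v .Hz * k := ⟨_, rfl⟩
  have ek : η .Hz = C.v .Hz * k + β := by rw [hβ]; ring
  have hrr : C.d (.q .r) (η .r) = m := by rw [er]; simp [C.d_v, mc]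
  have hrt : C.d .t (η .r) = 0 := by rw [er]; simp [C.d_v, mc]
  rw [hrr, hrt] at ηu
  rw [hrr, rs, hk, er] at ηρ
  have eh' : η .Hθ = C.v .Hθ * k := two _ _ (by rw [hk] at eh; linear_combination eh)
  obtain ⟨hQ, hp⟩ := hK (2 * k) (by rw [hrr, hk, er]; linear_combination m * hir)
  have ep : η .p = 2 * C.v .p * k - C.v .Hz * β := two _ _ (by
    rw [eh', ek] at hQ
    linear_combination hQ)
  have hγβ : (algebraMap ℝ R γ - 2) * β = 0 := C.cancel (.q .Hz) _ (by
    rw [ep] at hp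
    linear_combination -hp)
  have βu : C.d (.q .u) β = 0 := by rw [hβ]; simp [C.d_v, kc, ku]
  have Eβ : C.scaleO γ β = β := by
    have e : C.scaleO γ (C.v .Hz * k) = C.v .Hz * k := by simp [C.scaleO_apply, C.d_v, kc]
    rw [hβ, map_sub, Ek, e, rs]; ring
  refine ⟨m, k, β, mc, kc, Bc, ⟨st, hk, sq⟩, ⟨ts, tq⟩, ⟨er, ?_, ev, ?_, ep, eh', ek⟩, hγβ, ?_, ?_⟩
  · rw [ηu]; ring
  · rw [ηρ]; linear_combination -C.v .ρ * m * hir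
  · have F := h.reduce hir hiρ (sderivO (ir * iρ) 0 0 0 0 0 0 0) rfl .θ
    simp [Calculus.tot, VarO.sum_eq, flowO, dflowO, sderivO, tq, θu, er, ev] at F
    rw [C.scaleO_apply] at Eθ
    -- Adding `u/r` times the `scaleO` relation turns the u-part of the flow derivative into `(u/r)
    -- rotO`.
    obtain ⟨h1, h2, h3⟩ := C.eq_zero_of_trajectory hir θu (by
      rw [C.rotO_apply]
      linear_combination F + C.v .u * ir * Eθ
        + (C.v .u * C.d (.q .r) (η .θ) - C.v .v * ir * m) * hir)
    exact ⟨h1, h2, θu, by rw [C.scaleO_apply, Eθ], h3⟩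
  · have F := h.reduce hir hiρ (sderivO (ir * iρ) 0 0 0 0 0 0 0) rfl .Hz
    have uu : C.d .s (η .u) = 0 := by rw [ηu]; simp [C.d_v, mc, Bc]
    have uq : ∀ a, a ≠ .u → C.d (.q a) (η .u) = 0 := fun a ha => by
      rw [ηu]; simp [C.d_v, mc, Bc, ha]
    simp [Calculus.tot, VarO.sum_eq, flowO, dflowO, sderivO, tq, ts, er, ek, C.d_v, kc, βu, uu,
      uq] at F
    have Eβ' := Eβ
    rw [C.scaleO_apply] at Eβ
    obtain ⟨h1, h2, h3⟩ := C.eq_zero_of_trajectory hir βu (by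
      rw [C.rotO_apply]
      linear_combination F + C.v .u * ir * Eβ - ir * C.v .Hz * ηu
        + (C.v .u * C.d (.q .r) β + ir * C.v .Hz * C.v .u * m) * hir)
    have Er : C.rotO iρ = 0 := by simp [C.rotO_apply, C.d_inv hiρ]
    have Ei : C.scaleO γ iρ = -iρ := by
      simp [C.scaleO_apply, C.d_inv hiρ]; linear_combination iρ * hiρ
    refine ⟨?_, ?_, ?_, ?_, ?_⟩
    · simp [C.d_inv hiρ, h1]
    · simp [C.d_inv hiρ, h2]
    · simp [C.d_inv hiρ, βu]
    · simp [Ei, Eβ']; ring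
    · simp [Er, h3]

end CaseO

/-! ### Invariants and the form of the generators for A = 0 -/

section CaseO

open TopologicalSpace Smooth

theorem isOpen_domainO : IsOpen domainO :=
  (isOpen_lt continuous_const (Coord.fn (.q VarO.r)).continuous).inter
    (isOpen_lt continuous_const (Coord.fn (.q VarO.ρ)).continuous)

/-- The projection to the variables `s`, `v`, `p`, `H^θ`, `H^z`. -/
noncomputable def projO : Base VarO →L[ℝ] ℝ × ℝ × ℝ × ℝ × ℝ :=
  (Coord.fn .s).prod ((Coord.fn (.q .v)).prod ((Coord.fn (.q .p)).prod
    ((Coord.fn (.q .Hθ)).prod (Coord.fn (.q .Hz)))))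

/-- The inclusion of the variables `s`, `v`, `p`, `H^θ`, `H^z`. -/
noncomputable def inclO : ℝ × ℝ × ℝ × ℝ × ℝ →L[ℝ] Base VarO :=
  (0 : ℝ × ℝ × ℝ × ℝ × ℝ →L[ℝ] ℝ).prod ((ContinuousLinearMap.fst ℝ ℝ _).prod
    (ContinuousLinearMap.pi fun
      | .v => .comp (.fst ℝ _ _) (.snd ℝ _ _)
      | .p => .comp (.fst ℝ _ _) (.comp (.snd ℝ _ _) (.snd ℝ _ _))
      | .Hθ => .comp (.fst ℝ _ _) (.comp (.snd ℝ _ _) (.comp (.snd ℝ _ _) (.snd ℝ _ _)))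
      | .Hz => .comp (.snd ℝ _ _) (.comp (.snd ℝ _ _) (.comp (.snd ℝ _ _) (.snd ℝ _ _)))
      | _ => 0))

/-- The change of variables `v ↦ r v`, `p ↦ p / ρ ^ γ`, `H^θ ↦ H^θ / (r ρ)`, `H^z ↦ H^z / ρ`. -/
noncomputable def toInvO (γ : ℝ) (y : Base VarO) : Base VarO :=
  (y.1, y.2.1, fun
    | .v => y.2.2 .r * y.2.2 .v
    | .p => y.2.2 .p / y.2.2 .ρ ^ γ
    | .Hθ => y.2.2 .Hθ / (y.2.2 .r * y.2.2 .ρ)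
    | .Hz => y.2.2 .Hz / y.2.2 .ρ
    | a => y.2.2 a)

/-- The inverse of `toInvO`. -/
noncomputable def ofInvO (γ : ℝ) (y : Base VarO) : Base VarO :=
  (y.1, y.2.1, fun
    | .v => y.2.2 .v / y.2.2 .r
    | .p => y.2.2 .p * y.2.2 .ρ ^ γ
    | .Hθ => y.2.2 .Hθ * (y.2.2 .r * y.2.2 .ρ)
    | .Hz => y.2.2 .Hz * y.2.2 .ρ
    | a => y.2.2 a)

theorem contDiffOn_ofInvO (γ : ℝ) : ContDiffOn ℝ ∞ (ofInvO γ) domainO ∧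
    ContDiffOn ℝ ∞ (toInvO γ) domainO := by
  have hval : ∀ a : VarO, ContDiffOn ℝ ∞ (fun y : Base VarO => y.2.2 a) domainO := fun a =>
    (Coord.fn (.q a)).contDiff.contDiffOn
  have hpos : ∀ y ∈ domainO, (0 : ℝ) < y.2.2 .ρ ^ γ := fun y hy => Real.rpow_pos_of_pos hy.2 γ
  have hsm : ContDiffOn ℝ ∞ (fun y : Base VarO => y.2.2 .ρ ^ γ) domainO :=
    (hval .ρ).rpow_const_of_ne fun y hy => hy.2.ne'
  constructor
  · refine contDiff_fst.contDiffOn.prodMk ((contDiff_fst.comp contDiff_snd).contDiffOn.prodMk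
      (contDiffOn_pi.2 fun a => ?_))
    cases a
    case v => exact (hval .v).div (hval .r) fun y hy => hy.1.ne'
    case p => exact (hval .p).mul hsm
    case Hθ => exact (hval .Hθ).mul ((hval .r).mul (hval .ρ))
    case Hz => exact (hval .Hz).mul (hval .ρ)
    all_goals exact hval _
  · refine contDiff_fst.contDiffOn.prodMk ((contDiff_fst.comp contDiff_snd).contDiffOn.prodMk
      (contDiffOn_pi.2 fun a => ?_))
    cases a
    case v => exact (hval .r).mul (hval .v)
    case p => exact (hval .p).div hsm fun y hy => (hpos y hy).ne'
    case Hθ =>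
      exact (hval .Hθ).div ((hval .r).mul (hval .ρ)) fun y hy => (mul_pos hy.1 hy.2).ne'
    case Hz => exact (hval .Hz).div (hval .ρ) fun y hy => hy.2.ne'
    all_goals exact hval _

/-- Both `scaleO` and `rotO` annihilate the four nontrivial invariants. In the variables of `toInvO`
they become multiples of `∂_ρ` and `∂_r`. -/
theorem exists_local_factorO {γ : ℝ} {U : Opens (Base VarO)}
    (hU : (U : Set (Base VarO)) ⊆ domainO) (f : Smooth U)
    (hf : (smoothCalculus U).IsInvariantO γ f) (y₀ : U) :
    ∃ V : Set (Base VarO), IsOpen V ∧ (y₀ : Base VarO) ∈ V ∧ V ⊆ U ∧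
      ∃ F : ℝ × ℝ × ℝ × ℝ × ℝ → ℝ,
      ∀ y : U, (y : Base VarO) ∈ V → ContDiffAt ℝ ∞ F (invO γ y) ∧ eval y f = F (invO γ y) := by
  obtain ⟨ht, hθ, hu, hE, hL⟩ := hf
  rw [Calculus.scaleO_apply] at hE
  rw [Calculus.rotO_apply] at hL
  simp only [smoothCalculus, Calculus.v] at ht hθ hu hE hL
  have hpos : ∀ y ∈ domainO, (0 : ℝ) < y.2.2 .ρ ^ γ := fun y hy => Real.rpow_pos_of_pos hy.2 γ
  refine exists_local_factor f isOpen_domainO hU (Φ := toInvO γ) (Ψ := ofInvO γ)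
    (contDiffOn_ofInvO γ).2.continuousOn (fun y hy => hy) (contDiffOn_ofInvO γ).1
    (fun y hy => ?_) (fun y hy => ?_) projO inclO (fun g => ?_) (fun y w hw => ?_) y₀
  · have h1 := (hpos y hy).ne'
    have h2 := hy.1.ne'
    have h3 := hy.2.ne'
    refine Coord.ext ?_
    rintro (_ | _ | a)
    · rfl
    · rfl
    · cases a <;> simp [toInvO, ofInvO, Coord.fn] <;> field_simp
  · have h1 := (hpos y hy).ne'
    have h2 := hy.1.ne'
    have h3 := hy.2.ne'
    refine Coord.ext ?_
    rintro (_ | _ | a)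
    · rfl
    · rfl
    · cases a <;> simp [toInvO, ofInvO, Coord.fn] <;> field_simp
  · simp [projO, inclO, Coord.fn]
  · have hry : (0 : ℝ) < (y : Base VarO).2.2 .r := (hU y.2).1
    have hρy : (0 : ℝ) < (y : Base VarO).2.2 .ρ := (hU y.2).2
    simp only [projO, ContinuousLinearMap.prod_apply, Prod.mk_eq_zero] at hw
    simp only [Coord.fn] at hw
    obtain ⟨ws, wv, wp, wh, wk⟩ := hw
    change w.2.1 = 0 at ws
    change w.2.2 _ = 0 at wv wp wh wk
    -- The changes of `v, p, Hθ, Hz` that keep the invariants fixed when `r` and `ρ` vary.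
    refine ⟨(w.1, 0, fun
      | .v => -((y : Base VarO).2.2 .v / (y : Base VarO).2.2 .r * w.2.2 .r)
      | .p => γ * ((y : Base VarO).2.2 .p / (y : Base VarO).2.2 .ρ) * w.2.2 .ρ
      | .Hθ => (y : Base VarO).2.2 .Hθ / (y : Base VarO).2.2 .r * w.2.2 .r
          + (y : Base VarO).2.2 .Hθ / (y : Base VarO).2.2 .ρ * w.2.2 .ρ
      | .Hz => (y : Base VarO).2.2 .Hz / (y : Base VarO).2.2 .ρ * w.2.2 .ρ
      | a => w.2.2 a), ?_, ?_⟩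
    · have hv := fun a => hasDirDeriv_val a (toInvO γ y) w
      rintro (_ | _ | a)
      · exact hasDirDeriv_t _ _
      · exact (hasDirDeriv_s _ _).congr_deriv ws
      · cases a
        case v =>
          refine HasDirDeriv.congr_deriv ((hv .v).div (hv .r) hry.ne') ?_
          simp [toInvO, wv, Coord.fn]
          field_simp
        case p =>
          refine HasDirDeriv.congr_deriv ((hv .p).mul ((hv .ρ).rpow_const hρy.ne' γ)) ?_
          simp [toInvO, wp, Coord.fn, Real.rpow_sub_one hρy.ne']
          field_simp
        case Hθ =>
          refine HasDirDeriv.congr_deriv ((hv .Hθ).mul ((hv .r).mul (hv .ρ))) ?_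
          simp [toInvO, wh, Coord.fn]
          field_simp
          ring
        case Hz =>
          refine HasDirDeriv.congr_deriv ((hv .Hz).mul (hv .ρ)) ?_
          simp [toInvO, wk, Coord.fn]
        all_goals exact hv _
    · rw [fderiv_eq_sum (f := f) (extend_apply f), VarO.sum_eq]
      replace hE := congrArg (eval y) hE
      replace hL := congrArg (eval y) hL
      simp only [map_add, map_sub, map_mul, AlgHom.commutes, map_zero] at hE hL
      simp only [ht, hθ, hu, map_zero, mul_zero, add_zero, zero_mul, zero_add]
      field_simp
      change (y : Base VarO).2.2 .ρ * _ + γ * (y : Base VarO).2.2 .p * _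
        + (y : Base VarO).2.2 .Hθ * _ + (y : Base VarO).2.2 .Hz * _ = 0 at hE
      change (y : Base VarO).2.2 .r * _ - (y : Base VarO).2.2 .v * _
        + (y : Base VarO).2.2 .Hθ * _ = 0 at hL
      linear_combination w.2.2 .ρ * (y : Base VarO).2.2 .r * hE
        + w.2.2 .r * (y : Base VarO).2.2 .ρ * hL

end CaseO

section CaseO

open TopologicalSpace Smooth

/-- The symmetries of the system for `A = 0`. -/
theorem Admits.eq_combinationO {γ : ℝ} (hγ : 1 < γ) {U : Set (Base VarO)}
    (hUo : IsOpen U) (hU : U ⊆ domainO) (hUc : IsPreconnected U) {X : Base VarO → Base VarO}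
    (hX : Admits (systemO γ) U X) :
    ∃ a₁ a₂ a₃ a₄ a₅ : ℝ, ∀ y₀ ∈ U, ∃ V : Set (Base VarO), IsOpen V ∧ y₀ ∈ V ∧ V ⊆ U ∧
      ∃ f₁ f₂ : ℝ × ℝ × ℝ × ℝ × ℝ → ℝ,
        (∀ y ∈ V, ContDiffAt ℝ ∞ f₁ (invO γ y) ∧ ContDiffAt ℝ ∞ f₂ (invO γ y)) ∧
        (γ ≠ 2 → ∀ y ∈ V, f₂ (invO γ y) = 0) ∧
        ∀ y ∈ V, X y = a₁ • O1 y + a₂ • O2 y + a₃ • O3 y + a₄ • O4 y + a₅ • O5 y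
          + O6 γ f₁ y + O7 γ f₂ y := by
  lift U to Opens (Base VarO) using hUo
  obtain ⟨ir, iρ, hir, hiρ, hS⟩ := hX.isSymmetryO hU
  obtain ⟨m, k, β, hm, hk, hB, ⟨st, ss, sq⟩, ⟨ts, tq⟩, ⟨er, eu, ev, eρ, ep, eh, ek⟩, hβ,
    iθ, iβ⟩ := hS.solve hγ hir hiρ
  simp only [smoothCalculus, Calculus.v] at hm hk hB st ss sq ts tq er eu ev eρ ep eh ek
  obtain ⟨a₄, rfl⟩ := Smooth.eq_const hUc hm
  obtain ⟨k, rfl⟩ := Smooth.eq_const hUc hk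
  obtain ⟨a₃, h₃⟩ := Smooth.eq_const hUc hB
  rw [h₃] at ss eu ev eρ
  have ht : ∃ a₁ : ℝ, coeff hX.1 .t - algebraMap ℝ _ a₃ * crd .t = algebraMap ℝ _ a₁ :=
    Smooth.eq_const hUc (by
      rintro (_ | _ | a) <;> simp [par_crd, h₃, ts, tq])
  have hs : ∃ a₂ : ℝ, coeff hX.1 .s - (2 * algebraMap ℝ _ a₃ + 2 * algebraMap ℝ _ k) * crd .s =
      algebraMap ℝ _ a₂ := Smooth.eq_const hUc (by
    have h2 := fun i => (smoothCalculus U).d_two i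
    rintro (_ | _ | a) <;> simp [par_crd, st, sq, ss, show ∀ i, par i 2 = 0 from h2] )
  obtain ⟨a₁, h₁⟩ := ht
  obtain ⟨a₂, h₂⟩ := hs
  -- The field `Hθ` is scaled by `a₅ - a₄`, which must equal `k`.
  refine ⟨a₁, a₂, a₃, a₄, k + a₄, fun y₀ hy₀ => ?_⟩
  obtain ⟨V₁, hV₁, hy₁, hU₁, f₁, hf₁⟩ := exists_local_factorO hU _ iθ ⟨y₀, hy₀⟩
  obtain ⟨V₂, hV₂, hy₂, hU₂, f₂, hf₂⟩ := exists_local_factorO hU _ iβ ⟨y₀, hy₀⟩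
  have c2 : ∀ (z : U) i, eval z (crd i) = Coord.fn i (z : Base VarO) := fun z i => rfl
  have h2 : ∀ z : U, eval z 2 = 2 := fun z => map_ofNat _ 2
  refine ⟨V₁ ∩ V₂, hV₁.inter hV₂, ⟨hy₁, hy₂⟩, fun y hy => hU₁ hy.1, f₁, f₂,
    fun y hy => ⟨(hf₁ ⟨y, hU₁ hy.1⟩ hy.1).1, (hf₂ ⟨y, hU₁ hy.1⟩ hy.2).1⟩, fun h y hy => ?_,
    fun y hy => ?_⟩
  -- The values of `f₂` are those of `β / ρ`, and `(γ - 2) β = 0`.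
  · rw [← (hf₂ ⟨y, hU₁ hy.1⟩ hy.2).2]
    have e := congrArg (eval ⟨y, hU₁ hy.1⟩) hβ
    simp only [map_mul, map_sub, AlgHom.commutes, h2, map_zero, mul_eq_zero] at e ⊢
    exact .inr (e.resolve_left (sub_ne_zero.2 h))
  set z : U := ⟨y, hU₁ hy.1⟩ with hz
  have e6 := (hf₁ z hy.1).2
  have e7 := (hf₂ z hy.2).2
  have c1 : ∀ i, eval z (coeff hX.1 i) = Coord.fn i (X y) := fun i => rfl
  replace c2 : ∀ i, eval z (crd i) = Coord.fn i y := c2 z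
  replace hiρ := congrArg (eval z) hiρ
  replace h₁ := congrArg (eval z) h₁
  replace h₂ := congrArg (eval z) h₂
  replace er := congrArg (eval z) er
  replace eu := congrArg (eval z) eu
  replace ev := congrArg (eval z) ev
  replace eρ := congrArg (eval z) eρ
  replace ep := congrArg (eval z) ep
  replace eh := congrArg (eval z) eh
  replace ek := congrArg (eval z) ek
  simp only [map_add, map_sub, map_mul, map_one, AlgHom.commutes, c1, c2, h2,
    Algebra.algebraMap_self, RingHom.id_apply] at h₁ h₂ er eu ev eρ ep eh ek e6 e7 hiρ
  refine Coord.ext fun i => ?_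
  simp only [Coord.fn] at h₁ h₂ er eu ev eρ ep eh ek e6 e7 hiρ ⊢
  rcases i with _ | _ | a
  · simp [O1, O2, O3, O4, O5, O6, O7] at h₁ h₂ ⊢
    linear_combination h₁
  · simp [O1, O2, O3, O4, O5, O6, O7] at h₁ h₂ ⊢
    linear_combination h₂
  · cases a <;>
      simp [O1, O2, O3, O4, O5, O6, O7] at er eu ev eρ ep eh ek e6 hiρ ⊢
    · linear_combination er
    · linear_combination e6
    · linear_combination eu
    · linear_combination ev
    · linear_combination eρ
    · linear_combination ep + y.2.2 .Hz * eval z β * hiρ - y.2.2 .Hz * y.2.2 .ρ * e7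
    · linear_combination eh
    · linear_combination ek - eval z β * hiρ + y.2.2 .ρ * e7

end CaseO

/-! ### Verification of the generators for A = 0 -/

section CaseO

theorem admitsO_of {γ : ℝ} {U : Set (Base VarO)} (hU : U ⊆ domainO)
    {X : Base VarO → Base VarO} (hX : ∀ i, ContDiffOn ℝ ∞ (fun y => Coord.fn i (X y)) U)
    (h : ∀ y ∈ U, ∀ τ σ : VarO → ℝ, σ .r = (y.2.2 .r)⁻¹ * (y.2.2 .ρ)⁻¹ →
      (∀ a, τ a = flowO γ (y.2.2 .r)⁻¹ (y.2.2 .ρ)⁻¹ y.2.2 σ a) → ∃ Xt Xs : Base VarO,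
      (∀ i, HasDirDeriv (fun y => Coord.fn i (X y)) y (1, 0, τ) (Coord.fn i Xt)) ∧
      (∀ i, HasDirDeriv (fun y => Coord.fn i (X y)) y (0, 1, σ) (Coord.fn i Xs)) ∧
      Xs.2.2 .r - τ .r * Xs.1 - σ .r * Xs.2.1 = -((y.2.2 .r)⁻¹ * (y.2.2 .ρ)⁻¹ *
        ((y.2.2 .r)⁻¹ * (X y).2.2 .r + (y.2.2 .ρ)⁻¹ * (X y).2.2 .ρ)) ∧
      ∀ a, Xt.2.2 a - τ a * Xt.1 - σ a * Xt.2.1 = dflowO γ (y.2.2 .r)⁻¹ (y.2.2 .ρ)⁻¹ y.2.2 σ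
        (X y).2.2 (fun a => Xs.2.2 a - τ a * Xs.1 - σ a * Xs.2.1) a) :
    Admits (systemO γ) U X := by
  refine ⟨contDiffOn_of_coord hX, fun j hj hF => ?_⟩
  have hr : j.1.2.2 .r ≠ 0 := (hU hj).1.ne'
  have hρ : j.1.2.2 .ρ ≠ 0 := (hU hj).2.ne'
  obtain ⟨h1, h2⟩ := (systemO_eq_zero_iff γ j hr hρ).1 hF
  obtain ⟨Xt, Xs, ht, hs, e1, e2⟩ := h j.1 hj j.2.1 j.2.2 h1 h2
  refine (fderiv_systemO_eq_zero_iff γ j _ hr hρ h1).2 ?_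
  rw [prolong_eq ht hs]
  exact ⟨e1, e2⟩

/-- Each coefficient is affine in its own coordinate alone, so one diagonal computation covers all
five generators. -/
theorem admitsO_affine {γ : ℝ} {U : Set (Base VarO)} (hU : U ⊆ domainO) (a₁ a₂ a₃ a₄ a₅ : ℝ)
    {X : Base VarO → Base VarO}
    (hX : ∀ y, X y = a₁ • O1 y + a₂ • O2 y + a₃ • O3 y + a₄ • O4 y + a₅ • O5 y) :
    Admits (systemO γ) U X := by
  obtain rfl : X = _ := funext hX
  have form : ∀ i : Coord VarO, ∃ c d : ℝ, (∀ y : Base VarO, Coord.fn i (a₁ • O1 y +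
      a₂ • O2 y + a₃ • O3 y + a₄ • O4 y + a₅ • O5 y) = c * Coord.fn i y + d) ∧
      ∀ v : Base VarO, Coord.fn i (a₃ • O3 v + a₄ • O4 v + a₅ • O5 v) = c * Coord.fn i v := by
    rintro (_ | _ | a)
    · exact ⟨a₃, a₁, by intro y; simp [Coord.fn, O1, O2, O3, O4, O5]; ring,
        by intro v; simp [Coord.fn, O3, O4, O5]⟩
    · exact ⟨2 * a₃ - 2 * a₄ + 2 * a₅, a₂, by intro y; simp [Coord.fn, O1, O2, O3, O4, O5]; ring,
        by intro v; simp [Coord.fn, O3, O4, O5]; ring⟩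
    refine ⟨match a with
      | .r => a₄
      | .θ => 0
      | .u => a₄ - a₃
      | .v => a₄ - a₃
      | .ρ => 2 * a₃ - 4 * a₄ + 2 * a₅
      | .p => 2 * a₅ - 2 * a₄
      | .Hθ => a₅ - a₄
      | .Hz => a₅ - a₄, 0, ?_, ?_⟩
    · intro y
      cases a <;> simp [Coord.fn, O1, O2, O3, O4, O5] <;> ring
    · intro v
      cases a <;> simp [Coord.fn, O3, O4, O5] <;> ring
  refine admitsO_of hU (fun i => ?_) fun y hy τ σ h1 h2 => ?_
  · obtain ⟨c, d, h5, -⟩ := form i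
    rw [funext h5]
    fun_prop
  · have key : ∀ i (v : Base VarO), HasDirDeriv (fun y => Coord.fn i (a₁ • O1 y + a₂ • O2 y +
        a₃ • O3 y + a₄ • O4 y + a₅ • O5 y)) y v
        (Coord.fn i (a₃ • O3 v + a₄ • O4 v + a₅ • O5 v)) := by
      intro i v
      have hc : ∀ c : ℝ, HasDirDeriv (fun _ : Base VarO => c) y v 0 := fun c => .const c
      obtain ⟨c, d, h5, h6⟩ := form i
      rw [h6, funext h5]
      exact (((hc c).mul (.linear (Coord.fn i))).add (hc d)).congr_deriv (by ring)
    have hr : y.2.2 .r ≠ 0 := (hU hy).1.ne'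
    have hρ : y.2.2 .ρ ≠ 0 := (hU hy).2.ne'
    refine ⟨_, _, fun i => key i _, fun i => key i _, ?_, fun a => ?_⟩
    · simp [val, h1, h2, O1, O2, O3, O4, O5]
      field_simp
      ring
    · cases a <;> simp [val, h1, h2, O1, O2, O3, O4, O5, flowO, dflowO] <;> field_simp <;> ring

theorem hasDirDeriv_invO {γ : ℝ} {y v : Base VarO} (hr : 0 < y.2.2 .r) (hρ : 0 < y.2.2 .ρ) :
    HasDirDeriv (invO γ) y v (v.2.1, y.2.2 .r * v.2.2 .v + y.2.2 .v * v.2.2 .r,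
      (v.2.2 .p - γ * y.2.2 .p * v.2.2 .ρ / y.2.2 .ρ) / y.2.2 .ρ ^ γ,
      (v.2.2 .Hθ - y.2.2 .Hθ * (v.2.2 .r / y.2.2 .r + v.2.2 .ρ / y.2.2 .ρ)) /
        (y.2.2 .r * y.2.2 .ρ),
      (v.2.2 .Hz - y.2.2 .Hz * v.2.2 .ρ / y.2.2 .ρ) / y.2.2 .ρ) := by
  have h := Real.rpow_pos_of_pos hρ γ
  have h0 := fun a => hasDirDeriv_val a y v
  refine (hasDirDeriv_s y v).prodMk (((h0 .r).mul (h0 .v)).prodMk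
    ((((h0 .p).div ((h0 .ρ).rpow_const hρ.ne' γ) h.ne').congr_deriv ?_).prodMk
    ((((h0 .Hθ).div ((h0 .r).mul (h0 .ρ)) (mul_pos hr hρ).ne').congr_deriv ?_).prodMk
    (((h0 .Hz).div (h0 .ρ) hρ.ne').congr_deriv ?_))))
  · rw [Real.rpow_sub_one hρ.ne']
    field_simp
  · field_simp
    ring
  · field_simp

theorem contDiffAt_invO {γ : ℝ} {y : Base VarO} (hr : 0 < y.2.2 .r) (hρ : 0 < y.2.2 .ρ) :
    ContDiffAt ℝ ∞ (invO γ) y := by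
  have h1 : ∀ a : VarO, ContDiffAt ℝ ∞ (fun y : Base VarO => y.2.2 a) y := fun a => by fun_prop
  exact ContDiffAt.prodMk (by fun_prop) (((h1 .r).mul (h1 .v)).prodMk
    (((h1 .p).div ((h1 .ρ).rpow_const_of_ne hρ.ne') (Real.rpow_pos_of_pos hρ γ).ne').prodMk
    (((h1 .Hθ).div ((h1 .r).mul (h1 .ρ)) (mul_pos hr hρ).ne').prodMk
    ((h1 .Hz).div (h1 .ρ) hρ.ne'))))

/-- Without a radial field, angular momentum, entropy and the two frozen-in magnetic quantities are
constant along particle trajectories. -/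
theorem hasDirDeriv_comp_invO {γ : ℝ} {y : Base VarO} (hr : 0 < y.2.2 .r) (hρ : 0 < y.2.2 .ρ)
    {f : ℝ × ℝ × ℝ × ℝ × ℝ → ℝ} (hf : ContDiffAt ℝ ∞ f (invO γ y)) {τ σ : VarO → ℝ}
    (h : ∀ a, τ a = flowO γ (y.2.2 .r)⁻¹ (y.2.2 .ρ)⁻¹ y.2.2 σ a) :
    HasDirDeriv (fun y => f (invO γ y)) y (1, 0, τ) 0 := by
  refine (HasDirDeriv.comp (hf.differentiableAt (by simp))
    (hasDirDeriv_invO hr hρ)).congr_deriv ?_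
  suffices h0 : _ = (0 : ℝ × ℝ × ℝ × ℝ × ℝ) from
    (congrArg (fderiv ℝ f (invO γ y)) h0).trans (map_zero _)
  refine Prod.ext rfl (Prod.ext ?_ (Prod.ext ?_ (Prod.ext ?_ ?_)))
  · change _ * τ .v + _ * τ .r = 0
    rw [h, h]
    simp only [flowO]
    field_simp
    ring
  · change (τ .p - _ * τ .ρ / _) / _ = 0
    rw [h, h, div_eq_zero_iff]
    left
    simp only [flowO]
    field_simp
    ring
  · change (τ .Hθ - _ * (τ .r / _ + τ .ρ / _)) / _ = 0
    rw [h, h, h, div_eq_zero_iff]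
    left
    simp only [flowO]
    field_simp
    ring
  · change (τ .Hz - _ * τ .ρ / _) / _ = 0
    rw [h, h, div_eq_zero_iff]
    left
    simp only [flowO]
    field_simp
    ring

/-- For `γ = 2` both `p` and `Hz²` are carried like `ρ²`. The shift of `Hz` by `ρ f` is compensated
to first order by that of `p`, so the total pressure and the transport laws are preserved. -/
theorem admitsO_fiber {γ : ℝ} {U : Set (Base VarO)} (hU : U ⊆ domainO)
    {f : ℝ × ℝ × ℝ × ℝ × ℝ → ℝ} (hf : ∀ y ∈ U, ContDiffAt ℝ ∞ f (invO γ y)) :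
    Admits (systemO γ) U (O6 γ f) ∧ (γ = 2 → Admits (systemO γ) U (O7 γ f)) := by
  have hc : ∀ y v : Base VarO, HasDirDeriv (fun _ : Base VarO => (0 : ℝ)) y v 0 :=
    fun y v => .const 0
  have hs : ContDiffOn ℝ ∞ (fun y => f (invO γ y)) U := fun y hy =>
    ((hf y hy).comp y (contDiffAt_invO (hU hy).1 (hU hy).2)).contDiffWithinAt
  have hval : ∀ a : VarO, ContDiffOn ℝ ∞ (fun y : Base VarO => y.2.2 a) U := fun a =>
    (Coord.fn (.q a)).contDiff.contDiffOn
  constructor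
  · have key : ∀ y (v : Base VarO) d, HasDirDeriv (fun y => f (invO γ y)) y v d →
        ∀ i, HasDirDeriv (fun y => Coord.fn i (O6 γ f y)) y v (Coord.fn i (0, 0, fun
          | .θ => d
          | _ => 0)) := by
      rintro y v d hd (_ | _ | a)
      · exact hc y v
      · exact hc y v
      · cases a
        case θ => exact hd
        all_goals exact hc y v
    refine admitsO_of hU ?_ fun y hy τ σ h1 h2 => ?_
    · rintro (_ | _ | a)
      · exact contDiffOn_const
      · exact contDiffOn_const
      · cases a
        case θ => exact hs
        all_goals exact contDiffOn_const
    · refine ⟨_, _, key y _ _ (hasDirDeriv_comp_invO (hU hy).1 (hU hy).2 (hf y hy) h2),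
        key y _ _ (HasDirDeriv.comp ((hf y hy).differentiableAt (by simp))
          (hasDirDeriv_invO (hU hy).1 (hU hy).2)), ?_, fun a => ?_⟩
      · simp [O6]
      · cases a <;> simp [O6, dflowO]
  · rintro rfl
    have key : ∀ y (v : Base VarO) d, HasDirDeriv (fun y => f (invO 2 y)) y v d →
        ∀ i, HasDirDeriv (fun y => Coord.fn i (O7 2 f y)) y v (Coord.fn i (0, 0, fun
          | .Hz => y.2.2 .ρ * d + f (invO 2 y) * v.2.2 .ρ
          | .p => -(y.2.2 .ρ * f (invO 2 y) * v.2.2 .Hz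
            + y.2.2 .Hz * (y.2.2 .ρ * d + f (invO 2 y) * v.2.2 .ρ))
          | _ => 0)) := by
      intro y v d hd
      have h0 := fun a => hasDirDeriv_val a y v
      rintro (_ | _ | a)
      · exact hc y v
      · exact hc y v
      · cases a
        case Hz => exact (h0 .ρ).mul hd
        case p => exact (((h0 .ρ).mul hd).mul (h0 .Hz)).neg
        all_goals exact hc y v
    refine admitsO_of hU ?_ fun y hy τ σ h1 h2 => ?_
    · rintro (_ | _ | a)
      · exact contDiffOn_const
      · exact contDiffOn_const
      · cases a
        case Hz => exact (hval .ρ).mul hs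
        case p => exact (((hval .ρ).mul hs).mul (hval .Hz)).neg
        all_goals exact contDiffOn_const
    · refine ⟨_, _, key y _ _ (hasDirDeriv_comp_invO (hU hy).1 (hU hy).2 (hf y hy) h2),
        key y _ _ (HasDirDeriv.comp ((hf y hy).differentiableAt (by simp))
          (hasDirDeriv_invO (hU hy).1 (hU hy).2)), ?_, fun a => ?_⟩
      · simp [O7]
      · cases a <;> simp [O7, val, h2, flowO, dflowO] <;> ring

theorem admitsO {γ : ℝ} {U : Set (Base VarO)} (hU : U ⊆ domainO) :
    Admits (systemO γ) U O1 ∧ Admits (systemO γ) U O2 ∧ Admits (systemO γ) U O3 ∧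
      Admits (systemO γ) U O4 ∧ Admits (systemO γ) U O5 :=
  ⟨admitsO_affine hU 1 0 0 0 0 (by simp), admitsO_affine hU 0 1 0 0 0 (by simp),
    admitsO_affine hU 0 0 1 0 0 (by simp), admitsO_affine hU 0 0 0 1 0 (by simp),
    admitsO_affine hU 0 0 0 0 1 (by simp)⟩

end CaseO

end MHD

/-! ### The classification theorem -/

theorem mainTheorem5 (γ : ℝ) (hγ : 1 < γ) :
    (∀ A : ℝ, A ≠ 0 → ∀ U : Set (Base VarA), IsOpen U → U ⊆ domainA →
      Admits (systemA γ A) U A1 ∧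
      Admits (systemA γ A) U A2 ∧
      Admits (systemA γ A) U A3 ∧
      Admits (systemA γ A) U A4 ∧
      Admits (systemA γ A) U A5 ∧
      (∀ f : ℝ × ℝ → ℝ, (∀ y ∈ U, ContDiffAt ℝ ∞ f (invA γ y)) →
        Admits (systemA γ A) U (A6 γ f)) ∧
      (∀ f : ℝ × ℝ → ℝ, (∀ y ∈ U, ContDiffAt ℝ ∞ f (invA γ y)) →
        Admits (systemA γ A) U (A7 γ f)) ∧
      (IsPreconnected U → ∀ X : Base VarA → Base VarA, Admits (systemA γ A) U X →
        ∃ a₁ a₂ a₃ a₄ a₅ : ℝ, ∀ y₀ ∈ U, ∃ V : Set (Base VarA), IsOpen V ∧ y₀ ∈ V ∧ V ⊆ U ∧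
          ∃ f₁ f₂ : ℝ × ℝ → ℝ,
            (∀ y ∈ V, ContDiffAt ℝ ∞ f₁ (invA γ y) ∧ ContDiffAt ℝ ∞ f₂ (invA γ y)) ∧
            ∀ y ∈ V, X y = a₁ • A1 y + a₂ • A2 y + a₃ • A3 y + a₄ • A4 y + a₅ • A5 y
              + A6 γ f₁ y + A7 γ f₂ y)) ∧
    (∀ U : Set (Base VarO), IsOpen U → U ⊆ domainO →
      Admits (systemO γ) U O1 ∧
      Admits (systemO γ) U O2 ∧
      Admits (systemO γ) U O3 ∧
      Admits (systemO γ) U O4 ∧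
      Admits (systemO γ) U O5 ∧
      (∀ f : ℝ × ℝ × ℝ × ℝ × ℝ → ℝ, (∀ y ∈ U, ContDiffAt ℝ ∞ f (invO γ y)) →
        Admits (systemO γ) U (O6 γ f)) ∧
      (γ ≠ 2 → IsPreconnected U → ∀ X : Base VarO → Base VarO, Admits (systemO γ) U X →
        ∃ a₁ a₂ a₃ a₄ a₅ : ℝ, ∀ y₀ ∈ U, ∃ V : Set (Base VarO), IsOpen V ∧ y₀ ∈ V ∧ V ⊆ U ∧
          ∃ f₁ : ℝ × ℝ × ℝ × ℝ × ℝ → ℝ,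
            (∀ y ∈ V, ContDiffAt ℝ ∞ f₁ (invO γ y)) ∧
            ∀ y ∈ V, X y = a₁ • O1 y + a₂ • O2 y + a₃ • O3 y + a₄ • O4 y + a₅ • O5 y
              + O6 γ f₁ y) ∧
      (γ = 2 →
        (∀ f : ℝ × ℝ × ℝ × ℝ × ℝ → ℝ, (∀ y ∈ U, ContDiffAt ℝ ∞ f (invO γ y)) →
          Admits (systemO γ) U (O7 γ f)) ∧
        (IsPreconnected U → ∀ X : Base VarO → Base VarO, Admits (systemO γ) U X →
          ∃ a₁ a₂ a₃ a₄ a₅ : ℝ, ∀ y₀ ∈ U, ∃ V : Set (Base VarO), IsOpen V ∧ y₀ ∈ V ∧ V ⊆ U ∧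
            ∃ f₁ f₂ : ℝ × ℝ × ℝ × ℝ × ℝ → ℝ,
              (∀ y ∈ V, ContDiffAt ℝ ∞ f₁ (invO γ y) ∧ ContDiffAt ℝ ∞ f₂ (invO γ y)) ∧
              ∀ y ∈ V, X y = a₁ • O1 y + a₂ • O2 y + a₃ • O3 y + a₄ • O4 y + a₅ • O5 y
                + O6 γ f₁ y + O7 γ f₂ y))) := by
  refine ⟨fun A hA U hUo hU => ?_, fun U hUo hU => ?_⟩
  · obtain ⟨h1, h2, h3, h4, h5, h6, h7⟩ := admitsA (γ := γ) (A := A) hU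
    exact ⟨h1, h2, h3, h4, h5, h6, h7, fun hUc X hX => hX.eq_combinationA hγ hA hUo hU hUc⟩
  · obtain ⟨h1, h2, h3, h4, h5⟩ := admitsO (γ := γ) hU
    refine ⟨h1, h2, h3, h4, h5, fun f hf => (admitsO_fiber hU hf).1, fun h hUc X hX => ?_,
      fun h => ⟨fun f hf => (admitsO_fiber hU hf).2 h, fun hUc X hX => ?_⟩⟩
    · obtain ⟨a₁, a₂, a₃, a₄, a₅, H⟩ := hX.eq_combinationO hγ hUo hU hUc
      refine ⟨a₁, a₂, a₃, a₄, a₅, fun y₀ hy₀ => ?_⟩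
      obtain ⟨V, hV, hy, hVU, f₁, f₂, hf, h0, e⟩ := H y₀ hy₀
      refine ⟨V, hV, hy, hVU, f₁, fun y hy => (hf y hy).1, fun y hy => ?_⟩
      -- For `γ ≠ 2` the function `f₂` vanishes at the invariants, so the last generator contributes
      -- nothing.
      have h7 : O7 γ f₂ y = 0 := Coord.ext (by
        rintro (_ | _ | a)
        · rfl
        · rfl
        · cases a <;> simp [O7, Coord.fn, h0 h y hy])
      rw [e y hy, h7, add_zero]
    · obtain ⟨a₁, a₂, a₃, a₄, a₅, H⟩ := hX.eq_combinationO hγ hUo hU hUc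
      refine ⟨a₁, a₂, a₃, a₄, a₅, fun y₀ hy₀ => ?_⟩
      obtain ⟨V, hV, hy, hVU, f₁, f₂, hf, -, e⟩ := H y₀ hy₀
      exact ⟨V, hV, hy, hVU, f₁, f₂, hf, e⟩
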